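/- **Hammocks.** For $l,w\ge 1$ put $n=lw$. The hammock (brick-wall) network $H_{(l,w)}$ has $w$ rows of $l$ contacts, the $j$-th contact of row $i$ ($0\le i<w$, $0\le j<l$) joining the nodes $(i,j)$ and $(i,j+1)$; all nodes $(i,0)$ are identified (source), all nodes $(i,l)$ are identified (sink), and $(i,j)$, $(i+1,j)$ with $0<j<l$ are identified whenever $i+j+\varepsilon$ is even. Here $\varepsilon\in\{0,1\}$ is fixed (if $l$ or $w$ is odd, both choices give isomorphic networks); the dual hammock $H_{(w,l)}$ is the network with $l$ and $w$ exchanged and $\varepsilon$ replaced by $1-\varepsilon$. Let $N_k$, resp. $N_k^{\perp}$, be the number of $k$-element sets of contacts of $H_{(l,w)}$, resp. $H_{(w,l)}$, whose closing connects source and sink. The reliability polynomials (the probabilities of connection when each contact is closed independently with probability $p$) are $$h_{(l,w)}(p)=\sum_{k=0}^n N_kp^k(1-p)^{n-k},\qquad h_{(w,l)}(p)=\sum_{k=0}^n N_k^{\perp}p^k(1-p)^{n-k}.$$ **Approximation procedure.** For real $a,b$ let $f_{(l,w)}:[0,n]\to\mathbb R$ be $0$ on $[0,l-1]$, affine on $[l-1,l]$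 with value $N_l$ at $l$, equal to $$\frac{N_l(n-w-x)^3+3a(n-w-x)^2(x-l)+3b(n-w-x)(x-l)^2+N_{n-w}(x-l)^3}{(n-w-l)^3}$$ on $(l,n-w]$, and affine on each $[k-1,k]$, $n-w<k\le n$, with value $\binom nk$ at $k$. For real $c,d$ let $f_{(w,l)}$ be defined in the same way with $l$ and $w$ exchanged and with $N^{\perp},c,d$ in place of $N,a,b$. Let $t,s,x_1,x_2$ be natural numbers such that $t,s\ge1$, $l+t<n-w$, $w+s<n-l$, $l+t\ne n-w-s$ and such that * either $x_1\neq x_2$, and for $i=1,2$ both $\max\{l+t,w+s\}<x_i<\min\{n-w+s,n-l+t\}$ and $x_i<n-w$; * or $x_1=l+t$ and $x_2=n-w-s$. Let $a,b,c,d$ solve the system $$f_{(l,w)}(l+t)=N_{l+t},\quad f_{(w,l)}(w+s)=N^{\perp}_{w+s},\quad f_{(l,w)}(x_i)+f_{(w,l)}(n-x_i)=\binom n{x_i}\quad(i=1,2),$$ and put $$\tilde h_{(l,w)}(p)=\sum_{k=0}^n f_{(l,w)}(k)p^k(1-p)^{n-k},\qquad \tilde h_{(w,l)}(p)=\sum_{k=0}^n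 f_{(w,l)}(k)p^k(1-p)^{n-k}.$$ **Theorem.** Let $M=\max\{(l+1)^{l+1}(n-l-1)^{n-l-1},\,(w+1)^{w+1}(n-w-1)^{n-w-1}\}$ and $$R=\frac{M(n-w-l-1)}{n^n}\left|\binom n{\lfloor n/2\rfloor}-\min\left\{\binom n{l+1},\binom n{w+1}\right\}\right|.$$ Then for all $p\in[0,1]$ $$|h_{(l,w)}(p)-\tilde h_{(l,w)}(p)|\le R,\qquad |h_{(w,l)}(p)-\tilde h_{(w,l)}(p)|\le R,$$ $$|1-\tilde h_{(l,w)}(p)-\tilde h_{(w,l)}(1-p)|\le 2R,$$ and, unless $l=w=3$ (where $R=0$), also $$|1-\tilde h_{(l,w)}(p)-\tilde h_{(w,l)}(p)|\le 2R .$$ Consequently the same bounds hold for the Chebyshev norms on $[0,1]$ (the suprema over $p\in[0,1]$ of the absolute values) of these four error functions. -/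

import Mathlib

namespace Hammock

/-- The links of the hammock (brick-wall) network of length `l` and width `w` when exactly the
contacts in `S` are closed. The network has `w` rows of `l` contacts; the contact `(i, j)` lies in
row `i` between the nodes `(i, j)` and `(i, j + 1)`. All left ends are wired together (the source),
so are all right ends (the sink), and at the inner columns `0 < j < l` the nodes of the rows `i`
and `i + 1` are wired together at every second place, in the alternating pattern of a brick wall.
The parity of `ε` says at which of the places the pattern starts. (If `l` or `w` is odd, the two
patterns are mirror images of each other; if both are even, they are the two different hammocks
of these dimensions.) -/
inductive Link (l w ε : ℕ) (S : Finset (Fin w × Fin l)) : ℕ × ℕ → ℕ × ℕ → Prop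
  | contact (e : Fin w × Fin l) (he : e ∈ S) :
      Link l w ε S ((e.1 : ℕ), (e.2 : ℕ)) ((e.1 : ℕ), (e.2 : ℕ) + 1)
  | source (i : ℕ) (hi : i + 1 < w) : Link l w ε S (i, 0) (i + 1, 0)
  | sink (i : ℕ) (hi : i + 1 < w) : Link l w ε S (i, l) (i + 1, l)
  | wire (i j : ℕ) (hi : i + 1 < w) (h0 : 0 < j) (hj : j < l) (hp : (i + j + ε) % 2 = 0) :
      Link l w ε S (i, j) (i + 1, j)

/-- Closing the contacts in `S` connects the source with the sink. -/
def Connects (l w ε : ℕ) (S : Finset (Fin w × Fin l)) : Prop :=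
  Relation.EqvGen (Link l w ε S) (0, 0) (0, l)

open Classical in
/-- The sets of contacts whose closing connects the source with the sink. -/
noncomputable def pathsets (l w ε : ℕ) : Finset (Finset (Fin w × Fin l)) :=
  Finset.univ.filter (Connects l w ε)

/-- The reliability polynomial: the probability that source and sink are connected when the
contacts are closed independently with probability `p`. -/
noncomputable def reliability (l w ε : ℕ) (p : ℝ) : ℝ :=
  ∑ S ∈ pathsets l w ε, p ^ S.card * (1 - p) ^ (l * w - S.card)

/-- The coefficient `N_k` of the reliability polynomial: the number of pathsets of size `k`. -/
noncomputable def coeff (l w ε k : ℕ) : ℕ :=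
  ((pathsets l w ε).filter (fun S => S.card = k)).card

/-- The polynomial with coefficients `c k` in the basis `p ^ k * (1 - p) ^ (n - k)`. -/
noncomputable def NForm (n : ℕ) (c : ℕ → ℝ) (p : ℝ) : ℝ :=
  ∑ k ∈ Finset.range (n + 1), c k * p ^ k * (1 - p) ^ (n - k)

/-- The `N`-form of the reliability polynomial. -/
theorem reliability_eq_NForm (l w ε : ℕ) (p : ℝ) :
    reliability l w ε p = NForm (l * w) (fun k => (coeff l w ε k : ℝ)) p := by
  unfold reliability NForm coeff
  rw [← Finset.sum_fiberwise_of_maps_to (s := pathsets l w ε) (t := Finset.range (l * w + 1))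
    (g := Finset.card)]
  · refine Finset.sum_congr rfl fun k _ => ?_
    rw [Finset.sum_congr rfl (g := fun _ => p ^ k * (1 - p) ^ (l * w - k))]
    · rw [Finset.sum_const, nsmul_eq_mul, mul_assoc]
    · intro S hS
      rw [(Finset.mem_filter.mp hS).2]
  · intro S _
    have h := Finset.card_le_univ S
    rw [Fintype.card_prod, Fintype.card_fin, Fintype.card_fin, mul_comm] at h
    exact Finset.mem_range.mpr (Nat.lt_succ_of_le h)

/-- The cubic pseudo-Bernstein polynomial on `[l, n - w]`, where `n = l w`, with end values
`N l`, `N (n - w)` and free inner coefficients `a`, `b`. -/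
noncomputable def pseudoBernstein (N : ℕ → ℝ) (l w : ℕ) (a b x : ℝ) : ℝ :=
  let n : ℝ := (l : ℝ) * w
  1 / (n - w - l) ^ 3 *
    (N l * (n - w - x) ^ 3 + 3 * a * (n - w - x) ^ 2 * (x - l)
      + 3 * b * (n - w - x) * (x - l) ^ 2 + N (l * w - w) * (x - l) ^ 3)

/-- The spline on `[0, n]`, `n = l w`, that approximates the coefficients `N`: it vanishes on
`[0, l - 1]`, is affine on `[l - 1, l]`, cubic on `[l, n - w]`, and affine on every `[k - 1, k]`
with `n - w < k ≤ n`, joining `(n - w, N (n - w))` and the points `(k, n.choose k)`, `k > n - w`. -/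
noncomputable def spline (N : ℕ → ℝ) (l w : ℕ) (a b x : ℝ) : ℝ :=
  let n : ℕ := l * w
  if x ≤ (l : ℝ) - 1 then 0
  else if x ≤ l then N l * x + N l * (1 - l)
  else if x ≤ (n : ℝ) - w then pseudoBernstein N l w a b x
  else
    let k : ℕ := ⌈x⌉₊
    let y : ℝ := if k = n - w + 1 then N (n - w) else n.choose (k - 1)
    ((n.choose k : ℝ) - y) * x + k * y - ((k : ℝ) - 1) * n.choose k

/-- The system of equations for the inner coefficients `a, b, c, d` of the splines of the hammock
of length `l`, width `w` and of its dual: interpolation of `N_{l+t}` and of `N^⊥_{w+s}`, and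
complementarity at the points `x₁`, `x₂`. -/
def SplineSystem (l w ε t s x₁ x₂ : ℕ) (a b c d : ℝ) : Prop :=
  let n : ℕ := l * w
  let f : ℝ → ℝ := spline (fun k => (coeff l w ε k : ℝ)) l w a b
  let g : ℝ → ℝ := spline (fun k => (coeff w l (ε + 1) k : ℝ)) w l c d
  f ((l : ℝ) + t) = coeff l w ε (l + t) ∧
  g ((w : ℝ) + s) = coeff w l (ε + 1) (w + s) ∧
  f x₁ + g ((n : ℝ) - x₁) = n.choose x₁ ∧
  f x₂ + g ((n : ℝ) - x₂) = n.choose x₂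

/-- The approximation of the reliability polynomial of the hammock of length `l` and width `w`
obtained from the spline with inner coefficients `a`, `b`. -/
noncomputable def approx (l w ε : ℕ) (a b p : ℝ) : ℝ :=
  NForm (l * w) (fun k => spline (fun j => (coeff l w ε j : ℝ)) l w a b k) p

/-- `x` is a possible bridge point: `max (l + t, w + s) < x < min (n - w + s, n - l + t)`, and `x`
lies in the open interval `(l, n - w)` on which the two splines have free coefficients. -/
def IsBridge (l w t s x : ℕ) : Prop :=
  max ((l : ℤ) + t) (w + s) < x ∧ (x : ℤ) < min ((l : ℤ) * w - w + s) (l * w - l + t) ∧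
    (x : ℤ) < l * w - w

/-- The admissible choices of the bridge points: two different points of the above kind, or
the choice `x₁ = l + t`, `x₂ = n - w - s`, for which all interpolation data lie at these points. -/
def Admissible (l w t s x₁ x₂ : ℕ) : Prop :=
  (x₁ ≠ x₂ ∧ IsBridge l w t s x₁ ∧ IsBridge l w t s x₂) ∨
    ((x₁ : ℤ) = l + t ∧ (x₂ : ℤ) = l * w - w - s)

/-- The bound `M (n - w - l - 1) / n ^ n * |C(n, ⌊n / 2⌋) - min (C(n, l + 1), C(n, w + 1))|`. -/
noncomputable def errorBound (l w : ℕ) : ℝ :=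
  let n : ℕ := l * w
  let M : ℝ := max (((l : ℝ) + 1) ^ (l + 1) * ((n : ℝ) - l - 1) ^ (n - l - 1))
    (((w : ℝ) + 1) ^ (w + 1) * ((n : ℝ) - w - 1) ^ (n - w - 1))
  M * ((n : ℝ) - w - l - 1) / (n : ℝ) ^ n *
    |(n.choose (n / 2) : ℝ) - min (n.choose (l + 1) : ℝ) (n.choose (w + 1) : ℝ)|

/-- The Chebyshev norm on `[0, 1]`. -/
noncomputable def chebyshevNorm (u : ℝ → ℝ) : ℝ :=
  ⨆ p : Set.Icc (0 : ℝ) 1, |u p|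

end Hammock

/-!
Write `n = l * w`, `A = l` and `Z = n - w`.

*Reduction to sums over the coefficients.* By planar duality a set of contacts connects the source
and the sink of a hammock exactly if its complement does not connect those of the dual hammock, so
that `N_k + N^⊥_{n-k} = C(n, k)` (`coeff_add_coeff_dual`). If neither connected, there would be
separating potentials of both networks, and summation by parts (`sum_mul_grid`) shows that the
product of their drops is zero; if both did, the partial sums of a unit flow in the one network
would be a potential that separates the terminals of the other (`not_connects_dualSet`). Since
`p ^ k * (1 - p) ^ (n - k)` has maximum `peak n k` on `[0, 1]`, each spline error is at most the sum
of `peak n k` times the error of the coefficient at `k`, and it is enough to bound the two sums by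
`R - 1 / 2` (`bounds_of_sum_le`). The `1 / 2` is needed for the last of the four estimates, because
`1 - h(p) - h^⊥(p)` is only known to lie in `[-1, 1]`, whereas `1 - h(p) - h^⊥(1 - p)` vanishes.

*Linearization.* Reflection at `n / 2` moves the second spline to `[A, Z]`, where it approximates
`C(n, k) - N_k`. A cubic with given values at `A` and `Z` is the chord plus `(k - A) * (Z - k)`
times an arbitrary linear function (`line`). After division by `(k - A) * (Z - k)` the system
therefore says this (`exists_interpolates`): one linear function meets the divided deviation `dev`
of `N` from its chord at `u = l + t`, the other one meets that of `C(n, ·) - N` at `y = n - w - s`,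
and their sum meets that of `C(n, ·)` at the bridge points. Hence each of the two lines
interpolates at one of `u` and `y` exactly, and at the other one up to a defect, the value there of
the difference between `devC` and its secant through the bridge points (`IsDefect`, `ErrLe`,
`Interpolates.errSum_le`).

*Length and width at least three.* Here the coefficients enter almost only through
`0 ≤ N_k ≤ C(n, k)`. The products `peak n k * C(n, k)` decrease towards the middle, `devC` is
small and flat compared with `C(n, n / 2)`, and so the sum of the errors is of the order of
`n - w - l - 1` terms `peak n (m + 1) * C(n, m + 1)`, where `m = min l w`; the bound `R` has the
much larger `C(n, n / 2) - C(n, m + 1)` in place of `C(n, m + 1)`. This becomes an inequality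
between binomial coefficients that does not involve the interpolation points (`UniformBound`,
`errLe_of_uniformBound`). It holds for `n ≥ 300` by Gaussian bounds for binomial coefficients
(`uniformBound_of_large`), and for `n < 300`, with the exception of small dimensions, by evaluation
in the kernel (`uniformCheck`). In the exceptional dimensions all pairs of interpolation points are
tested, the bridge points being dealt with by bounds for the increments of `devC`. It suffices to
know `0 ≤ N_k ≤ C(n, k)` in some dimensions (`coarseCheck`); in the others the paths that never run
backwards, in the network and in its dual, give the required bounds for `N_k` from both sides
(`forwardCheck`, `digit_forwardNumber_le`). All this is put together in `errLe_coeff`.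

*Length or width two.* There is no room for two different bridge points, hence no defect. Since a
set of contacts of a network of length two connects as soon as it contains a full row,
`C(2 * m, k) - N_k ≤ 2 ^ k * C(m, k)` (`choose_le_coeff_two`), which is small compared with the
binomial coefficients in the middle; this is enough for `m ≥ 22`, and for `6 ≤ m < 22` the
interpolation points are tested (`errLe_coeff_two`). Width two is dual (`errLe_coeff_width_two`).

*Two inner points.* In the remaining dimensions `(3, 3)`, `(2, 5)` and `(5, 2)` the only integers
strictly between `A` and `Z` are the two interpolation points, and the errors vanish
(`errLe_of_eq_add_three`).
-/

namespace Hammock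

open Finset

/-! ### Duality -/

theorem Connects.potential_eq {α : Type*} {l w ε : ℕ} {S : Finset (Fin w × Fin l)}
    (h : Connects l w ε S) (φ : ℕ × ℕ → α) (hφ : ∀ a b, Link l w ε S a b → φ a = φ b) :
    φ (0, 0) = φ (0, l) := by
  have key : ∀ a b, Relation.EqvGen (Link l w ε S) a b → φ a = φ b := by
    intro a b hab
    induction hab with
    | rel _ _ h => exact hφ _ _ h
    | refl => rfl
    | symm _ _ _ ih => exact ih.symm
    | trans _ _ _ _ _ h1 h2 => exact h1.trans h2
  exact key _ _ h

open Classical in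
/-- If source and sink are not connected, then the indicator function of the component of the source
is a potential that separates them. -/
theorem exists_potential_of_not_connects {l w ε : ℕ} {S : Finset (Fin w × Fin l)}
    (h : ¬ Connects l w ε S) :
    ∃ φ : ℕ × ℕ → ℤ, (∀ a b, Link l w ε S a b → φ a = φ b) ∧ φ (0, 0) ≠ φ (0, l) := by
  refine ⟨fun v => if Relation.EqvGen (Link l w ε S) (0, 0) v then 1 else 0, ?_, ?_⟩
  · intro a b hab
    have : Relation.EqvGen (Link l w ε S) (0, 0) a ↔ Relation.EqvGen (Link l w ε S) (0, 0) b :=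
      ⟨fun h => h.trans _ _ _ (.rel _ _ hab), fun h => h.trans _ _ _ (.symm _ _ (.rel _ _ hab))⟩
    simp [this]
  · have h0 : Relation.EqvGen (Link l w ε S) (0, 0) (0, 0) := .refl _
    have h1 : ¬ Relation.EqvGen (Link l w ε S) (0, 0) (0, l) := h
    simp [h0, h1]

/-- Summation by parts on the grid of contacts. -/
theorem sum_mul_grid (l w : ℕ) (φ ψ : ℕ → ℕ → ℤ) (φs φt ψs ψt : ℤ)
    (h0 : ∀ r < w, φ r 0 = φs) (h1 : ∀ r < w, φ r l = φt)
    (h2 : ∀ c < l, ψ c 0 = ψs) (h3 : ∀ c < l, ψ c w = ψt) (hl : 0 < l)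
    (h4 : ∀ r c, r + 1 < w → c + 1 < l →
      (ψ (c + 1) (r + 1) - ψ c (r + 1)) * (φ (r + 1) (c + 1) - φ r (c + 1)) = 0) :
    ∑ r ∈ range w, ∑ c ∈ range l, (ψ c (r + 1) - ψ c r) * (φ r (c + 1) - φ r c)
      = (ψt - ψs) * (φt - φs) := by
  obtain ⟨l, rfl⟩ : ∃ k, l = k + 1 := ⟨l - 1, by omega⟩
  have byparts : ∀ (m : ℕ) (a b : ℕ → ℤ), ∑ c ∈ range (m + 1), a c * (b (c + 1) - b c)
      = a m * b (m + 1) - a 0 * b 0 - ∑ c ∈ range m, (a (c + 1) - a c) * b (c + 1) := by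
    intro m a b
    induction m with
    | zero => simp; ring
    | succ m ih => rw [sum_range_succ, ih, sum_range_succ]; ring
  have e1 : ∀ r ∈ range w, ∑ c ∈ range (l + 1), (ψ c (r + 1) - ψ c r) * (φ r (c + 1) - φ r c)
      = ((ψ l (r + 1) - ψ l r) * φt - (ψ 0 (r + 1) - ψ 0 r) * φs)
        - ∑ c ∈ range l, ((ψ (c + 1) (r + 1) - ψ c (r + 1)) - (ψ (c + 1) r - ψ c r))
            * φ r (c + 1) := by
    intro r hr
    rw [byparts l (fun c => ψ c (r + 1) - ψ c r) (φ r), h1 r (mem_range.1 hr),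
      h0 r (mem_range.1 hr)]
    congr 1
    exact sum_congr rfl fun c _ => by ring
  rw [sum_congr rfl e1, sum_sub_distrib, sum_sub_distrib, ← sum_mul, ← sum_mul,
    sum_range_sub (fun r => ψ l r), sum_range_sub (fun r => ψ 0 r), sum_comm]
  have e2 : ∀ c ∈ range l, ∑ r ∈ range w,
      ((ψ (c + 1) (r + 1) - ψ c (r + 1)) - (ψ (c + 1) r - ψ c r)) * φ r (c + 1) = 0 := by
    intro c hc
    have hc := mem_range.1 hc
    rcases w with _ | w
    · simp
    have e3 := byparts w (fun r => φ r (c + 1)) (fun r => ψ (c + 1) r - ψ c r)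
    rw [sum_congr rfl (fun r _ => mul_comm _ _), e3]
    rw [sum_eq_zero]
    · simp only [h2 _ (show c + 1 < l + 1 by omega), h2 _ (show c < l + 1 by omega),
        h3 _ (show c + 1 < l + 1 by omega), h3 _ (show c < l + 1 by omega)]
      ring
    · intro r hr
      have := h4 r c (by have := mem_range.1 hr; omega) (by omega)
      linarith
  rw [sum_eq_zero e2, h2 _ (by omega), h2 _ (by omega), h3 _ (by omega), h3 _ (by omega)]
  ring

/-- The contacts of the dual network that are closed when those of `S` are closed: the dual
contact `(j, i)` crosses the contact `(i, j)`, and exactly one of the two is closed. -/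
def dualSet {w l : ℕ} (S : Finset (Fin w × Fin l)) : Finset (Fin l × Fin w) :=
  univ.filter fun e => (e.2, e.1) ∉ S

theorem mem_dualSet {w l : ℕ} {S : Finset (Fin w × Fin l)} {e : Fin l × Fin w} :
    e ∈ dualSet S ↔ (e.2, e.1) ∉ S := by
  simp [dualSet]

theorem dualSet_dualSet {w l : ℕ} (S : Finset (Fin w × Fin l)) : dualSet (dualSet S) = S := by
  ext e; simp [mem_dualSet]

theorem card_dualSet {w l : ℕ} (S : Finset (Fin w × Fin l)) :
    (dualSet S).card = l * w - S.card := by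
  have h : dualSet S = Sᶜ.map (Equiv.prodComm _ _).toEmbedding := by
    ext e
    simp [mem_dualSet, Prod.swap]
  rw [h, card_map, card_compl, Fintype.card_prod, Fintype.card_fin, Fintype.card_fin, mul_comm]

/-- If every wire is respected, a potential takes one value on the source. -/
theorem potential_source {α : Type*} {l w ε : ℕ} {S : Finset (Fin w × Fin l)} {φ : ℕ × ℕ → α}
    (hφ : ∀ a b, Link l w ε S a b → φ a = φ b) : ∀ r < w, φ (r, 0) = φ (0, 0) := by
  intro r hr
  induction r with
  | zero => rfl
  | succ r ih => rw [← ih (by omega)]; exact (hφ _ _ (.source r hr)).symm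

theorem potential_sink {α : Type*} {l w ε : ℕ} {S : Finset (Fin w × Fin l)} {φ : ℕ × ℕ → α}
    (hφ : ∀ a b, Link l w ε S a b → φ a = φ b) : ∀ r < w, φ (r, l) = φ (0, l) := by
  intro r hr
  induction r with
  | zero => rfl
  | succ r ih => rw [← ih (by omega)]; exact (hφ _ _ (.sink r hr)).symm

/-- A cut of the network and a cut of the dual network cannot coexist. -/
theorem connects_or_connects_dualSet {l w : ℕ} (ε : ℕ) (hl : 0 < l)
    (S : Finset (Fin w × Fin l)) : Connects l w ε S ∨ Connects w l (ε + 1) (dualSet S) := by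
  by_contra! hcon
  obtain ⟨φ, hφ, hφ'⟩ := exists_potential_of_not_connects hcon.1
  obtain ⟨ψ, hψ, hψ'⟩ := exists_potential_of_not_connects hcon.2
  have key := sum_mul_grid l w (fun r c => φ (r, c)) (fun c r => ψ (c, r)) (φ (0, 0)) (φ (0, l))
    (ψ (0, 0)) (ψ (0, w)) (potential_source hφ) (potential_sink hφ) (potential_source hψ)
    (potential_sink hψ) hl ?_
  · rw [sum_eq_zero] at key
    · rcases mul_eq_zero.1 key.symm with h | h
      · exact hψ' (by linarith)
      · exact hφ' (by linarith)
    · intro r hr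
      refine sum_eq_zero fun c hc => ?_
      by_cases he : ((⟨r, mem_range.1 hr⟩, ⟨c, mem_range.1 hc⟩) : Fin w × Fin l) ∈ S
      · have := hφ _ _ (.contact _ he)
        simp only at this
        rw [this]; ring
      · have := hψ _ _ (.contact (⟨c, mem_range.1 hc⟩, ⟨r, mem_range.1 hr⟩) (mem_dualSet.2 he))
        simp only at this
        rw [this]; ring
  · intro r c hr hc
    rcases Nat.even_or_odd' (r + c + 1 + ε) with ⟨k, hk | hk⟩
    · have := hφ _ _ (.wire r (c + 1) hr (by omega) hc (by omega))
      simp only [this]; ring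
    · have := hψ _ _ (.wire c (r + 1) hc (by omega) hr (by omega))
      simp only [this]; ring

open Classical in
/-- Two connected nodes carry a unit flow through the closed contacts, in the weak form of a
pairing with the potentials that are constant along the wires. -/
theorem exists_flow {l w ε : ℕ} {S : Finset (Fin w × Fin l)} {a b : ℕ × ℕ}
    (h : Relation.EqvGen (Link l w ε S) a b) :
    ∃ x : ℕ → ℕ → ℤ, (∀ e : Fin w × Fin l, e ∉ S → x e.1 e.2 = 0) ∧
      ∀ φ : ℕ × ℕ → ℤ, (∀ a b, Link l w ε ∅ a b → φ a = φ b) →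
        ∑ r ∈ range w, ∑ c ∈ range l, x r c * (φ (r, c + 1) - φ (r, c)) = φ b - φ a := by
  induction h with
  | rel a b h =>
    have wired : Link l w ε ∅ a b → ∃ x : ℕ → ℕ → ℤ,
      (∀ e : Fin w × Fin l, e ∉ S → x e.1 e.2 = 0) ∧
      ∀ φ : ℕ × ℕ → ℤ, (∀ a b, Link l w ε ∅ a b → φ a = φ b) →
        ∑ r ∈ range w, ∑ c ∈ range l, x r c * (φ (r, c + 1) - φ (r, c)) = φ b - φ a :=
      fun h' => ⟨fun _ _ => 0, fun _ _ => rfl, fun φ hφ => by simp [hφ _ _ h']⟩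
    cases h with
    | contact e he =>
      refine ⟨fun r c => if r = e.1 ∧ c = e.2 then 1 else 0, ?_, ?_⟩
      · intro e' he'
        refine if_neg ?_
        rintro ⟨h1, h2⟩
        exact he' (by rwa [show e' = e from Prod.ext (Fin.ext h1) (Fin.ext h2)])
      · intro φ _
        rw [sum_eq_single_of_mem (e.1 : ℕ) (mem_range.2 e.1.2),
          sum_eq_single_of_mem (e.2 : ℕ) (mem_range.2 e.2.2)]
        · simp
        · intro c _ hc; simp [hc]
        · intro r _ hr; simp [hr]
    | source i hi => exact wired (.source i hi)
    | sink i hi => exact wired (.sink i hi)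
    | wire i j hi h0 hj hp => exact wired (.wire i j hi h0 hj hp)
  | refl a => exact ⟨fun _ _ => 0, fun _ _ => rfl, fun φ hφ => by simp⟩
  | symm a b _ ih =>
    obtain ⟨x, hx, h⟩ := ih
    refine ⟨fun r c => -x r c, fun e he => by simp [hx e he], fun φ hφ => ?_⟩
    simp only [neg_mul, sum_neg_distrib, h φ hφ]; ring
  | trans a b c _ _ ih1 ih2 =>
    obtain ⟨x, hx, h⟩ := ih1
    obtain ⟨y, hy, h'⟩ := ih2
    refine ⟨fun r c => x r c + y r c, fun e he => by simp [hx e he, hy e he], fun φ hφ => ?_⟩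
    simp only [add_mul, sum_add_distrib, h φ hφ, h' φ hφ]; ring

/-- A path of the network and a path of the dual network cannot coexist: the partial sums of a
flow along the columns form a potential of the dual network that separates its terminals. -/
theorem not_connects_dualSet {l w ε : ℕ} (hl : 0 < l) {S : Finset (Fin w × Fin l)}
    (h : Connects l w ε S) : ¬ Connects w l (ε + 1) (dualSet S) := by
  intro hd
  obtain ⟨x, hx, hflow⟩ := exists_flow h
  have tot : ∀ c < l, ∑ r ∈ range w, x r c = 1 := by
    intro c hc
    have := hflow (fun v => if c < v.2 then 1 else 0) (by
      intro a b hab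
      cases hab with
      | contact e he => simp at he
      | source | sink | wire => rfl)
    simp only [hc, if_true, not_lt_zero, if_false, sub_zero] at this
    rw [← this]
    refine sum_congr rfl fun r _ => ?_
    rw [sum_eq_single_of_mem c (mem_range.2 hc)]
    · simp
    · intro c' _ hc'
      rcases lt_or_gt_of_ne hc' with h | h
      · simp [show ¬ c < c' + 1 by omega, show ¬ c < c' by omega]
      · simp [show c < c' + 1 by omega, h]
  have := hd.potential_eq (fun v => ∑ r ∈ range v.2, x r v.1) ?_
  · simp only [range_zero, sum_empty, tot 0 hl] at this
    exact absurd this (by norm_num)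
  intro a b hab
  cases hab with
  | contact e he =>
    have := hx (e.2, e.1) (mem_dualSet.1 he)
    simp only at this
    simp only [sum_range_succ, this, add_zero]
  | source i hi => simp
  | sink i hi => simp only [tot _ hi, tot i (by omega)]
  | wire i j hi h0 hj hp =>
    have hf := hflow (fun v => if v.2 = i + 1 ∧ v.1 < j then 1 else 0) (by
      intro a b hab
      cases hab with
      | contact e he => simp at he
      | source => simp
      | sink => simp [show l ≠ i + 1 by omega]
      | wire i' j' hi' h0' hj' hp' =>
        by_cases h : j' = i + 1
        · have : i' < j ↔ i' + 1 < j := by omega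
          simp [h, this]
        · simp [h])
    simp only [show l ≠ i + 1 by omega, false_and, if_false, show (0 : ℕ) ≠ i + 1 by omega,
      sub_zero] at hf
    have e1 : ∀ r ∈ range w, ∑ c ∈ range l, x r c *
        ((if c + 1 = i + 1 ∧ r < j then 1 else 0) - (if c = i + 1 ∧ r < j then 1 else 0))
        = if r < j then x r i - x r (i + 1) else 0 := by
      intro r _
      by_cases hr : r < j
      · simp only [hr, and_true, add_left_inj, mul_sub, sum_sub_distrib, mul_ite, mul_one,
          mul_zero, sum_ite_eq', mem_range, hi, show i < l by omega, if_true]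
      · simp [hr]
    rw [sum_congr rfl e1, ← sum_filter] at hf
    have e2 : (range w).filter (· < j) = range j := by
      ext r; simp; omega
    rw [e2, sum_sub_distrib] at hf
    simp only
    linarith

theorem connects_dualSet_iff {l w : ℕ} (ε : ℕ) (hl : 0 < l) (S : Finset (Fin w × Fin l)) :
    Connects w l (ε + 1) (dualSet S) ↔ ¬ Connects l w ε S :=
  ⟨fun h h' => not_connects_dualSet hl h' h,
    fun h => (connects_or_connects_dualSet ε hl S).resolve_left h⟩

open Classical in
/-- The complementarity `N_k + N^⊥_{n-k} = C(n, k)` of a hammock and its dual. -/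
theorem coeff_add_coeff_dual (l w ε k : ℕ) (hl : 0 < l) (hk : k ≤ l * w) :
    coeff l w ε k + coeff w l (ε + 1) (l * w - k) = (l * w).choose k := by
  have h1 : coeff l w ε k = ((univ.powersetCard k).filter (Connects l w ε)).card := by
    unfold coeff pathsets
    congr 1
    ext S
    simp [and_comm]
  have h2 : coeff w l (ε + 1) (l * w - k)
      = ((univ.powersetCard k).filter (fun S => ¬ Connects l w ε S)).card := by
    unfold coeff pathsets
    symm
    refine card_bij' (fun S _ => dualSet S) (fun S _ => dualSet S) ?_ ?_ ?_ ?_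
    · intro S hS
      simp only [mem_filter, mem_powersetCard, mem_univ, true_and, subset_univ] at hS ⊢
      exact ⟨(connects_dualSet_iff ε hl S).2 hS.2, by rw [card_dualSet, hS.1]⟩
    · intro S hS
      simp only [mem_filter, mem_powersetCard, mem_univ, true_and, subset_univ] at hS ⊢
      refine ⟨?_, ?_⟩
      · rw [card_dualSet, hS.2, mul_comm w l]; omega
      · rw [← connects_dualSet_iff ε hl, dualSet_dualSet]; exact hS.1
    · intro S _; exact dualSet_dualSet S
    · intro S _; exact dualSet_dualSet S
  rw [h1, h2, card_filter_add_card_filter_not, card_powersetCard, card_univ, Fintype.card_prod,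
    Fintype.card_fin, Fintype.card_fin, mul_comm w l]

/-! ### Extreme coefficients -/

/-- A pathset meets every column. -/
theorem Connects.exists_mem_column {l w ε : ℕ} {S : Finset (Fin w × Fin l)}
    (h : Connects l w ε S) (c : Fin l) : ∃ r, (r, c) ∈ S := by
  by_contra! hc
  have := h.potential_eq (fun v => decide (v.2 ≤ c)) ?_
  · have hcl := c.2
    simp at this
    omega
  · intro a b hab
    cases hab with
    | contact e he =>
      have : e.2 ≠ c := fun h => hc e.1 (by rw [← h]; exact he)
      have : (e.2 : ℕ) ≠ c := fun h => this (Fin.ext h)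
      simp only [decide_eq_decide]
      omega
    | source | sink | wire => rfl

theorem coeff_eq_zero {l w ε k : ℕ} (hk : k < l) : coeff l w ε k = 0 := by
  unfold coeff
  rw [card_eq_zero, filter_eq_empty_iff]
  intro S hS hc
  have hS : Connects l w ε S := by simpa [pathsets] using hS
  choose r hr using hS.exists_mem_column
  have : univ.card ≤ S.card := card_le_card_of_injOn (fun c : Fin l => (r c, c))
    (fun c _ => hr c) (fun a _ b _ h => (Prod.ext_iff.1 h).2)
  rw [card_univ, Fintype.card_fin] at this
  omega

theorem coeff_eq_choose {l w ε k : ℕ} (hl : 0 < l) (hk : k ≤ l * w) (hk' : l * w < k + w) :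
    coeff l w ε k = (l * w).choose k := by
  rw [← coeff_add_coeff_dual l w ε k hl hk, coeff_eq_zero (k := l * w - k) (by omega), add_zero]

theorem coeff_le_choose {l w ε k : ℕ} (hl : 0 < l) (hk : k ≤ l * w) :
    coeff l w ε k ≤ (l * w).choose k := by
  rw [← coeff_add_coeff_dual l w ε k hl hk]; omega

/-! ### From coefficients to polynomials -/

/-- The maximum of `p ^ k * (1 - p) ^ (n - k)` on `[0, 1]`. -/
noncomputable def peak (n k : ℕ) : ℝ := (k : ℝ) ^ k * ((n - k : ℕ) : ℝ) ^ (n - k) / (n : ℝ) ^ n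

theorem peak_nonneg (n k : ℕ) : 0 ≤ peak n k := by unfold peak; positivity

theorem peak_symm {n k : ℕ} (hk : k ≤ n) : peak n (n - k) = peak n k := by
  unfold peak
  rw [Nat.sub_sub_self hk, mul_comm]

/-- The maximum on `[0, 1]` is attained at `p = k / n`. -/
theorem pow_mul_pow_le_peak {n k : ℕ} (hk : k ≤ n) {p : ℝ} (h0 : 0 ≤ p) (h1 : p ≤ 1) :
    p ^ k * (1 - p) ^ (n - k) ≤ peak n k := by
  obtain ⟨j, rfl⟩ := Nat.exists_eq_add_of_le hk
  unfold peak
  rw [Nat.add_sub_cancel_left]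
  have hq : 0 ≤ 1 - p := by linarith
  rcases Nat.eq_zero_or_pos k with rfl | hk0
  · rcases Nat.eq_zero_or_pos j with rfl | hj0
    · simp
    · have : (0 : ℝ) < (j : ℝ) ^ j := by positivity
      simp only [pow_zero, one_mul, zero_add]
      rw [div_self this.ne']
      exact pow_le_one₀ hq (by linarith)
  rcases Nat.eq_zero_or_pos j with rfl | hj0
  · have : (0 : ℝ) < (k : ℝ) ^ k := by positivity
    simp only [pow_zero, mul_one, add_zero]
    rw [div_self this.ne']
    exact pow_le_one₀ h0 h1
  have hk' : (0 : ℝ) < k := by exact_mod_cast hk0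
  have hj' : (0 : ℝ) < j := by exact_mod_cast hj0
  have hn' : (0 : ℝ) < (k : ℝ) + j := by positivity
  have key := Real.geom_mean_le_arith_mean2_weighted (w₁ := k / (k + j : ℝ))
    (w₂ := j / (k + j : ℝ)) (p₁ := p * (k + j) / k) (p₂ := (1 - p) * (k + j) / j)
    (by positivity) (by positivity) (by positivity) (by positivity) (by field_simp)
  have e1 : (k : ℝ) / (k + j) * (p * (k + j) / k) + j / (k + j) * ((1 - p) * (k + j) / j) = 1 := by
    field_simp; ring
  rw [e1] at key
  have h2 := pow_le_one₀ (n := k + j) (by positivity) key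
  have e2 : ∀ (x : ℝ) (m : ℕ), 0 ≤ x → (x ^ ((m : ℝ) / (k + j))) ^ (k + j) = x ^ m := by
    intro x m hx
    rw [← Real.rpow_natCast, ← Real.rpow_mul hx, ← Real.rpow_natCast]
    congr 1
    push_cast
    field_simp
  rw [mul_pow, e2 _ _ (by positivity), e2 _ _ (by positivity)] at h2
  rw [le_div_iff₀ (by positivity)]
  calc p ^ k * (1 - p) ^ j * ((k + j : ℕ) : ℝ) ^ (k + j)
      = ((p * (k + j) / k) ^ k * ((1 - p) * (k + j) / j) ^ j) * ((k : ℝ) ^ k * (j : ℝ) ^ j) := by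
        push_cast
        rw [div_pow, div_pow, mul_pow, mul_pow, pow_add]
        field_simp
    _ ≤ 1 * ((k : ℝ) ^ k * (j : ℝ) ^ j) := by gcongr
    _ = _ := one_mul _

theorem NForm_sub (n : ℕ) (a b : ℕ → ℝ) (p : ℝ) :
    NForm n a p - NForm n b p = NForm n (fun k => a k - b k) p := by
  unfold NForm
  rw [← sum_sub_distrib]
  exact sum_congr rfl fun k _ => by ring

theorem abs_NForm_le {n : ℕ} (e : ℕ → ℝ) {p : ℝ} (hp : p ∈ Set.Icc (0 : ℝ) 1) :
    |NForm n e p| ≤ ∑ k ∈ range (n + 1), peak n k * |e k| := by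
  have hq : 0 ≤ 1 - p := by linarith [hp.2]
  refine (abs_sum_le_sum_abs _ _).trans (sum_le_sum fun k hk => ?_)
  have h := pow_mul_pow_le_peak (Nat.lt_succ_iff.1 (mem_range.1 hk)) hp.1 hp.2
  rw [mul_assoc, abs_mul, abs_of_nonneg (a := p ^ k * (1 - p) ^ (n - k))
    (mul_nonneg (pow_nonneg hp.1 _) (pow_nonneg hq _)), mul_comm]
  exact mul_le_mul_of_nonneg_right h (abs_nonneg _)

theorem NForm_choose (n : ℕ) (p : ℝ) : NForm n (fun k => (n.choose k : ℝ)) p = 1 := by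
  have := add_pow p (1 - p) n
  rw [add_sub_cancel, one_pow] at this
  rw [this]
  exact sum_congr rfl fun k _ => by ring

theorem NForm_reflect (n : ℕ) (a : ℕ → ℝ) (p : ℝ) :
    NForm n a (1 - p) = NForm n (fun k => a (n - k)) p := by
  unfold NForm
  rw [← sum_range_reflect]
  refine sum_congr rfl fun k hk => ?_
  have hk := mem_range.1 hk
  rw [show n + 1 - 1 - k = n - k by omega, Nat.sub_sub_self (by omega), sub_sub_cancel]
  ring

theorem reliability_nonneg (l w ε : ℕ) {p : ℝ} (hp : p ∈ Set.Icc (0 : ℝ) 1) :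
    0 ≤ reliability l w ε p := by
  have hq : 0 ≤ 1 - p := by linarith [hp.2]
  exact sum_nonneg fun S _ => mul_nonneg (pow_nonneg hp.1 _) (pow_nonneg hq _)

theorem reliability_add_dual {l w : ℕ} (ε : ℕ) (hl : 0 < l) (p : ℝ) :
    reliability l w ε p + reliability w l (ε + 1) (1 - p) = 1 := by
  rw [reliability_eq_NForm, reliability_eq_NForm, mul_comm w l, NForm_reflect,
    ← NForm_choose (l * w) p]
  unfold NForm
  rw [← sum_add_distrib]
  refine sum_congr rfl fun k hk => ?_
  beta_reduce
  rw [← coeff_add_coeff_dual l w ε k hl (Nat.lt_succ_iff.1 (mem_range.1 hk))]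
  push_cast
  ring

theorem reliability_le_one {l w : ℕ} (ε : ℕ) (hl : 0 < l) {p : ℝ}
    (hp : p ∈ Set.Icc (0 : ℝ) 1) : reliability l w ε p ≤ 1 := by
  have h := reliability_add_dual (l := l) (w := w) ε hl p
  have h' := reliability_nonneg w l (ε + 1) (p := 1 - p) ⟨by linarith [hp.2], by linarith [hp.1]⟩
  linarith

theorem chebyshevNorm_le {u : ℝ → ℝ} {r : ℝ} (h : ∀ p ∈ Set.Icc (0 : ℝ) 1, |u p| ≤ r) :
    chebyshevNorm u ≤ r :=
  haveI : Nonempty (Set.Icc (0 : ℝ) 1) := ⟨⟨0, by simp⟩⟩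
  ciSup_le fun p => h p p.2

/-- The estimates of the theorem follow from a bound for the weighted `ℓ¹`-norms of the errors of
the coefficients. The last estimate compares the approximations at the same `p`, where the exact
polynomials may leave a defect up to `1`; the bound on the errors has to make up for it. -/
theorem bounds_of_sum_le {l w ε : ℕ} {a b c d T r : ℝ} (hl : 0 < l) (hw : 0 < w)
    (h1 : ∑ k ∈ range (l * w + 1), peak (l * w) k *
      |(coeff l w ε k : ℝ) - spline (fun j => (coeff l w ε j : ℝ)) l w a b k| ≤ T)
    (h2 : ∑ k ∈ range (l * w + 1), peak (l * w) k * |(coeff w l (ε + 1) k : ℝ)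
      - spline (fun j => (coeff w l (ε + 1) j : ℝ)) w l c d k| ≤ T)
    (hT : T ≤ r) (hT' : ¬ (l = 3 ∧ w = 3) → 1 + 2 * T ≤ 2 * r) :
    (∀ p ∈ Set.Icc (0 : ℝ) 1,
      |reliability l w ε p - approx l w ε a b p| ≤ r ∧
      |reliability w l (ε + 1) p - approx w l (ε + 1) c d p| ≤ r ∧
      |1 - approx l w ε a b p - approx w l (ε + 1) c d (1 - p)| ≤ 2 * r ∧
      (¬ (l = 3 ∧ w = 3) →
        |1 - approx l w ε a b p - approx w l (ε + 1) c d p| ≤ 2 * r)) ∧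
    chebyshevNorm (fun p => reliability l w ε p - approx l w ε a b p) ≤ r ∧
    chebyshevNorm (fun p => reliability w l (ε + 1) p - approx w l (ε + 1) c d p) ≤ r ∧
    chebyshevNorm (fun p => 1 - approx l w ε a b p - approx w l (ε + 1) c d (1 - p)) ≤ 2 * r ∧
    (¬ (l = 3 ∧ w = 3) →
      chebyshevNorm (fun p => 1 - approx l w ε a b p - approx w l (ε + 1) c d p) ≤ 2 * r) := by
  have e1 : ∀ p ∈ Set.Icc (0 : ℝ) 1, |reliability l w ε p - approx l w ε a b p| ≤ T := by
    intro p hp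
    rw [reliability_eq_NForm, approx, NForm_sub]
    exact (abs_NForm_le _ hp).trans h1
  have e2 : ∀ p ∈ Set.Icc (0 : ℝ) 1,
      |reliability w l (ε + 1) p - approx w l (ε + 1) c d p| ≤ T := by
    intro p hp
    rw [reliability_eq_NForm, approx, NForm_sub, mul_comm w l]
    exact (abs_NForm_le _ hp).trans h2
  have e3 : ∀ p ∈ Set.Icc (0 : ℝ) 1,
      |1 - approx l w ε a b p - approx w l (ε + 1) c d (1 - p)| ≤ 2 * r := by
    intro p hp
    have i1 := abs_le.1 (e1 p hp)
    have i2 := abs_le.1 (e2 (1 - p) ⟨by linarith [hp.2], by linarith [hp.1]⟩)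
    have i3 := reliability_add_dual (l := l) (w := w) ε hl p
    rw [abs_le]
    constructor <;> linarith [i1.1, i1.2, i2.1, i2.2]
  have e4 : ∀ p ∈ Set.Icc (0 : ℝ) 1, ¬ (l = 3 ∧ w = 3) →
      |1 - approx l w ε a b p - approx w l (ε + 1) c d p| ≤ 2 * r := by
    intro p hp h
    have i0 := hT' h
    have i1 := abs_le.1 (e1 p hp)
    have i2 := abs_le.1 (e2 p hp)
    have i3 := reliability_nonneg l w ε hp
    have i4 := reliability_nonneg w l (ε + 1) hp
    have i5 := reliability_le_one (l := l) (w := w) ε hl hp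
    have i6 := reliability_le_one (l := w) (w := l) (ε + 1) hw hp
    rw [abs_le]
    constructor <;> linarith [i1.1, i1.2, i2.1, i2.2]
  exact ⟨fun p hp => ⟨(e1 p hp).trans hT, (e2 p hp).trans hT, e3 p hp, e4 p hp⟩,
    chebyshevNorm_le fun p hp => (e1 p hp).trans hT,
    chebyshevNorm_le fun p hp => (e2 p hp).trans hT, chebyshevNorm_le e3,
    fun h => chebyshevNorm_le fun p hp => e4 p hp h⟩

/-! ### The splines at the integers -/

theorem spline_of_lt (N : ℕ → ℝ) {l w k : ℕ} (a b : ℝ) (hk : k < l) : spline N l w a b k = 0 := by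
  have : (k : ℝ) + 1 ≤ l := by exact_mod_cast hk
  simp only [spline]
  rw [if_pos (by linarith)]

theorem spline_left (N : ℕ → ℝ) (l w : ℕ) (a b : ℝ) : spline N l w a b l = N l := by
  simp only [spline]
  rw [if_neg (by linarith), if_pos le_rfl]
  ring

theorem spline_mid (N : ℕ → ℝ) {l w : ℕ} (a b : ℝ) {x : ℝ} (h1 : l < x)
    (h2 : x ≤ (l * w : ℕ) - w) : spline N l w a b x = pseudoBernstein N l w a b x := by
  simp only [spline]
  rw [if_neg (by linarith), if_neg (by linarith), if_pos h2]

theorem spline_right (N : ℕ → ℝ) {l w k : ℕ} (a b : ℝ) (h1 : l < k) (h2 : l * w < k + w) :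
    spline N l w a b k = (l * w).choose k := by
  have h1' : (l : ℝ) + 1 ≤ k := by exact_mod_cast h1
  have h2' : ((l * w : ℕ) : ℝ) + 1 ≤ k + w := by exact_mod_cast h2
  simp only [spline]
  rw [if_neg (by linarith), if_neg (by linarith), if_neg (by linarith), Nat.ceil_natCast]
  ring

/-- The chord of `X` over `[A, Z]`. -/
noncomputable def chord (X : ℕ → ℝ) (A Z k : ℕ) : ℝ :=
  (X A * ((Z : ℝ) - k) + X Z * ((k : ℝ) - A)) / ((Z : ℝ) - A)

/-- The weight `(k - A) (Z - k)`. -/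
noncomputable def wt (A Z k : ℕ) : ℝ := ((k : ℝ) - A) * ((Z : ℝ) - k)

/-- The linear function with the values `α` at `A` and `β` at `Z`. -/
noncomputable def line (A Z : ℕ) (α β : ℝ) (k : ℕ) : ℝ :=
  (α * ((Z : ℝ) - k) + β * ((k : ℝ) - A)) / ((Z : ℝ) - A)

/-- The cubic polynomial with the values `X A` at `A` and `X Z` at `Z` whose difference to the
chord, divided by `wt A Z`, has the end values `α` and `β`. -/
noncomputable def cubic (X : ℕ → ℝ) (A Z : ℕ) (α β : ℝ) (k : ℕ) : ℝ :=
  chord X A Z k + wt A Z k * line A Z α β k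

theorem exists_spline_eq_cubic (N : ℕ → ℝ) {l w : ℕ} (h : l + w < l * w) (a b : ℝ) :
    ∃ α β : ℝ, ∀ k : ℕ, l < k → k + w ≤ l * w →
      spline N l w a b k = cubic N l (l * w - w) α β k := by
  have hD : (l : ℝ) + w < (l * w : ℕ) := by exact_mod_cast h
  have hc : ((l * w - w : ℕ) : ℝ) = (l * w : ℕ) - w := Nat.cast_sub (by omega)
  have hd : (0 : ℝ) < (l * w : ℕ) - w - l := by linarith
  set D : ℝ := (l * w : ℕ) - w - l with hDdef
  refine ⟨(3 * a - 2 * N l - N (l * w - w)) / D ^ 2, (3 * b - N l - 2 * N (l * w - w)) / D ^ 2,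
    fun k h1 h2 => ?_⟩
  rw [spline_mid N a b (by exact_mod_cast h1)
    (by have : (k : ℝ) + w ≤ (l * w : ℕ) := by exact_mod_cast h2
        linarith)]
  simp only [pseudoBernstein, cubic, chord, wt, line, hc]
  rw [← Nat.cast_mul, ← hDdef]
  have hx : ((l * w : ℕ) : ℝ) - w = D + l := by rw [hDdef]; ring
  simp only [hx]
  field_simp
  ring

/-- The divided deviation of `X` from its chord over `[A, Z]`. -/
noncomputable def dev (X : ℕ → ℝ) (A Z k : ℕ) : ℝ := (X k - chord X A Z k) / wt A Z k

theorem wt_pos {A Z k : ℕ} (h1 : A < k) (h2 : k < Z) : 0 < wt A Z k := by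
  have h1' : (A : ℝ) < k := by exact_mod_cast h1
  have h2' : (k : ℝ) < Z := by exact_mod_cast h2
  exact mul_pos (by linarith) (by linarith)

theorem sub_cubic {X : ℕ → ℝ} {A Z k : ℕ} (α β : ℝ) (h1 : A < k) (h2 : k < Z) :
    X k - cubic X A Z α β k = wt A Z k * (dev X A Z k - line A Z α β k) := by
  have := (wt_pos h1 h2).ne'
  unfold cubic dev
  field_simp
  ring

theorem dev_sub (X Y : ℕ → ℝ) (A Z k : ℕ) :
    dev (fun j => X j - Y j) A Z k = dev X A Z k - dev Y A Z k := by
  unfold dev chord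
  ring

theorem line_add (A Z : ℕ) (α β α' β' : ℝ) (k : ℕ) :
    line A Z (α + α') (β + β') k = line A Z α β k + line A Z α' β' k := by
  unfold line
  ring

/-- The weighted `ℓ¹`-distance between `X` and a cubic polynomial with the same values at `A` and
`Z`, over the integers strictly between `A` and `Z`. -/
noncomputable def errSum (n A Z : ℕ) (X : ℕ → ℝ) (α β : ℝ) : ℝ :=
  ∑ k ∈ Ioo A Z, peak n k * (wt A Z k * |dev X A Z k - line A Z α β k|)

theorem sum_spline_error (N : ℕ → ℝ) {l w : ℕ} (hlw : l + w < l * w) {a b α β : ℝ}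
    (h0 : ∀ k < l, N k = 0) (h1 : ∀ k ≤ l * w, l * w < k + w → N k = (l * w).choose k)
    (h : ∀ k : ℕ, l < k → k + w ≤ l * w →
      spline N l w a b k = cubic N l (l * w - w) α β k) :
    ∑ k ∈ range (l * w + 1), peak (l * w) k * |N k - spline N l w a b k|
      = errSum (l * w) l (l * w - w) N α β := by
  unfold errSum
  symm
  refine sum_subset_zero_on_sdiff ?_ ?_ ?_
  · intro k hk
    have := mem_Ioo.1 hk
    exact mem_range.2 (by omega)
  · intro k hk
    simp only [mem_sdiff, mem_range, mem_Ioo, not_and, not_lt] at hk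
    suffices N k = spline N l w a b k by rw [this, sub_self, abs_zero, mul_zero]
    rcases lt_trichotomy k l with hkl | rfl | hkl
    · rw [spline_of_lt _ _ _ hkl, h0 k hkl]
    · rw [spline_left]
    · have := hk.2 hkl
      rcases this.eq_or_lt with hkZ | hkZ
      · rw [h k hkl (by omega), ← hkZ]
        have hd : ((l * w - w : ℕ) : ℝ) - l ≠ 0 := by
          have : (l : ℝ) < (l * w - w : ℕ) := by exact_mod_cast (by omega)
          linarith
        unfold cubic chord wt
        field_simp
        ring
      · rw [spline_right _ _ _ hkl (by omega), h1 k (by omega) (by omega)]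
  · intro k hk
    have := mem_Ioo.1 hk
    rw [h k this.1 (by omega), sub_cubic α β this.1 this.2, abs_mul,
      abs_of_pos (wt_pos this.1 this.2)]

theorem sub_reflect_cubic {N N' C : ℕ → ℝ} {n A Z : ℕ} (hN : ∀ k ≤ n, N k + N' (n - k) = C k)
    (hAZ : A < Z) (hZ : Z ≤ n) (α β : ℝ) {k : ℕ} (hk : k ≤ n) :
    cubic N' (n - Z) (n - A) α β (n - k) = cubic (fun j => C j - N j) A Z β α k := by
  have e : ∀ j ≤ n, N' (n - j) = C j - N j := fun j hj => by linarith [hN j hj]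
  have hd : (Z : ℝ) - A ≠ 0 := by
    have : (A : ℝ) < Z := by exact_mod_cast hAZ
    linarith
  unfold cubic chord wt line
  rw [e Z hZ, e A (by omega), Nat.cast_sub hk, Nat.cast_sub hZ, Nat.cast_sub (by omega : A ≤ n)]
  have h1 : (n : ℝ) - A - (n - k) = k - A := by ring
  have h2 : (n : ℝ) - k - (n - Z) = Z - k := by ring
  have h3 : (n : ℝ) - A - (n - Z) = Z - A := by ring
  rw [h1, h2, h3]
  ring

/-- Reflection at `n / 2` turns the error of the dual coefficients into that of `C - N`. -/
theorem errSum_reflect {N N' C : ℕ → ℝ} {n A Z : ℕ} (hN : ∀ k ≤ n, N k + N' (n - k) = C k)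
    (hAZ : A < Z) (hZ : Z ≤ n) (α β : ℝ) :
    errSum n (n - Z) (n - A) N' α β = errSum n A Z (fun j => C j - N j) β α := by
  unfold errSum
  refine sum_bij' (fun k _ => n - k) (fun k _ => n - k) ?_ ?_ ?_ ?_ ?_
  · intro k hk; have := mem_Ioo.1 hk; exact mem_Ioo.2 ⟨by omega, by omega⟩
  · intro k hk; have := mem_Ioo.1 hk; exact mem_Ioo.2 ⟨by omega, by omega⟩
  · intro k hk; have := mem_Ioo.1 hk; omega
  · intro k hk; have := mem_Ioo.1 hk; omega
  · intro k hk
    have := mem_Ioo.1 hk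
    have hkn : k ≤ n := by omega
    rw [peak_symm hkn]
    congr 1
    rw [← abs_of_pos (wt_pos this.1 this.2), ← abs_mul, ← sub_cubic _ _ this.1 this.2,
      ← abs_of_pos (wt_pos (A := A) (Z := Z) (k := n - k) (by omega) (by omega)), ← abs_mul,
      ← sub_cubic _ _ (by omega) (by omega), ← sub_reflect_cubic hN hAZ hZ α β (by omega),
      Nat.sub_sub_self hkn]
    congr 2
    have := hN (n - k) (by omega)
    rw [Nat.sub_sub_self hkn] at this
    linarith

/-- What the system of equations says about the deviations from the chords: `α, β` and `α', β'`
describe the cubic parts of the two splines, the second one being reflected. -/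
structure Interpolates (n A Z u y x₁ x₂ : ℕ) (X : ℕ → ℝ) (α β α' β' : ℝ) : Prop where
  left : line A Z α β u = dev X A Z u
  right : line A Z α' β' y = dev (fun k => (n.choose k : ℝ) - X k) A Z y
  bridge₁ : line A Z α β x₁ + line A Z α' β' x₁ = dev (fun k => (n.choose k : ℝ)) A Z x₁
  bridge₂ : line A Z α β x₂ + line A Z α' β' x₂ = dev (fun k => (n.choose k : ℝ)) A Z x₂

/-- The passage from the splines to linear functions: both sums of errors become sums over the same
interval, and the system of equations becomes `Interpolates`. -/
theorem exists_interpolates {l w ε t s x₁ x₂ : ℕ}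
    (ht : 1 ≤ t) (htn : (l : ℤ) + t < l * w - w) (hs : 1 ≤ s) (hsn : (w : ℤ) + s < l * w - l)
    (hx : Admissible l w t s x₁ x₂) {a b c d : ℝ} (hsys : SplineSystem l w ε t s x₁ x₂ a b c d) :
    ∃ α β α' β' : ℝ,
      ∑ k ∈ range (l * w + 1), peak (l * w) k *
        |(coeff l w ε k : ℝ) - spline (fun j => (coeff l w ε j : ℝ)) l w a b k|
        = errSum (l * w) l (l * w - w) (fun k => (coeff l w ε k : ℝ)) α β ∧
      ∑ k ∈ range (l * w + 1), peak (l * w) k * |(coeff w l (ε + 1) k : ℝ)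
        - spline (fun j => (coeff w l (ε + 1) j : ℝ)) w l c d k|
        = errSum (l * w) l (l * w - w)
          (fun k => ((l * w).choose k : ℝ) - coeff l w ε k) α' β' ∧
      Interpolates (l * w) l (l * w - w) (l + t) (l * w - w - s) x₁ x₂
        (fun k => (coeff l w ε k : ℝ)) α β α' β' := by
  have htn' : l + t + w < l * w := by zify; linarith
  have hsn' : w + s + l < l * w := by zify; linarith
  have hl : 0 < l := Nat.pos_of_ne_zero (by rintro rfl; simp at htn')
  have hw : 0 < w := Nat.pos_of_ne_zero (by rintro rfl; simp at htn')
  have hxr : (l < x₁ ∧ x₁ + w < l * w) ∧ (l < x₂ ∧ x₂ + w < l * w) := by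
    rcases hx with ⟨_, h1, h2⟩ | ⟨h1, h2⟩
    · obtain ⟨h1, _, h1'⟩ := h1
      obtain ⟨h2, _, h2'⟩ := h2
      have := le_max_left ((l : ℤ) + t) (w + s)
      zify
      refine ⟨⟨?_, ?_⟩, ?_, ?_⟩ <;> linarith
    · zify
      zify at htn' hsn'
      refine ⟨⟨?_, ?_⟩, ?_, ?_⟩ <;> linarith
  set n := l * w with hn
  set N : ℕ → ℝ := fun k => (coeff l w ε k : ℝ) with hNdef
  set N' : ℕ → ℝ := fun k => (coeff w l (ε + 1) k : ℝ) with hN'def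
  have hsum : ∀ k ≤ n, N k + N' (n - k) = (n.choose k : ℝ) := by
    intro k hk
    simp only [hNdef, hN'def]
    exact_mod_cast coeff_add_coeff_dual l w ε k hl hk
  obtain ⟨α, β, hf⟩ := exists_spline_eq_cubic N (l := l) (w := w) (by omega) a b
  obtain ⟨β', α', hg⟩ := exists_spline_eq_cubic N' (l := w) (w := l) (by rw [mul_comm w l]; omega) c d
  have e1 := sum_spline_error N (l := l) (w := w) (by omega) (a := a) (b := b)
    (fun k hk => by simp only [hNdef]; rw [coeff_eq_zero hk, Nat.cast_zero])
    (fun k hk hk' => by simp only [hNdef]; rw [coeff_eq_choose hl hk hk']) hf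
  have e2 := sum_spline_error N' (l := w) (w := l) (by rw [mul_comm w l]; omega) (a := c) (b := d)
    (fun k hk => by simp only [hN'def]; rw [coeff_eq_zero hk, Nat.cast_zero])
    (fun k hk hk' => by simp only [hN'def]; rw [coeff_eq_choose hw hk hk']) hg
  rw [mul_comm w l] at e2 hg
  rw [← hn] at e1 e2 hf hg
  have hZw : n - (n - w) = w := by omega
  have hrefl := errSum_reflect (A := l) (Z := n - w) hsum (by omega) (by omega) β' α'
  rw [hZw] at hrefl
  have hg' : ∀ k, l < k → k + w < n → spline N' w l c d ((n - k : ℕ) : ℝ)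
      = cubic (fun j => (n.choose j : ℝ) - N j) l (n - w) α' β' k := by
    intro k h1 h2
    rw [hg (n - k) (by omega) (by omega)]
    have := sub_reflect_cubic (A := l) (Z := n - w) hsum (by omega) (by omega) β' α' (k := k)
      (by omega)
    rwa [hZw] at this
  refine ⟨α, β, α', β', e1, e2.trans hrefl, ?_⟩
  obtain ⟨s1, s2, s3, s4⟩ := hsys
  have hx1 : ∀ x, l < x → x + w < n →
      spline N l w a b x + spline N' w l c d ((n : ℝ) - x) = n.choose x →
      line l (n - w) α β x + line l (n - w) α' β' x
        = dev (fun k => (n.choose k : ℝ)) l (n - w) x := by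
    intro x h1 h2 h
    rw [← Nat.cast_sub (by omega : x ≤ n), hg' x h1 h2, hf x h1 (by omega)] at h
    have i1 := sub_cubic (X := N) (A := l) (Z := n - w) α β h1 (by omega)
    have i2 := sub_cubic (X := fun j => (n.choose j : ℝ) - N j) (A := l) (Z := n - w) α' β' h1
      (by omega)
    rw [dev_sub] at i2
    have : wt l (n - w) x * (dev (fun k => (n.choose k : ℝ)) l (n - w) x
        - (line l (n - w) α β x + line l (n - w) α' β' x)) = 0 := by
      linear_combination i1.symm + i2.symm - h
    rcases mul_eq_zero.1 this with h0 | h0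
    · exact absurd h0 (wt_pos h1 (by omega)).ne'
    · linarith
  refine ⟨?_, ?_, hx1 _ hxr.1.1 hxr.1.2 s3, hx1 _ hxr.2.1 hxr.2.2 s4⟩
  · have s1' : spline N l w a b ((l + t : ℕ) : ℝ) = N (l + t) := by push_cast; exact s1
    rw [hf (l + t) (by omega) (by omega)] at s1'
    have i1 := sub_cubic (X := N) (A := l) (Z := n - w) (k := l + t) α β (by omega) (by omega)
    rw [s1', sub_self] at i1
    rcases mul_eq_zero.1 i1.symm with h0 | h0
    · exact absurd h0 (wt_pos (by omega) (by omega)).ne'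
    · linarith
  · have hy : n - (n - w - s) = w + s := by omega
    have s2' : spline N' w l c d ((n - (n - w - s) : ℕ) : ℝ) = N' (w + s) := by
      rw [hy]; push_cast; exact s2
    rw [hg' (n - w - s) (by omega) (by omega)] at s2'
    have i1 := sub_cubic (X := fun j => (n.choose j : ℝ) - N j) (A := l) (Z := n - w)
      (k := n - w - s) α' β' (by omega) (by omega)
    have := hsum (n - w - s) (by omega)
    rw [hy] at this
    rw [s2'] at i1
    have i2 : wt l (n - w) (n - w - s) *
      (dev (fun j => (n.choose j : ℝ) - N j) l (n - w) (n - w - s)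
        - line l (n - w) α' β' (n - w - s)) = 0 := by
      rw [← i1]; linarith
    rcases mul_eq_zero.1 i2 with h0 | h0
    · exact absurd h0 (wt_pos (by omega) (by omega)).ne'
    · linarith

/-! ### The two interpolation errors -/

/-- The divided deviation of the binomial coefficients from their chord. -/
noncomputable def devC (n A Z k : ℕ) : ℝ := dev (fun j => (n.choose j : ℝ)) A Z k

/-- The possible defects at `r` of the complementarity condition: zero, or the difference at `r`
between `devC` and a linear function that meets it at two bridge points beyond `m`. -/
def IsDefect (n A Z m r : ℕ) (δ : ℝ) : Prop :=
  δ = 0 ∨ ∃ (α β : ℝ) (x₁ x₂ : ℕ), m < x₁ ∧ x₁ < x₂ ∧ x₂ < Z ∧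
    line A Z α β x₁ = devC n A Z x₁ ∧ line A Z α β x₂ = devC n A Z x₂ ∧
    δ = line A Z α β r - devC n A Z r

/-- `T` bounds the error of every cubic that interpolates `Y` at `A`, `Z`, at a point `p` and, up
to a defect, at a point `r`. The bridge points lie beyond `m p r`. -/
def ErrLe (n A Z : ℕ) (m : ℕ → ℕ → ℕ) (Y : ℕ → ℝ) (T : ℝ) : Prop :=
  ∀ (p r : ℕ) (α β δ : ℝ), A < p → p < Z → A < r → r < Z → p ≠ r → IsDefect n A Z (m p r) r δ →
    line A Z α β p = dev Y A Z p → line A Z α β r = dev Y A Z r + δ → errSum n A Z Y α β ≤ T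

theorem line_interp {A Z : ℕ} (h : A < Z) (α β : ℝ) (p r k : ℕ) :
    ((r : ℝ) - p) * line A Z α β k
      = ((r : ℝ) - k) * line A Z α β p + ((k : ℝ) - p) * line A Z α β r := by
  have : (Z : ℝ) - A ≠ 0 := by
    have : (A : ℝ) < Z := by exact_mod_cast h
    linarith
  unfold line
  field_simp
  ring

/-- The slope of the linear function through two bridge points is an average of increments of
`devC`. -/
theorem IsDefect.exists_slope {n A Z m r : ℕ} {δ : ℝ} (h : IsDefect n A Z m r δ) (hAZ : A < Z)
    (h0 : δ ≠ 0) :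
    ∃ (x : ℕ) (s : ℝ), m < x ∧ x + 1 < Z ∧ δ = devC n A Z x - devC n A Z r + s * ((r : ℝ) - x) ∧
      (∀ M, (∀ j, x ≤ j → j + 1 < Z → devC n A Z (j + 1) - devC n A Z j ≤ M) → s ≤ M) ∧
      (∀ M, (∀ j, x ≤ j → j + 1 < Z → devC n A Z j - devC n A Z (j + 1) ≤ M) → -s ≤ M) := by
  rcases h with h | ⟨α, β, x₁, x₂, hm, hlt, hZ, e1, e2, rfl⟩
  · exact absurd h h0
  have hd : (0 : ℝ) < (x₂ : ℝ) - x₁ := by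
    have : (x₁ : ℝ) < x₂ := by exact_mod_cast hlt
    linarith
  have tele : ∀ (g : ℕ → ℝ) (M : ℝ) (k : ℕ), x₁ + k < Z →
      (∀ j, x₁ ≤ j → j + 1 < Z → g (j + 1) - g j ≤ M) → g (x₁ + k) - g x₁ ≤ M * k := by
    intro g M k hk hg
    induction k with
    | zero => simp
    | succ k ih =>
      have i1 := ih (by omega)
      have i2 := hg (x₁ + k) (by omega) (by omega)
      push_cast
      rw [← add_assoc]
      linarith
  obtain ⟨k, rfl⟩ := Nat.exists_eq_add_of_lt hlt
  refine ⟨x₁, (devC n A Z (x₁ + k + 1) - devC n A Z x₁) / (((x₁ + k + 1 : ℕ) : ℝ) - x₁), hm,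
    by omega, ?_, ?_, ?_⟩
  · have := line_interp hAZ α β x₁ (x₁ + k + 1) r
    rw [e1, e2] at this
    have e3 : line A Z α β r = ((((x₁ + k + 1 : ℕ) : ℝ) - r) * devC n A Z x₁
        + ((r : ℝ) - x₁) * devC n A Z (x₁ + k + 1)) / (((x₁ + k + 1 : ℕ) : ℝ) - x₁) := by
      rw [← this]; field_simp
    rw [e3]
    field_simp
    ring
  · intro M hM
    rw [div_le_iff₀ hd]
    have := tele (devC n A Z) M (k + 1) (by omega) hM
    push_cast at this ⊢
    rw [← add_assoc] at this
    linarith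
  · intro M hM
    rw [← neg_div, div_le_iff₀ hd]
    have := tele (fun j => -devC n A Z j) M (k + 1) (by omega)
      (fun j h1 h2 => by have := hM j h1 h2; linarith)
    push_cast at this ⊢
    rw [← add_assoc] at this
    linarith

/-! ### Kernel-friendly arithmetic -/

/-- Evaluates `x` before it is handed to `f`: the recursor makes the kernel reduce `x` to a numeral,
which is then shared by all its occurrences. -/
def force {α : Type} (x : ℕ) (f : ℕ → α) : α := Nat.rec (f 0) (fun p _ => f (Nat.succ p)) x

@[simp] theorem force_eq {α : Type} (x : ℕ) (f : ℕ → α) : force x f = f x := by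
  cases x <;> rfl

/-- The maximum, by means of the comparison `Nat.ble` that the kernel evaluates natively. -/
def mx (a b : ℕ) : ℕ := force a fun a => force b fun b => bif Nat.ble a b then b else a

theorem mx_eq (a b : ℕ) : mx a b = max a b := by
  simp only [mx, force_eq]
  rcases le_total a b with h | h
  · rw [max_eq_right h, Nat.ble_eq_true_of_le h]; rfl
  · rw [max_eq_left h]
    by_cases h' : a ≤ b
    · rw [Nat.ble_eq_true_of_le h']; exact le_antisymm h h'
    · have : Nat.ble a b = false := by
        rw [← Bool.not_eq_true, Nat.ble_eq]; exact h'
      rw [this]; rfl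

theorem sub_le_cast_sub (x y : ℕ) : (x : ℝ) - y ≤ ((x - y : ℕ) : ℝ) := by
  rcases le_total y x with h | h
  · rw [Nat.cast_sub h]
  · rw [Nat.sub_eq_zero_of_le h, Nat.cast_zero]
    have : (x : ℝ) ≤ y := by exact_mod_cast h
    linarith

/-! ### A certified search over the interpolation points -/

/-- The data of an integer `k` strictly between `A` and `Z`, in fixed-point arithmetic: bounds
`lo`, `hi` for the shifted deviation of the coefficients, bounds `cl`, `ch` for that of the
binomial coefficients, bounds `sp`, `sn` for the increments and the decrements of the latter from
`k` on, and the weight `W` of the error at `k`. -/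
structure Cell where
  k : ℕ
  lo : ℕ
  hi : ℕ
  cl : ℕ
  ch : ℕ
  sp : ℕ
  sn : ℕ
  W : ℕ

/-- The weight of the error at `k`, multiplied by `n ^ n`. -/
def weight (n A Z k : ℕ) : ℕ := k ^ k * (n - k) ^ (n - k) * ((k - A) * (Z - k))

/-- The cell is correct. Deviations are multiplied by the scale `s`, and shifted by `Q` and `Qc`,
respectively, in order to become nonnegative. -/
structure Cell.Valid (n A Z s Q Qc : ℕ) (Y : ℕ → ℝ) (c : Cell) : Prop where
  lo_le : (c.lo : ℝ) ≤ s * dev Y A Z c.k + Q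
  le_hi : s * dev Y A Z c.k + Q ≤ c.hi
  cl_le : (c.cl : ℝ) ≤ s * devC n A Z c.k + Qc
  le_ch : s * devC n A Z c.k + Qc ≤ c.ch
  le_sp : ∀ j, c.k ≤ j → j + 1 < Z → s * (devC n A Z (j + 1) - devC n A Z j) ≤ c.sp
  le_sn : ∀ j, c.k ≤ j → j + 1 < Z → s * (devC n A Z j - devC n A Z (j + 1)) ≤ c.sn
  w_eq : c.W = weight n A Z c.k

/-- Bounds for `(r - p) |v - f k|` where `f` is the linear function with values in `[lp, hp]` at
`p` and in `[lr, hr]` at `r`, and `v` is in `[lo, hi]`; zero for `k = p` and `k = r`. -/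
def gap (p lp hp r lr hr k lo hi : ℕ) : ℕ :=
  bif Nat.blt k p then
    force (r - k) fun a => force (p - k) fun b =>
      mx (a * hp - ((r - p) * lo + b * lr)) ((r - p) * hi + b * hr - a * lp)
  else bif (Nat.blt p k).and (Nat.blt k r) then
    force (r - k) fun a => force (k - p) fun b =>
      mx ((r - p) * hi - (a * lp + b * lr)) (a * hp + b * hr - (r - p) * lo)
  else bif Nat.blt r k then
    force (k - r) fun a => force (k - p) fun b =>
      mx (b * hr - ((r - p) * lo + a * lp)) ((r - p) * hi + a * hp - b * lr)
  else 0

theorem blt_eq_decide (a b : ℕ) : Nat.blt a b = decide (a < b) := by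
  rw [Bool.eq_iff_iff, decide_eq_true_iff, Nat.blt_eq]

theorem abs_sub_le_gap {p lp hp r lr hr k lo hi : ℕ} {f : ℕ → ℝ} {v : ℝ}
    (hf : ((r : ℝ) - p) * f k = ((r : ℝ) - k) * f p + ((k : ℝ) - p) * f r) (hpr : p < r)
    (hkp : k ≠ p) (hkr : k ≠ r) (h1 : lp ≤ f p) (h2 : f p ≤ hp) (h3 : lr ≤ f r) (h4 : f r ≤ hr)
    (h5 : lo ≤ v) (h6 : v ≤ hi) :
    ((r : ℝ) - p) * |v - f k| ≤ gap p lp hp r lr hr k lo hi := by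
  have hd : (0 : ℝ) < (r : ℝ) - p := by
    have : (p : ℝ) < r := by exact_mod_cast hpr
    linarith
  rw [← abs_of_pos hd, ← abs_mul, mul_sub, hf]
  unfold gap
  simp only [blt_eq_decide, force_eq, mx_eq, Bool.and_eq_true, decide_eq_true_eq, Bool.cond_eq_ite]
  have dv := mul_le_mul_of_nonneg_left h5 hd.le
  have dv' := mul_le_mul_of_nonneg_left h6 hd.le
  split_ifs with c1 c2 c3
  · have hrk : (0 : ℝ) ≤ (r : ℝ) - k := by
      have : (k : ℝ) ≤ r := by exact_mod_cast (by omega)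
      linarith
    have hpk : (0 : ℝ) ≤ (p : ℝ) - k := by
      have : (k : ℝ) ≤ p := by exact_mod_cast c1.le
      linarith
    have a1 := mul_le_mul_of_nonneg_left h1 hrk
    have a2 := mul_le_mul_of_nonneg_left h2 hrk
    have a3 := mul_le_mul_of_nonneg_left h3 hpk
    have a4 := mul_le_mul_of_nonneg_left h4 hpk
    have u1 := sub_le_cast_sub ((r - k) * hp) ((r - p) * lo + (p - k) * lr)
    have u2 := sub_le_cast_sub ((r - p) * hi + (p - k) * hr) ((r - k) * lp)
    push_cast [Nat.cast_sub hpr.le, Nat.cast_sub c1.le, Nat.cast_sub (c1.le.trans hpr.le)] at u1 u2 ⊢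
    rw [abs_le']
    exact ⟨le_max_of_le_right (by linarith), le_max_of_le_left (by linarith)⟩
  · have hrk : (0 : ℝ) ≤ (r : ℝ) - k := by
      have : (k : ℝ) ≤ r := by exact_mod_cast c2.2.le
      linarith
    have hpk : (0 : ℝ) ≤ (k : ℝ) - p := by
      have : (p : ℝ) ≤ k := by exact_mod_cast c2.1.le
      linarith
    have a1 := mul_le_mul_of_nonneg_left h1 hrk
    have a2 := mul_le_mul_of_nonneg_left h2 hrk
    have a3 := mul_le_mul_of_nonneg_left h3 hpk
    have a4 := mul_le_mul_of_nonneg_left h4 hpk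
    have u1 := sub_le_cast_sub ((r - p) * hi) ((r - k) * lp + (k - p) * lr)
    have u2 := sub_le_cast_sub ((r - k) * hp + (k - p) * hr) ((r - p) * lo)
    push_cast [Nat.cast_sub hpr.le, Nat.cast_sub c2.1.le, Nat.cast_sub c2.2.le] at u1 u2 ⊢
    rw [abs_le']
    exact ⟨le_max_of_le_left (by linarith), le_max_of_le_right (by linarith)⟩
  · have hrk : (0 : ℝ) ≤ (k : ℝ) - r := by
      have : (r : ℝ) ≤ k := by exact_mod_cast c3.le
      linarith
    have hpk : (0 : ℝ) ≤ (k : ℝ) - p := by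
      have : (p : ℝ) ≤ k := by exact_mod_cast (by omega)
      linarith
    have a1 := mul_le_mul_of_nonneg_left h1 hrk
    have a2 := mul_le_mul_of_nonneg_left h2 hrk
    have a3 := mul_le_mul_of_nonneg_left h3 hpk
    have a4 := mul_le_mul_of_nonneg_left h4 hpk
    have u1 := sub_le_cast_sub ((k - p) * hr) ((r - p) * lo + (k - r) * lp)
    have u2 := sub_le_cast_sub ((r - p) * hi + (k - r) * hp) ((k - p) * lr)
    push_cast [Nat.cast_sub hpr.le, Nat.cast_sub c3.le, Nat.cast_sub (hpr.le.trans c3.le)] at u1 u2 ⊢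
    rw [abs_le']
    exact ⟨le_max_of_le_right (by linarith), le_max_of_le_left (by linarith)⟩
  · omega

/-- The weighted sum of the gaps over a list of cells. -/
noncomputable def gapSum (p lp hp r lr hr : ℕ) (L : List Cell) : ℕ :=
  List.rec 0 (fun c _ ih => Nat.add (Nat.mul c.W (gap p lp hp r lr hr c.k c.lo c.hi)) ih) L

theorem gapSum_eq (p lp hp r lr hr : ℕ) (L : List Cell) :
    gapSum p lp hp r lr hr L
      = (L.map fun c => c.W * gap p lp hp r lr hr c.k c.lo c.hi).sum := by
  induction L with
  | nil => rfl
  | cons c t ih => rw [List.map_cons, List.sum_cons, ← ih]; rfl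

theorem peak_mul_wt {n A Z k : ℕ} (hn : 0 < n) (h1 : A < k) (h2 : k < Z) :
    (n : ℝ) ^ n * (peak n k * wt A Z k) = weight n A Z k := by
  have : (n : ℝ) ≠ 0 := by positivity
  unfold peak wt weight
  push_cast [Nat.cast_sub h1.le, Nat.cast_sub h2.le]
  field_simp

theorem sum_Ioo_eq_list {L : List Cell} {A Z : ℕ}
    (hL : L.map Cell.k = List.range' (A + 1) (Z - A - 1)) (g : ℕ → ℝ) :
    ∑ k ∈ Ioo A Z, g k = (L.map fun c => g c.k).sum := by
  have h1 : (L.map fun c => g c.k) = (List.range' (A + 1) (Z - A - 1)).map g := by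
    rw [← hL, List.map_map]; rfl
  have h2 : Ioo A Z = (List.range' (A + 1) (Z - A - 1)).toFinset := by
    ext k
    simp only [mem_Ioo, List.mem_toFinset, List.mem_range'_1]
    omega
  rw [h1, h2, List.sum_toFinset _ List.nodup_range']

/-- Tests whether the error of a cubic is at most `RB / n ^ n - 1 / 2` if its linear part agrees with
the deviation of the coefficients up to defects, which (times `s`) are in `[-np, pp]` at `cp` and in
`[-nr, pr]` at `cr`. The argument `nn` stands for `n ^ n`. -/
noncomputable def pairTest (nn s RB : ℕ) (L : List Cell) (cp cr : Cell) (np pp nr pr : ℕ) :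
    Bool :=
  (Nat.ble np cp.lo).and ((Nat.ble nr cr.lo).and
    (force (cp.lo - np) fun lp => force (cp.hi + pp) fun hp =>
      force (cr.lo - nr) fun lr => force (cr.hi + pr) fun hr =>
        Nat.ble (2 * (gapSum cp.k lp hp cr.k lr hr L
            + (cp.W * mx np pp + cr.W * mx nr pr) * (cr.k - cp.k)) + nn * s * (cr.k - cp.k))
          (2 * RB * s * (cr.k - cp.k))))

theorem errSum_le_of_pairTest {n A Z s Q Qc RB : ℕ} {Y : ℕ → ℝ} {L : List Cell}
    (hn : 0 < n) (hs : 0 < s) (hL : L.map Cell.k = List.range' (A + 1) (Z - A - 1))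
    (hv : ∀ c ∈ L, c.Valid n A Z s Q Qc Y) {cp cr : Cell} (hcp : cp ∈ L) (hcr : cr ∈ L)
    (hpr : cp.k < cr.k) {np pp nr pr : ℕ} {α β δp δr : ℝ}
    (h1 : -(np : ℝ) ≤ s * δp) (h2 : s * δp ≤ pp) (h3 : -(nr : ℝ) ≤ s * δr) (h4 : s * δr ≤ pr)
    (hp : line A Z α β cp.k = dev Y A Z cp.k + δp) (hr : line A Z α β cr.k = dev Y A Z cr.k + δr)
    (ht : pairTest (n ^ n) s RB L cp cr np pp nr pr = true) :
    errSum n A Z Y α β ≤ RB / (n : ℝ) ^ n - 1 / 2 := by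
  simp only [pairTest, force_eq, Bool.and_eq_true, Nat.ble_eq, mx_eq] at ht
  obtain ⟨t1, t2, t3⟩ := ht
  have hmem : ∀ c ∈ L, A < c.k ∧ c.k < Z := by
    intro c hc
    have : c.k ∈ L.map Cell.k := List.mem_map_of_mem hc
    rw [hL, List.mem_range'_1] at this
    omega
  have hAZ : A < Z := (hmem _ hcp).1.trans (hmem _ hcp).2
  have hd : (0 : ℝ) < (cr.k : ℝ) - cp.k := by
    have : (cp.k : ℝ) < cr.k := by exact_mod_cast hpr
    linarith
  have hs' : (0 : ℝ) < s := by exact_mod_cast hs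
  have hn' : (0 : ℝ) < (n : ℝ) ^ n := by positivity
  set lp := cp.lo - np with hlp
  set lr := cr.lo - nr with hlr
  have vp := hv _ hcp
  have vr := hv _ hcr
  set f : ℕ → ℝ := fun k => s * line A Z α β k + Q with hfdef
  have f1 : (lp : ℝ) ≤ f cp.k := by
    simp only [hfdef, hlp, hp]; rw [Nat.cast_sub t1]; linarith [vp.lo_le]
  have f2 : f cp.k ≤ ((cp.hi + pp : ℕ) : ℝ) := by
    simp only [hfdef, hp]; push_cast; linarith [vp.le_hi]
  have f3 : (lr : ℝ) ≤ f cr.k := by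
    simp only [hfdef, hlr, hr]; rw [Nat.cast_sub t2]; linarith [vr.lo_le]
  have f4 : f cr.k ≤ ((cr.hi + pr : ℕ) : ℝ) := by
    simp only [hfdef, hr]; push_cast; linarith [vr.le_hi]
  have term : ∀ c ∈ L, (n : ℝ) ^ n * (s * ((cr.k : ℝ) - cp.k)) *
      (peak n c.k * (wt A Z c.k * |dev Y A Z c.k - line A Z α β c.k|))
      ≤ ((c.W * gap cp.k lp (cp.hi + pp) cr.k lr (cr.hi + pr) c.k c.lo c.hi : ℕ) : ℝ)
        + ((if c.k = cp.k then ((weight n A Z cp.k * max np pp : ℕ) : ℝ) * (cr.k - cp.k) else 0)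
          + (if c.k = cr.k then ((weight n A Z cr.k * max nr pr : ℕ) : ℝ) * (cr.k - cp.k)
            else 0)) := by
    intro c hc
    have vc := hv _ hc
    have e1 : (n : ℝ) ^ n * (s * ((cr.k : ℝ) - cp.k)) *
      (peak n c.k * (wt A Z c.k * |dev Y A Z c.k - line A Z α β c.k|))
      = (n ^ n * (peak n c.k * wt A Z c.k)) *
        (((cr.k : ℝ) - cp.k) * |s * dev Y A Z c.k + Q - f c.k|) := by
      have : s * dev Y A Z c.k + Q - f c.k = s * (dev Y A Z c.k - line A Z α β c.k) := by
        simp only [hfdef]; ring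
      rw [this, abs_mul, abs_of_pos hs']
      ring
    rw [e1, peak_mul_wt hn (hmem c hc).1 (hmem c hc).2]
    have hδ : ∀ (δ : ℝ) (a b : ℕ), -(a : ℝ) ≤ s * δ → s * δ ≤ b →
        |s * δ| ≤ ((max a b : ℕ) : ℝ) := by
      intro δ a b i1 i2
      rw [Nat.cast_max, abs_le']
      exact ⟨le_max_of_le_right i2, le_max_of_le_left (by linarith)⟩
    have hw0 : (0 : ℝ) ≤ (weight n A Z c.k : ℝ) := Nat.cast_nonneg _
    by_cases ep : c.k = cp.k
    · have hne : c.k ≠ cr.k := by omega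
      rw [if_pos ep, if_neg hne, ep, add_zero]
      have : s * dev Y A Z cp.k + Q - f cp.k = -(s * δp) := by
        simp only [hfdef, hp]; ring
      rw [this, abs_neg]
      have i1 := mul_le_mul_of_nonneg_left (mul_le_mul_of_nonneg_right (hδ δp np pp h1 h2) hd.le)
        (Nat.cast_nonneg (α := ℝ) (weight n A Z cp.k))
      have i2 : (0 : ℝ) ≤ ((c.W * gap cp.k lp (cp.hi + pp) cr.k lr (cr.hi + pr) cp.k c.lo c.hi : ℕ)
        : ℝ) := Nat.cast_nonneg _
      push_cast at i1 i2 ⊢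
      linarith
    by_cases er : c.k = cr.k
    · rw [if_neg ep, if_pos er, er, zero_add]
      have : s * dev Y A Z cr.k + Q - f cr.k = -(s * δr) := by
        simp only [hfdef, hr]; ring
      rw [this, abs_neg]
      have i1 := mul_le_mul_of_nonneg_left (mul_le_mul_of_nonneg_right (hδ δr nr pr h3 h4) hd.le)
        (Nat.cast_nonneg (α := ℝ) (weight n A Z cr.k))
      have i2 : (0 : ℝ) ≤ ((c.W * gap cp.k lp (cp.hi + pp) cr.k lr (cr.hi + pr) cr.k c.lo c.hi : ℕ)
        : ℝ) := Nat.cast_nonneg _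
      push_cast at i1 i2 ⊢
      linarith
    rw [if_neg ep, if_neg er, add_zero, add_zero, vc.w_eq]
    have := abs_sub_le_gap (f := f) (k := c.k) (lo := c.lo) (hi := c.hi)
      (v := s * dev Y A Z c.k + Q) (by
        simp only [hfdef]
        linear_combination (s : ℝ) * line_interp hAZ α β cp.k cr.k c.k)
      hpr ep er f1 f2 f3 f4 vc.lo_le vc.le_hi
    push_cast at this ⊢
    exact mul_le_mul_of_nonneg_left this hw0
  have hsum : (n : ℝ) ^ n * (s * ((cr.k : ℝ) - cp.k)) * errSum n A Z Y α β
      ≤ ((gapSum cp.k lp (cp.hi + pp) cr.k lr (cr.hi + pr) L : ℕ) : ℝ)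
        + (((weight n A Z cp.k * max np pp : ℕ) : ℝ) * (cr.k - cp.k)
          + ((weight n A Z cr.k * max nr pr : ℕ) : ℝ) * (cr.k - cp.k)) := by
    unfold errSum
    rw [mul_sum, sum_Ioo_eq_list hL]
    refine (List.sum_le_sum (f := fun c : Cell => (n : ℝ) ^ n * (s * ((cr.k : ℝ) - cp.k)) *
      (peak n c.k * (wt A Z c.k * |dev Y A Z c.k - line A Z α β c.k|))) term).trans ?_
    rw [List.sum_map_add, List.sum_map_add]
    have e2 : ∀ (q : ℕ) (x : ℝ), A < q → q < Z →
        (L.map fun c => if c.k = q then x else 0).sum = x := by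
      intro q x hq hq'
      rw [← sum_Ioo_eq_list hL (fun k => if k = q then x else 0), sum_ite_eq',
        if_pos (mem_Ioo.2 ⟨hq, hq'⟩)]
    rw [e2 _ _ (hmem _ hcp).1 (hmem _ hcp).2, e2 _ _ (hmem _ hcr).1 (hmem _ hcr).2, gapSum_eq,
      Nat.cast_list_sum, List.map_map]
    rfl
  have t3' : ((2 * (gapSum cp.k lp (cp.hi + pp) cr.k lr (cr.hi + pr) L
      + (cp.W * max np pp + cr.W * max nr pr) * (cr.k - cp.k)) + n ^ n * s * (cr.k - cp.k) : ℕ) : ℝ)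
      ≤ ((2 * RB * s * (cr.k - cp.k) : ℕ) : ℝ) := by exact_mod_cast t3
  rw [vp.w_eq, vr.w_eq] at t3'
  push_cast [Nat.cast_sub hpr.le] at t3' hsum
  have hsd : 0 < (s : ℝ) * ((cr.k : ℝ) - cp.k) := mul_pos hs' hd
  rw [le_sub_iff_add_le, le_div_iff₀ hn']
  refine le_of_mul_le_mul_right ?_ hsd
  linarith

/-- An upper bound for the defect at `r`, where `cl` is the lower bound for `devC` at `r`. -/
noncomputable def defectPos (Z m r cl : ℕ) (L : List Cell) : ℕ :=
  List.rec 0 (fun c _ ih => bif (Nat.blt m c.k).and (Nat.blt (c.k + 1) Z) then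
    mx (c.ch + (bif Nat.blt r c.k then (c.k - r) * c.sn else (r - c.k) * c.sp) - cl) ih else ih) L

/-- An upper bound for the negative of the defect at `r`, where `ch` is the upper bound for `devC`
at `r`. -/
noncomputable def defectNeg (Z m r ch : ℕ) (L : List Cell) : ℕ :=
  List.rec 0 (fun c _ ih => bif (Nat.blt m c.k).and (Nat.blt (c.k + 1) Z) then
    mx (ch + (bif Nat.blt r c.k then (c.k - r) * c.sp else (r - c.k) * c.sn) - c.cl) ih else ih) L

theorem le_foldMax {L : List Cell} {P : Cell → Bool} {g : Cell → ℕ} {c : Cell} (hc : c ∈ L)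
    (hP : P c = true) :
    g c ≤ List.rec (motive := fun _ => ℕ) 0 (fun c _ ih => bif P c then mx (g c) ih else ih) L := by
  induction L with
  | nil => simp at hc
  | cons a t ih =>
    rcases List.mem_cons.1 hc with rfl | hc
    · change _ ≤ cond (P c) (mx (g c) _) _
      rw [hP, cond_true, mx_eq]
      exact le_max_left _ _
    · refine (ih hc).trans ?_
      change _ ≤ cond (P a) (mx (g a) _) _
      cases P a
      · exact le_rfl
      · rw [cond_true, mx_eq]; exact le_max_right _ _

theorem exists_cell {L : List Cell} {A Z x : ℕ}
    (hL : L.map Cell.k = List.range' (A + 1) (Z - A - 1)) (h1 : A < x) (h2 : x < Z) :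
    ∃ c ∈ L, c.k = x := by
  have : x ∈ L.map Cell.k := by rw [hL, List.mem_range'_1]; omega
  simpa using this

theorem IsDefect.mono {n A Z m m' r : ℕ} {δ : ℝ} (h : IsDefect n A Z m r δ) (hm : m' ≤ m) :
    IsDefect n A Z m' r δ := by
  rcases h with h | ⟨α, β, x₁, x₂, h1, h2⟩
  · exact Or.inl h
  · exact Or.inr ⟨α, β, x₁, x₂, hm.trans_lt h1, h2⟩

theorem defect_bounds {n A Z s Q Qc m : ℕ} {Y : ℕ → ℝ} {L : List Cell}
    (hL : L.map Cell.k = List.range' (A + 1) (Z - A - 1))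
    (hv : ∀ c ∈ L, c.Valid n A Z s Q Qc Y) {cr : Cell} (hcr : cr ∈ L) {δ : ℝ} (hAm : A ≤ m)
    (hAZ : A < Z) (h : IsDefect n A Z m cr.k δ) :
    s * δ ≤ defectPos Z m cr.k cr.cl L ∧ -(defectNeg Z m cr.k cr.ch L : ℝ) ≤ s * δ := by
  by_cases h0 : δ = 0
  · rw [h0, mul_zero]
    exact ⟨Nat.cast_nonneg _, neg_nonpos.2 (Nat.cast_nonneg _)⟩
  obtain ⟨x, σ, hmx, hxZ, hδ, hup, hdn⟩ := h.exists_slope hAZ h0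
  obtain ⟨c, hc, rfl⟩ := exists_cell hL (hAm.trans_lt hmx) (by omega : x < Z)
  have vc := hv _ hc
  have vr := hv _ hcr
  have hs0 : (0 : ℝ) ≤ s := Nat.cast_nonneg _
  have hP : ((Nat.blt m c.k).and (Nat.blt (c.k + 1) Z)) = true := by
    simp [blt_eq_decide, hmx, hxZ]
  have hsp : s * σ ≤ c.sp := by
    rcases hs0.eq_or_lt with h | h
    · rw [← h, zero_mul]; exact Nat.cast_nonneg _
    · rw [← le_div_iff₀' h]
      exact hup _ fun j h1 h2 => by rw [le_div_iff₀' h]; exact vc.le_sp j h1 h2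
  have hsn : s * (-σ) ≤ c.sn := by
    rcases hs0.eq_or_lt with h | h
    · rw [← h, zero_mul]; exact Nat.cast_nonneg _
    · rw [← le_div_iff₀' h]
      exact hdn _ fun j h1 h2 => by rw [le_div_iff₀' h]; exact vc.le_sn j h1 h2
  have g1 := le_foldMax (P := fun c => (Nat.blt m c.k).and (Nat.blt (c.k + 1) Z))
    (g := fun c => c.ch + (bif Nat.blt cr.k c.k then (c.k - cr.k) * c.sn
      else (cr.k - c.k) * c.sp) - cr.cl) hc hP
  have g2 := le_foldMax (P := fun c => (Nat.blt m c.k).and (Nat.blt (c.k + 1) Z))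
    (g := fun c => cr.ch + (bif Nat.blt cr.k c.k then (c.k - cr.k) * c.sp
      else (cr.k - c.k) * c.sn) - c.cl) hc hP
  change _ ≤ defectPos Z m cr.k cr.cl L at g1
  change _ ≤ defectNeg Z m cr.k cr.ch L at g2
  have g1' : ((c.ch + (bif Nat.blt cr.k c.k then (c.k - cr.k) * c.sn
      else (cr.k - c.k) * c.sp) - cr.cl : ℕ) : ℝ) ≤ defectPos Z m cr.k cr.cl L := by
    exact_mod_cast g1
  have g2' : ((cr.ch + (bif Nat.blt cr.k c.k then (c.k - cr.k) * c.sp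
      else (cr.k - c.k) * c.sn) - c.cl : ℕ) : ℝ) ≤ defectNeg Z m cr.k cr.ch L := by
    exact_mod_cast g2
  have w1 := (sub_le_cast_sub _ _).trans g1'
  have w2 := (sub_le_cast_sub _ _).trans g2'
  have a1 := vc.cl_le
  have a2 := vc.le_ch
  have a3 := vr.cl_le
  have a4 := vr.le_ch
  rw [hδ]
  rcases lt_or_ge cr.k c.k with hlt | hge
  · simp only [blt_eq_decide, hlt, decide_true, cond_true] at w1 w2
    push_cast [Nat.cast_sub hlt.le] at w1 w2
    have hd : (0 : ℝ) ≤ (c.k : ℝ) - cr.k := by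
      have : (cr.k : ℝ) ≤ c.k := by exact_mod_cast hlt.le
      linarith
    have b1 := mul_le_mul_of_nonneg_left hsn hd
    have b2 := mul_le_mul_of_nonneg_left hsp hd
    constructor <;> linarith
  · have hnl : ¬ cr.k < c.k := by omega
    simp only [blt_eq_decide, hnl, decide_false, cond_false] at w1 w2
    push_cast [Nat.cast_sub hge] at w1 w2
    have hd : (0 : ℝ) ≤ (cr.k : ℝ) - c.k := by
      have : (c.k : ℝ) ≤ cr.k := by exact_mod_cast hge
      linarith
    have b1 := mul_le_mul_of_nonneg_left hsn hd
    have b2 := mul_le_mul_of_nonneg_left hsp hd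
    constructor <;> linarith

/-- Tests all pairs of a list, the earlier element first. -/
noncomputable def allPairs (f : Cell → Cell → Bool) (L : List Cell) : Bool :=
  List.rec true (fun c t ih =>
    (List.rec (motive := fun _ => Bool) true (fun c' _ ih' => (f c c').and ih') t).and ih) L

theorem allPairs_pairwise {f : Cell → Cell → Bool} {L : List Cell} (h : allPairs f L = true) :
    L.Pairwise fun c c' => f c c' = true := by
  induction L with
  | nil => exact List.Pairwise.nil
  | cons c t ih =>
    change ((List.rec (motive := fun _ => Bool) true (fun c' _ ih' => (f c c').and ih') t).and
      (allPairs f t)) = true at h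
    rw [Bool.and_eq_true] at h
    refine List.Pairwise.cons ?_ (ih h.2)
    have h1 := h.1
    clear h ih
    induction t with
    | nil => simp
    | cons a t ih =>
      rw [Bool.and_eq_true] at h1
      intro c' hc'
      rcases List.mem_cons.1 hc' with rfl | hc'
      · exact h1.1
      · exact ih h1.2 c' hc'

theorem of_allPairs {f : Cell → Cell → Bool} {L : List Cell} {A Z : ℕ}
    (hL : L.map Cell.k = List.range' (A + 1) (Z - A - 1)) (h : allPairs f L = true) {p r : ℕ}
    (h1 : A < p) (h2 : p < r) (h3 : r < Z) :
    ∃ c ∈ L, ∃ c' ∈ L, c.k = p ∧ c'.k = r ∧ f c c' = true := by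
  have hlen : L.length = Z - A - 1 := by
    rw [← List.length_map (f := Cell.k), hL, List.length_range']
  have hk : ∀ (i : ℕ) (hi : i < L.length), (L[i]).k = A + 1 + i := by
    intro i hi
    rw [← List.getElem_map Cell.k (h := by rwa [List.length_map])]
    simp only [hL, List.getElem_range', one_mul]
  have hpw := List.pairwise_iff_getElem.1 (allPairs_pairwise h) (p - A - 1) (r - A - 1)
    (by omega) (by omega) (by omega)
  exact ⟨_, List.getElem_mem (by omega), _, List.getElem_mem (by omega),
    by rw [hk]; omega, by rw [hk]; omega, hpw⟩

/-- The test of a pair of interpolation points with a defect at one of them; the bridge points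
lie beyond `m` if the defect is at the second point, and beyond `m'` if it is at the first. -/
noncomputable def exactTest (Z nn s RB : ℕ) (L : List Cell) (m m' : ℕ) (c c' : Cell) : Bool :=
  force (defectNeg Z m c'.k c'.ch L) fun a => force (defectPos Z m c'.k c'.cl L) fun b =>
  force (defectNeg Z m' c.k c.ch L) fun a' => force (defectPos Z m' c.k c.cl L) fun b' =>
    (pairTest nn s RB L c c' 0 0 a b).and (pairTest nn s RB L c c' a' b' 0 0)

/-- A faster and coarser test that allows for defects at both points. -/
noncomputable def coarseTest (Z nn s RB : ℕ) (L : List Cell) (m : ℕ) (c c' : Cell) : Bool :=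
  force (defectNeg Z m c'.k c'.ch L) fun a => force (defectPos Z m c'.k c'.cl L) fun b =>
  force (defectNeg Z m c.k c.ch L) fun a' => force (defectPos Z m c.k c.cl L) fun b' =>
    pairTest nn s RB L c c' a' b' a b

theorem errLe_of_exactTest {n A Z s Q Qc RB : ℕ} {Y : ℕ → ℝ} {L : List Cell} (hn : 0 < n)
    (hs : 0 < s) (hL : L.map Cell.k = List.range' (A + 1) (Z - A - 1))
    (hv : ∀ c ∈ L, c.Valid n A Z s Q Qc Y) {m : ℕ → ℕ → ℕ} (hm : ∀ p r, A < p → A < r → A ≤ m p r)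
    (ht : allPairs (fun c c' => force (m c.k c'.k) fun a => force (m c'.k c.k) fun b =>
      exactTest Z (n ^ n) s RB L a b c c') L = true) :
    ErrLe n A Z m Y (RB / (n : ℝ) ^ n - 1 / 2) := by
  intro p r α β δ hAp hpZ hAr hrZ hne hδ hlp hlr
  have hAm := hm p r hAp hAr
  simp only [exactTest, force_eq] at ht
  rcases lt_or_gt_of_ne hne with hlt | hlt
  · obtain ⟨c, hc, c', hc', rfl, rfl, htest⟩ := of_allPairs hL ht hAp hlt hrZ
    rw [Bool.and_eq_true] at htest
    have hb := defect_bounds hL hv hc' hAm (hAp.trans hpZ) hδ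
    exact errSum_le_of_pairTest hn hs hL hv hc hc' hlt (δp := 0) (δr := δ) (by simp) (by simp)
      hb.2 hb.1 (by rw [hlp, add_zero]) hlr htest.1
  · obtain ⟨c, hc, c', hc', rfl, rfl, htest⟩ := of_allPairs hL ht hAr hlt hpZ
    rw [Bool.and_eq_true] at htest
    have hb := defect_bounds hL hv hc hAm (hAp.trans hpZ) hδ
    exact errSum_le_of_pairTest hn hs hL hv hc hc' hlt (δp := δ) (δr := 0) hb.2 hb.1 (by simp)
      (by simp) hlr (by rw [hlp, add_zero]) htest.2

theorem errLe_of_coarseTest {n A Z s Q Qc RB : ℕ} {Y : ℕ → ℝ} {L : List Cell} (hn : 0 < n)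
    (hs : 0 < s) (hL : L.map Cell.k = List.range' (A + 1) (Z - A - 1))
    (hv : ∀ c ∈ L, c.Valid n A Z s Q Qc Y) {m : ℕ → ℕ → ℕ} {m₀ : ℕ → ℕ → ℕ}
    (hm₀ : ∀ p r, A < p → A < r → A ≤ m₀ p r) (h1 : ∀ p r, m₀ p r ≤ m p r)
    (h2 : ∀ p r, m₀ p r ≤ m r p)
    (ht : allPairs (fun c c' => force (m₀ c.k c'.k) fun a =>
      coarseTest Z (n ^ n) s RB L a c c') L = true) :
    ErrLe n A Z m Y (RB / (n : ℝ) ^ n - 1 / 2) := by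
  intro p r α β δ hAp hpZ hAr hrZ hne hδ hlp hlr
  simp only [coarseTest, force_eq] at ht
  rcases lt_or_gt_of_ne hne with hlt | hlt
  · obtain ⟨c, hc, c', hc', rfl, rfl, htest⟩ := of_allPairs hL ht hAp hlt hrZ
    have hb := defect_bounds hL hv hc' (hm₀ _ _ hAp hAr) (hAp.trans hpZ) (hδ.mono (h1 _ _))
    exact errSum_le_of_pairTest hn hs hL hv hc hc' hlt (δp := 0) (δr := δ) (by simp) (by simp)
      hb.2 hb.1 (by rw [hlp, add_zero]) hlr htest
  · obtain ⟨c, hc, c', hc', rfl, rfl, htest⟩ := of_allPairs hL ht hAr hlt hpZ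
    have hb := defect_bounds hL hv hc (hm₀ _ _ hAr hAp) (hAp.trans hpZ) (hδ.mono (h2 _ _))
    exact errSum_le_of_pairTest hn hs hL hv hc hc' hlt (δp := δ) (δr := 0) hb.2 hb.1 (by simp)
      (by simp) hlr (by rw [hlp, add_zero]) htest

/-! ### Construction of the cells -/

/-- A lower bound for `s * dev Y A Z k + Q` when `nlo ≤ Y ≤ nhi`. -/
def fixLo (A Z s Q : ℕ) (nlo nhi : ℕ → ℕ) (k : ℕ) : ℕ :=
  (s * nlo k * (Z - A) + Q * ((Z - A) * ((k - A) * (Z - k)))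
    - s * (nhi A * (Z - k) + nhi Z * (k - A))) / ((Z - A) * ((k - A) * (Z - k)))

/-- An upper bound for `s * dev Y A Z k + Q` when `nlo ≤ Y ≤ nhi`. -/
def fixHi (A Z s Q : ℕ) (nlo nhi : ℕ → ℕ) (k : ℕ) : ℕ :=
  (s * nhi k * (Z - A) + Q * ((Z - A) * ((k - A) * (Z - k)))
    - s * (nlo A * (Z - k) + nlo Z * (k - A))) / ((Z - A) * ((k - A) * (Z - k))) + 1

theorem fix_bounds {A Z s Q k : ℕ} {nlo nhi : ℕ → ℕ} {Y : ℕ → ℝ}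
    (hY : ∀ j, A ≤ j → j ≤ Z → (nlo j : ℝ) ≤ Y j ∧ Y j ≤ nhi j) (hQ : s * (nhi A + nhi Z) ≤ Q)
    (h1 : A < k) (h2 : k < Z) :
    (fixLo A Z s Q nlo nhi k : ℝ) ≤ s * dev Y A Z k + Q ∧
      s * dev Y A Z k + Q ≤ fixHi A Z s Q nlo nhi k := by
  obtain ⟨a, rfl⟩ := Nat.exists_eq_add_of_lt h1
  obtain ⟨b, rfl⟩ := Nat.exists_eq_add_of_lt h2
  have yA := hY A le_rfl (by omega)
  have yk := hY (A + a + 1) (by omega) (by omega)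
  have yZ := hY (A + a + 1 + b + 1) (by omega) le_rfl
  have e1 : A + a + 1 + b + 1 - A = a + 1 + (b + 1) := by omega
  have e2 : A + a + 1 - A = a + 1 := by omega
  have e3 : A + a + 1 + b + 1 - (A + a + 1) = b + 1 := by omega
  unfold fixLo fixHi
  rw [e1, e2, e3]
  have key : s * dev Y A (A + a + 1 + b + 1) (A + a + 1) + Q
      = (s * Y (A + a + 1) * ((a : ℝ) + 1 + (b + 1))
        + Q * (((a : ℝ) + 1 + (b + 1)) * ((a + 1) * (b + 1)))
        - s * (Y A * (b + 1) + Y (A + a + 1 + b + 1) * (a + 1)))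
        / (((a : ℝ) + 1 + (b + 1)) * ((a + 1) * (b + 1))) := by
    unfold dev chord wt
    have e4 : ((A + a + 1 + b + 1 : ℕ) : ℝ) - ((A + a + 1 : ℕ) : ℝ) = b + 1 := by push_cast; ring
    have e5 : ((A + a + 1 + b + 1 : ℕ) : ℝ) - (A : ℝ) = a + 1 + (b + 1) := by push_cast; ring
    have e6 : ((A + a + 1 : ℕ) : ℝ) - (A : ℝ) = a + 1 := by push_cast; ring
    rw [e4, e5, e6]
    have : (a : ℝ) + 1 ≠ 0 := by positivity
    have : (b : ℝ) + 1 ≠ 0 := by positivity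
    have : (a : ℝ) + 1 + (b + 1) ≠ 0 := by positivity
    field_simp
    ring
  have hs0 : (0 : ℝ) ≤ s := Nat.cast_nonneg _
  have hD : (0 : ℝ) < ((a : ℝ) + 1 + (b + 1)) * ((a + 1) * (b + 1)) := by positivity
  have hDc : (((a + 1 + (b + 1)) * ((a + 1) * (b + 1)) : ℕ) : ℝ)
      = ((a : ℝ) + 1 + (b + 1)) * ((a + 1) * (b + 1)) := by push_cast; ring
  constructor
  · have hle : s * (nhi A * (b + 1) + nhi (A + a + 1 + b + 1) * (a + 1))
        ≤ s * nlo (A + a + 1) * (a + 1 + (b + 1))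
          + Q * ((a + 1 + (b + 1)) * ((a + 1) * (b + 1))) := by
      have i1 := Nat.mul_le_mul_right ((a + 1) * (b + 1)) hQ
      have i2 : s * (nhi A * (b + 1) + nhi (A + a + 1 + b + 1) * (a + 1))
          ≤ s * (nhi A + nhi (A + a + 1 + b + 1)) * ((a + 1) * (b + 1)) := by
        have : nhi A * (b + 1) + nhi (A + a + 1 + b + 1) * (a + 1)
            ≤ (nhi A + nhi (A + a + 1 + b + 1)) * ((a + 1) * (b + 1)) := by
          nlinarith [Nat.zero_le (nhi A * (a * (b + 1))),
            Nat.zero_le (nhi (A + a + 1 + b + 1) * ((a + 1) * b))]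
        calc _ ≤ s * ((nhi A + nhi (A + a + 1 + b + 1)) * ((a + 1) * (b + 1))) :=
              Nat.mul_le_mul_left s this
          _ = _ := by ring
      have i3 : Q * ((a + 1) * (b + 1)) ≤ Q * ((a + 1 + (b + 1)) * ((a + 1) * (b + 1))) := by
        apply Nat.mul_le_mul_left
        exact Nat.le_mul_of_pos_left _ (by omega)
      omega
    refine Nat.cast_div_le.trans ?_
    rw [key, hDc, Nat.cast_sub hle]
    refine div_le_div_of_nonneg_right ?_ hD.le
    push_cast
    have j1 := mul_le_mul_of_nonneg_left yk.1 hs0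
    have j2 := mul_le_mul_of_nonneg_left yA.2 hs0
    have j3 := mul_le_mul_of_nonneg_left yZ.2 hs0
    have j1' := mul_le_mul_of_nonneg_right j1 (by positivity : (0 : ℝ) ≤ (a : ℝ) + 1 + (b + 1))
    have j2' := mul_le_mul_of_nonneg_right j2 (by positivity : (0 : ℝ) ≤ (b : ℝ) + 1)
    have j3' := mul_le_mul_of_nonneg_right j3 (by positivity : (0 : ℝ) ≤ (a : ℝ) + 1)
    linarith
  · rw [key, div_le_iff₀ hD]
    have hdiv : ∀ x y : ℕ, 0 < y → (x : ℝ) ≤ ((x / y + 1 : ℕ) : ℝ) * y := by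
      intro x y hy
      have := Nat.lt_div_mul_add hy (a := x)
      have : x ≤ (x / y + 1) * y := by rw [add_mul, one_mul]; omega
      exact_mod_cast this
    have h := (sub_le_cast_sub _ _).trans (hdiv (s * nhi (A + a + 1) * (a + 1 + (b + 1))
      + Q * ((a + 1 + (b + 1)) * ((a + 1) * (b + 1)))
      - s * (nlo A * (b + 1) + nlo (A + a + 1 + b + 1) * (a + 1)))
      ((a + 1 + (b + 1)) * ((a + 1) * (b + 1))) (by positivity))
    rw [hDc] at h
    refine le_trans ?_ h
    push_cast
    have j1 := mul_le_mul_of_nonneg_left yk.2 hs0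
    have j2 := mul_le_mul_of_nonneg_left yA.1 hs0
    have j3 := mul_le_mul_of_nonneg_left yZ.1 hs0
    have j1' := mul_le_mul_of_nonneg_right j1 (by positivity : (0 : ℝ) ≤ (a : ℝ) + 1 + (b + 1))
    have j2' := mul_le_mul_of_nonneg_right j2 (by positivity : (0 : ℝ) ≤ (b : ℝ) + 1)
    have j3' := mul_le_mul_of_nonneg_right j3 (by positivity : (0 : ℝ) ≤ (a : ℝ) + 1)
    linarith

/-- Adds the lowest `K` cells, from above, to the list `acc`; `bc` are the binomial coefficients,
and the coefficients are between `nlo` and `nhi`. Handed on are the bounds `cl'`, `ch'` of the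
preceding cell for `devC`, and the bounds `sp`, `sn` for its increments so far. -/
noncomputable def mkCells (n A Z s Q Qc : ℕ) (bc nlo nhi : ℕ → ℕ) (K : ℕ) :
    List Cell → ℕ → ℕ → ℕ → ℕ → List Cell :=
  Nat.rec (fun acc _ _ _ _ => acc) (fun i ih acc cl' ch' sp sn =>
    force (A + 1 + i) fun k => force (fixLo A Z s Q nlo nhi k) fun lo =>
    force (fixHi A Z s Q nlo nhi k) fun hi => force (fixLo A Z s Qc bc bc k) fun cl =>
    force (fixHi A Z s Qc bc bc k) fun ch => force (mx sp (ch' - cl)) fun sp =>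
    force (mx sn (ch - cl')) fun sn => force (weight n A Z k) fun W =>
    ih (⟨k, lo, hi, cl, ch, sp, sn, W⟩ :: acc) cl ch sp sn) K

theorem mkCells_valid {n A Z s Q Qc : ℕ} {bc nlo nhi : ℕ → ℕ} {Y : ℕ → ℝ}
    (hY : ∀ j, A ≤ j → j ≤ Z → (nlo j : ℝ) ≤ Y j ∧ Y j ≤ nhi j) (hQ : s * (nhi A + nhi Z) ≤ Q)
    (hbc : ∀ j, A ≤ j → j ≤ Z → bc j = n.choose j) (hQc : s * (bc A + bc Z) ≤ Qc) (K : ℕ)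
    (hK : A + 1 + K ≤ Z) (acc : List Cell) (cl' ch' sp sn : ℕ)
    (hacc : acc.map Cell.k = List.range' (A + 1 + K) (Z - A - 1 - K))
    (hv : ∀ c ∈ acc, c.Valid n A Z s Q Qc Y)
    (hprev : A + 1 + K < Z → (cl' : ℝ) ≤ s * devC n A Z (A + 1 + K) + Qc ∧
      s * devC n A Z (A + 1 + K) + Qc ≤ ch')
    (hsp : ∀ j, A + 1 + K ≤ j → j + 1 < Z → s * (devC n A Z (j + 1) - devC n A Z j) ≤ sp)
    (hsn : ∀ j, A + 1 + K ≤ j → j + 1 < Z → s * (devC n A Z j - devC n A Z (j + 1)) ≤ sn) :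
    (mkCells n A Z s Q Qc bc nlo nhi K acc cl' ch' sp sn).map Cell.k
      = List.range' (A + 1) (Z - A - 1) ∧
    ∀ c ∈ mkCells n A Z s Q Qc bc nlo nhi K acc cl' ch' sp sn, c.Valid n A Z s Q Qc Y := by
  induction K generalizing acc cl' ch' sp sn with
  | zero =>
    refine ⟨?_, hv⟩
    rw [add_zero, Nat.sub_zero] at hacc
    exact hacc
  | succ K ih =>
    have hC : ∀ j, A ≤ j → j ≤ Z → (bc j : ℝ) ≤ (n.choose j : ℝ) ∧ (n.choose j : ℝ) ≤ bc j :=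
      fun j h1 h2 => by rw [hbc j h1 h2]; exact ⟨le_rfl, le_rfl⟩
    have b1 := fix_bounds hY hQ (k := A + 1 + K) (by omega) (by omega)
    have b2 := fix_bounds hC hQc (k := A + 1 + K) (by omega) (by omega)
    change _ ∧ _ at b2
    rw [← devC] at b2
    have hsp' : ∀ j, A + 1 + K ≤ j → j + 1 < Z → s * (devC n A Z (j + 1) - devC n A Z j)
        ≤ ((max sp (ch' - fixLo A Z s Qc bc bc (A + 1 + K)) : ℕ) : ℝ) := by
      intro j h1 h2
      rw [Nat.cast_max]
      rcases h1.eq_or_lt with rfl | h1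
      · refine le_max_of_le_right (le_trans ?_ (sub_le_cast_sub _ _))
        have := (hprev (by omega)).2
        rw [show A + 1 + (K + 1) = A + 1 + K + 1 by omega] at this
        linarith [b2.1]
      · exact le_max_of_le_left (hsp j (by omega) h2)
    have hsn' : ∀ j, A + 1 + K ≤ j → j + 1 < Z → s * (devC n A Z j - devC n A Z (j + 1))
        ≤ ((max sn (fixHi A Z s Qc bc bc (A + 1 + K) - cl') : ℕ) : ℝ) := by
      intro j h1 h2
      rw [Nat.cast_max]
      rcases h1.eq_or_lt with rfl | h1
      · refine le_max_of_le_right (le_trans ?_ (sub_le_cast_sub _ _))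
        have := (hprev (by omega)).1
        rw [show A + 1 + (K + 1) = A + 1 + K + 1 by omega] at this
        linarith [b2.2]
      · exact le_max_of_le_left (hsn j (by omega) h2)
    have heq : mkCells n A Z s Q Qc bc nlo nhi (K + 1) acc cl' ch' sp sn
        = mkCells n A Z s Q Qc bc nlo nhi K
          (⟨A + 1 + K, fixLo A Z s Q nlo nhi (A + 1 + K), fixHi A Z s Q nlo nhi (A + 1 + K),
            fixLo A Z s Qc bc bc (A + 1 + K), fixHi A Z s Qc bc bc (A + 1 + K),
            max sp (ch' - fixLo A Z s Qc bc bc (A + 1 + K)),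
            max sn (fixHi A Z s Qc bc bc (A + 1 + K) - cl'), weight n A Z (A + 1 + K)⟩ :: acc)
          (fixLo A Z s Qc bc bc (A + 1 + K)) (fixHi A Z s Qc bc bc (A + 1 + K))
          (max sp (ch' - fixLo A Z s Qc bc bc (A + 1 + K)))
          (max sn (fixHi A Z s Qc bc bc (A + 1 + K) - cl')) := by
      rw [← mx_eq, ← mx_eq]
      simp only [mkCells, force_eq]
    rw [heq]
    refine ih (by omega) _ _ _ _ _ ?_ ?_ (fun _ => b2) hsp' hsn'
    · rw [List.map_cons, hacc, show Z - A - 1 - K = Z - A - 1 - (K + 1) + 1 by omega,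
        List.range'_succ]
      rfl
    · intro c hc
      rcases List.mem_cons.1 hc with rfl | hc
      · exact ⟨b1.1, b1.2, b2.1, b2.2, hsp', hsn', rfl⟩
      · exact hv c hc

/-! ### Digits -/

theorem digit_sum {b : ℕ} (hb : 0 < b) (a : ℕ → ℕ) (N : ℕ) (ha : ∀ k < N, a k < b) (j : ℕ)
    (hj : j < N) : (∑ k ∈ range N, a k * b ^ k) / b ^ j % b = a j := by
  induction N generalizing a j with
  | zero => omega
  | succ N ih =>
    have e : ∑ k ∈ range (N + 1), a k * b ^ k
        = a 0 + b * ∑ k ∈ range N, a (k + 1) * b ^ k := by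
      rw [sum_range_succ', mul_sum, add_comm, pow_zero, mul_one]
      congr 1
      exact sum_congr rfl fun k _ => by ring
    rw [e]
    rcases j with _ | j
    · rw [pow_zero, Nat.div_one, Nat.add_mul_mod_self_left, Nat.mod_eq_of_lt (ha 0 (by omega))]
    · rw [pow_succ', ← Nat.div_div_eq_div_mul, Nat.add_mul_div_left _ _ hb,
        Nat.div_eq_of_lt (ha 0 (by omega)), zero_add]
      exact ih (fun k => a (k + 1)) (fun k hk => ha (k + 1) (by omega)) j (by omega)

/-- The digit of order `k` of `T` in base `2 ^ b`. -/
def digit (b T k : ℕ) : ℕ := Nat.land (Nat.shiftRight T (Nat.mul b k)) (Nat.pred (Nat.pow 2 b))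

theorem digit_eq (b T k : ℕ) : digit b T k = T / (2 ^ b) ^ k % 2 ^ b := by
  rw [← pow_mul, ← Nat.shiftRight_eq_div_pow, ← Nat.and_two_pow_sub_one_eq_mod]; rfl

theorem choose_lt_two_pow {n : ℕ} (hn : 0 < n) (k : ℕ) : n.choose k < 2 ^ n := by
  rcases lt_or_ge n k with h | h
  · rw [Nat.choose_eq_zero_of_lt h]; positivity
  have h1 := Nat.sum_range_choose n
  rcases Nat.eq_zero_or_pos k with rfl | hk0
  · rw [Nat.choose_zero_right]; exact Nat.one_lt_two_pow hn.ne'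
  · have : n.choose k + n.choose 0 ≤ ∑ m ∈ range (n + 1), n.choose m := by
      rw [← sum_pair (f := fun m => n.choose m) hk0.ne']
      refine sum_le_sum_of_subset fun x hx => ?_
      rcases mem_insert.1 hx with rfl | hx
      · exact mem_range.2 (by omega)
      · rw [mem_singleton.1 hx]; exact mem_range.2 (by omega)
    rw [h1, Nat.choose_zero_right] at this
    omega

/-- The number with the digits `C(n, k)` in base `2 ^ n`. -/
def binomialNumber (n : ℕ) : ℕ := Nat.pow (Nat.succ (Nat.pow 2 n)) n

theorem digit_binomialNumber {n k : ℕ} (hn : 0 < n) (hk : k ≤ n) :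
    digit n (binomialNumber n) k = n.choose k := by
  have e : binomialNumber n = ∑ k ∈ range (n + 1), n.choose k * (2 ^ n) ^ k := by
    change (2 ^ n + 1) ^ n = _
    rw [add_pow]
    exact sum_congr rfl fun k _ => by rw [one_pow, mul_one, mul_comm, Nat.cast_id]
  rw [digit_eq, e]
  exact digit_sum (by positivity) _ _ (fun k _ => choose_lt_two_pow hn k) k (by omega)

/-! ### The error bound as a fraction -/

/-- The error bound multiplied by `n ^ n`, in terms of the binomial coefficients `bc`. -/
def boundNum (l w : ℕ) (bc : ℕ → ℕ) : ℕ :=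
  mx ((l + 1) ^ (l + 1) * (l * w - l - 1) ^ (l * w - l - 1))
    ((w + 1) ^ (w + 1) * (l * w - w - 1) ^ (l * w - w - 1)) * (l * w - w - l - 1) *
    (bc (l * w / 2) - (bc (l + 1) - (bc (l + 1) - bc (w + 1))))

theorem errorBound_eq {l w : ℕ} (h : l + w + 1 ≤ l * w) {bc : ℕ → ℕ}
    (hbc : ∀ k ≤ l * w, bc k = (l * w).choose k) :
    errorBound l w = (boundNum l w bc : ℝ) / ((l * w : ℕ) : ℝ) ^ (l * w) := by
  have hmin : bc (l + 1) - (bc (l + 1) - bc (w + 1)) = min (bc (l + 1)) (bc (w + 1)) := by omega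
  unfold errorBound boundNum
  rw [hmin, mx_eq, hbc _ (by omega), hbc _ (by omega), hbc _ (by omega)]
  have h1 : min ((l * w).choose (l + 1)) ((l * w).choose (w + 1)) ≤ (l * w).choose (l * w / 2) :=
    (min_le_left _ _).trans (Nat.choose_le_middle _ _)
  have h2 : (0 : ℝ) ≤ ((l * w).choose (l * w / 2) : ℝ) -
      min ((l * w).choose (l + 1) : ℝ) ((l * w).choose (w + 1) : ℝ) := by
    rw [← Nat.cast_min, ← Nat.cast_sub h1]
    exact Nat.cast_nonneg _
  have c1 : ((l * w - w - l - 1 : ℕ) : ℝ) = (l : ℝ) * w - w - l - 1 := by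
    rw [Nat.cast_sub (by omega), Nat.cast_sub (by omega), Nat.cast_sub (by omega), Nat.cast_one,
      Nat.cast_mul]
  have c2 : ((l * w - l - 1 : ℕ) : ℝ) = (l : ℝ) * w - l - 1 := by
    rw [Nat.cast_sub (by omega), Nat.cast_sub (by omega), Nat.cast_one, Nat.cast_mul]
  have c3 : ((l * w - w - 1 : ℕ) : ℝ) = (l : ℝ) * w - w - 1 := by
    rw [Nat.cast_sub (by omega), Nat.cast_sub (by omega), Nat.cast_one, Nat.cast_mul]
  simp only
  rw [abs_of_nonneg h2]
  simp only [Nat.cast_mul, Nat.cast_sub h1, c1, c2, c3, Nat.cast_max, Nat.cast_pow, Nat.cast_min,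
    Nat.cast_add, Nat.cast_one]
  ring

/-! ### Tests of all interpolation points -/

/-- The test of all interpolation points, for coefficients between `nlo` and `nhi`. The scale is
`2 ^ 40`, and `dual` says whether the coefficients are those of the reflected second spline, which
interpolates exactly at `y` and not at `u`, so that the bridge points are subject to the bounds in
the other order. -/
noncomputable def exactCheck (l w : ℕ) (dual : Bool) (nlo nhi : ℕ → ℕ) : Bool :=
  force (l * w) fun n => force (n - w) fun Z => force (binomialNumber n) fun T =>
  force (2 ^ 40 * (nhi l + nhi Z + 2 ^ n)) fun Q =>
  force (2 ^ 40 * (digit n T l + digit n T Z)) fun Qc =>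
  force (n ^ n) fun nn => force (boundNum l w (digit n T)) fun RB =>
    (fun L => allPairs (fun c c' =>
      force (mx c.k (n - c'.k)) fun a => force (mx c'.k (n - c.k)) fun b =>
        bif dual then exactTest Z nn (2 ^ 40) RB L b a c c'
        else exactTest Z nn (2 ^ 40) RB L a b c c') L)
      (mkCells n l Z (2 ^ 40) Q Qc (digit n T) nlo nhi (Z - l - 1) [] (Qc + 2 ^ 40 * 2 ^ n) 0 0 0)

/-- A fast test of all interpolation points that uses nothing about the coefficients but that they
lie between `0` and the binomial coefficients. -/
noncomputable def coarseCheck (l w : ℕ) : Bool :=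
  force (l * w) fun n => force (n - w) fun Z => force (binomialNumber n) fun T =>
  force (2 ^ 40 * (digit n T l + digit n T Z + 2 ^ n)) fun Q =>
  force (n ^ n) fun nn => force (boundNum l w (digit n T)) fun RB =>
    (fun L => allPairs (fun c c' =>
      force (mx c.k (n - c'.k)) fun a => force (mx c'.k (n - c.k)) fun b =>
        force (a - (a - b)) fun m => coarseTest Z nn (2 ^ 40) RB L m c c') L)
      (mkCells n l Z (2 ^ 40) Q Q (digit n T) (fun _ => 0) (digit n T) (Z - l - 1) []
        (Q + 2 ^ 40 * 2 ^ n) 0 0 0)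

theorem errLe_of_exactCheck {l w : ℕ} (hl : 0 < l) (hw : 0 < w) (h : l + w + 1 ≤ l * w)
    {dual : Bool} {nlo nhi : ℕ → ℕ} {Y : ℕ → ℝ}
    (hY : ∀ j, l ≤ j → j ≤ l * w - w → (nlo j : ℝ) ≤ Y j ∧ Y j ≤ nhi j)
    (hc : exactCheck l w dual nlo nhi = true) :
    ErrLe (l * w) l (l * w - w)
      (fun p r => bif dual then max r (l * w - p) else max p (l * w - r)) Y
      (errorBound l w - 1 / 2) := by
  have hn : 0 < l * w := Nat.mul_pos hl hw
  have hbc : ∀ k ≤ l * w, digit (l * w) (binomialNumber (l * w)) k = (l * w).choose k :=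
    fun k hk => digit_binomialNumber hn hk
  simp only [exactCheck, force_eq, mx_eq] at hc
  have hcells := mkCells_valid (n := l * w) (s := 2 ^ 40) (bc := digit (l * w)
    (binomialNumber (l * w))) (Q := 2 ^ 40 * (nhi l + nhi (l * w - w) + 2 ^ (l * w))) hY
    (Nat.mul_le_mul_left _ (Nat.le_add_right _ _)) (fun j _ h2 => hbc j (by omega)) le_rfl
    (l * w - w - l - 1) (by omega) [] (2 ^ 40 * (digit (l * w) (binomialNumber (l * w)) l
      + digit (l * w) (binomialNumber (l * w)) (l * w - w)) + 2 ^ 40 * 2 ^ (l * w)) 0 0 0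
    (by simp) (by simp) (fun h => by omega) (fun j h1 h2 => by omega) (fun j h1 h2 => by omega)
  rw [errorBound_eq h hbc]
  refine errLe_of_exactTest hn (by positivity) hcells.1 hcells.2 ?_ ?_
  · intro p r h1 h2
    cases dual
    · exact le_max_of_le_left h1.le
    · exact le_max_of_le_left h2.le
  · simp only [force_eq]
    rw [← hc]
    congr 1
    funext c c'
    cases dual <;> rfl

theorem errLe_of_coarseCheck {l w : ℕ} (hl : 0 < l) (hw : 0 < w) (h : l + w + 1 ≤ l * w)
    {Y : ℕ → ℝ} (hY : ∀ j, l ≤ j → j ≤ l * w - w → 0 ≤ Y j ∧ Y j ≤ (l * w).choose j)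
    (hc : coarseCheck l w = true) {m : ℕ → ℕ → ℕ}
    (h1 : ∀ p r, min (max p (l * w - r)) (max r (l * w - p)) ≤ m p r) :
    ErrLe (l * w) l (l * w - w) m Y (errorBound l w - 1 / 2) := by
  have hn : 0 < l * w := Nat.mul_pos hl hw
  have hbc : ∀ k ≤ l * w, digit (l * w) (binomialNumber (l * w)) k = (l * w).choose k :=
    fun k hk => digit_binomialNumber hn hk
  have hmin : ∀ a b : ℕ, a - (a - b) = min a b := by omega
  simp only [coarseCheck, force_eq, mx_eq, hmin] at hc
  have hcells := mkCells_valid (n := l * w) (s := 2 ^ 40) (bc := digit (l * w)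
    (binomialNumber (l * w))) (nlo := fun _ => 0) (nhi := digit (l * w) (binomialNumber (l * w)))
    (Y := Y)
    (Q := 2 ^ 40 * (digit (l * w) (binomialNumber (l * w)) l
      + digit (l * w) (binomialNumber (l * w)) (l * w - w) + 2 ^ (l * w)))
    (Qc := 2 ^ 40 * (digit (l * w) (binomialNumber (l * w)) l
      + digit (l * w) (binomialNumber (l * w)) (l * w - w) + 2 ^ (l * w)))
    (fun j i1 i2 => by
      rw [hbc j (by omega), Nat.cast_zero]
      exact hY j i1 i2) (Nat.mul_le_mul_left _ (Nat.le_add_right _ _))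
    (fun j _ h2 => hbc j (by omega)) (Nat.mul_le_mul_left _ (Nat.le_add_right _ _))
    (l * w - w - l - 1) (by omega) [] (2 ^ 40 * (digit (l * w) (binomialNumber (l * w)) l
      + digit (l * w) (binomialNumber (l * w)) (l * w - w) + 2 ^ (l * w))
        + 2 ^ 40 * 2 ^ (l * w)) 0 0 0
    (by simp) (by simp) (fun h => by omega) (fun j h1 h2 => by omega) (fun j h1 h2 => by omega)
  rw [errorBound_eq h hbc]
  refine errLe_of_coarseTest (m₀ := fun p r => min (max p (l * w - r)) (max r (l * w - p))) hn
    (by positivity) hcells.1 hcells.2 ?_ h1 ?_ ?_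
  · intro p r i1 i2
    exact le_min (le_max_of_le_left i1.le) (le_max_of_le_left i2.le)
  · intro p r
    rw [min_comm]
    exact h1 r p
  · simp only [force_eq]
    exact hc

/-! ### A lower bound for the coefficients -/

/-- Joins the entries at `2 i` and `2 i + 1`. -/
def joinPairs : List Bool → List Bool
  | a :: b :: t => (a || b) :: (a || b) :: joinPairs t
  | t => t

/-- Joins the entries that are wired in the column `c`. -/
def joinWires (ε c : ℕ) (R : List Bool) : List Bool :=
  bif Nat.beq ((c + ε) % 2) 0 then joinPairs R
  else List.rec [] (fun a t _ => a :: joinPairs t) R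

/-- The restriction of the row set `R` to the closed contacts of a column. -/
def mask : (w : ℕ) → List Bool → (Fin w → Bool) → List Bool
  | 0, _, _ => []
  | _ + 1, [], _ => []
  | w + 1, b :: t, T => (b && T 0) :: mask w t (Fin.tail T)

/-- Whether a path from the nodes `R` of the column `j` to the sink exists that never runs
backwards. -/
def reaches (w ε : ℕ) : (m j : ℕ) → List Bool → (Fin m → Fin w → Bool) → Bool
  | 0, _, R, _ => R.any id
  | m + 1, j, R, σ => reaches w ε m (j + 1) (joinWires ε (j + 1) (mask w R (σ 0))) (Fin.tail σ)

/-- The sum of `z ^ |T| * f (R ∩ T)` over all sets `T` of closed contacts of a column. -/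
def subsetSum (z : ℕ) (R : List Bool) : (List Bool → ℕ) → ℕ :=
  List.rec (fun f => f []) (fun b _ ih f =>
    Bool.rec ((z + 1) * ih fun t => f (false :: t))
      (z * (ih fun t => f (true :: t)) + ih fun t => f (false :: t)) b) R

/-- The generating function, at `z`, of the sets of contacts with a forward path from `R`. -/
def forwardSum (z ε m : ℕ) : ℕ → List Bool → ℕ :=
  Nat.rec (fun _ R => bif R.any id then 1 else 0)
    (fun _ ih j R => subsetSum z R fun R' => ih (j + 1) (joinWires ε (j + 1) R')) m

/-- The number of closed contacts. -/
def size {w : ℕ} (T : Fin w → Bool) : ℕ := ∑ i, (T i).toNat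

theorem length_mask {w : ℕ} {R : List Bool} (hR : R.length = w) (T : Fin w → Bool) :
    (mask w R T).length = w := by
  induction w generalizing R with
  | zero => rfl
  | succ w ih =>
    cases R with
    | nil => simp at hR
    | cons b t => simp only [mask, List.length_cons, ih (by simpa using hR)]

theorem length_joinPairs (R : List Bool) : (joinPairs R).length = R.length := by
  induction R using joinPairs.induct with
  | case1 a b t ih => simp [joinPairs, ih]
  | case2 t h => rw [joinPairs.eq_def]; split <;> simp_all

theorem length_joinWires (ε c : ℕ) (R : List Bool) : (joinWires ε c R).length = R.length := by
  unfold joinWires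
  cases Nat.beq ((c + ε) % 2) 0
  · cases R <;> simp [length_joinPairs]
  · exact length_joinPairs R

theorem subsetSum_eq (z : ℕ) {w : ℕ} {R : List Bool} (hR : R.length = w) (f : List Bool → ℕ) :
    subsetSum z R f = ∑ T : Fin w → Bool, z ^ size T * f (mask w R T) := by
  induction w generalizing R f with
  | zero =>
    rw [List.length_eq_zero_iff.1 hR]
    simp [subsetSum, size, mask]
  | succ w ih =>
    cases R with
    | nil => simp at hR
    | cons b t =>
      have ht : t.length = w := by simpa using hR
      have e : ∑ T : Fin (w + 1) → Bool, z ^ size T * f (mask (w + 1) (b :: t) T)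
          = ∑ a : Bool, ∑ T : Fin w → Bool, z ^ (a.toNat + size T) * f ((b && a) :: mask w t T) := by
        rw [← (Fin.consEquiv (fun _ : Fin (w + 1) => Bool)).sum_comp, Fintype.sum_prod_type]
        refine sum_congr rfl fun a _ => sum_congr rfl fun T _ => ?_
        simp [size, mask, Fin.consEquiv, Fin.sum_univ_succ, Fin.tail_cons]
      rw [e, Fintype.sum_bool]
      cases b
      · change (z + 1) * subsetSum z t (fun t => f (false :: t)) = _
        rw [ih ht]
        simp only [Bool.toNat_true, Bool.toNat_false, Bool.false_and, zero_add, pow_add, pow_one,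
          mul_assoc, ← mul_sum]
        ring
      · change z * subsetSum z t (fun t => f (true :: t)) + subsetSum z t (fun t => f (false :: t))
          = _
        rw [ih ht, ih ht]
        simp only [Bool.toNat_true, Bool.toNat_false, Bool.true_and, zero_add, pow_add, pow_one,
          mul_assoc, ← mul_sum]

theorem forwardSum_eq (z ε : ℕ) {w : ℕ} (m j : ℕ) {R : List Bool} (hR : R.length = w) :
    forwardSum z ε m j R = ∑ σ : Fin m → Fin w → Bool,
      z ^ (∑ c, size (σ c)) * bif reaches w ε m j R σ then 1 else 0 := by
  induction m generalizing j R with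
  | zero => simp [forwardSum, reaches]
  | succ m ih =>
    change subsetSum z R (fun R' => forwardSum z ε m (j + 1) (joinWires ε (j + 1) R')) = _
    rw [subsetSum_eq z hR, ← (Fin.consEquiv (fun _ : Fin (m + 1) => Fin w → Bool)).sum_comp,
      Fintype.sum_prod_type]
    refine sum_congr rfl fun T _ => ?_
    rw [ih (j + 1) (by rw [length_joinWires, length_mask hR]), mul_sum]
    refine sum_congr rfl fun σ _ => ?_
    simp only [Fin.consEquiv, Equiv.coe_fn_mk, reaches, Fin.sum_univ_succ, Fin.cons_zero,
      Fin.cons_succ, Fin.tail_cons, pow_add]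
    ring

theorem getD_joinPairs {R : List Bool} {i : ℕ} (h : (joinPairs R).getD i false = true) :
    R.getD i false = true ∨ (i % 2 = 0 ∧ R.getD (i + 1) false = true) ∨
      (i % 2 = 1 ∧ R.getD (i - 1) false = true) := by
  induction R using joinPairs.induct generalizing i with
  | case1 a b t ih =>
    rw [joinPairs] at h
    rcases i with _ | _ | i
    · simp at h ⊢; tauto
    · simp at h ⊢; tauto
    · simp only [List.getD_cons_succ] at h
      have := ih h
      rcases this with h1 | h1 | h1
      · left; simpa using h1
      · right; left; exact ⟨by omega, by simpa using h1.2⟩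
      · right; right
        refine ⟨by omega, ?_⟩
        rcases i with _ | i
        · simp at h1
        · simpa using h1.2
  | case2 t h' =>
    left
    rw [joinPairs.eq_def] at h
    split at h
    · exact absurd rfl (h' _ _ _)
    · exact h

theorem getD_joinWires {ε c : ℕ} {R : List Bool} {i : ℕ}
    (h : (joinWires ε c R).getD i false = true) :
    R.getD i false = true ∨ ((i + c + ε) % 2 = 0 ∧ R.getD (i + 1) false = true) ∨
      (0 < i ∧ (i - 1 + c + ε) % 2 = 0 ∧ R.getD (i - 1) false = true) := by
  unfold joinWires at h
  by_cases hp : (c + ε) % 2 = 0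
  · rw [hp, Nat.beq_refl, cond_true] at h
    rcases getD_joinPairs h with h1 | h1 | h1
    · exact Or.inl h1
    · exact Or.inr (Or.inl ⟨by omega, h1.2⟩)
    · exact Or.inr (Or.inr ⟨by omega, by omega, h1.2⟩)
  · have : Nat.beq ((c + ε) % 2) 0 = false := by
      rw [← Bool.not_eq_true]; exact fun h0 => hp (Nat.eq_of_beq_eq_true h0)
    rw [this, cond_false] at h
    cases R with
    | nil => simp at h
    | cons a t =>
      rcases i with _ | i
      · left; simpa using h
      · simp only [List.getD_cons_succ] at h
        rcases getD_joinPairs h with h1 | h1 | h1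
        · left; simpa using h1
        · right; left; exact ⟨by omega, by simpa using h1.2⟩
        · right; right
          refine ⟨by omega, by omega, ?_⟩
          rcases i with _ | i
          · simp at h1
          · simpa using h1.2

theorem getD_mask {w : ℕ} {R : List Bool} {T : Fin w → Bool} {i : ℕ}
    (h : (mask w R T).getD i false = true) :
    R.getD i false = true ∧ ∃ hi : i < w, T ⟨i, hi⟩ = true := by
  induction w generalizing R i with
  | zero => simp [mask] at h
  | succ w ih =>
    cases R with
    | nil => simp [mask] at h
    | cons b t =>
      rcases i with _ | i
      · simp [mask] at h
        exact ⟨by simpa using h.1, Nat.succ_pos _, h.2⟩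
      · simp only [mask, List.getD_cons_succ] at h
        obtain ⟨h1, hi, h2⟩ := ih h
        exact ⟨by simpa using h1, Nat.succ_lt_succ hi, h2⟩

theorem source_eqvGen (l w ε : ℕ) (S : Finset (Fin w × Fin l)) {i : ℕ} (hi : i < w) :
    Relation.EqvGen (Link l w ε S) (0, 0) (i, 0) := by
  induction i with
  | zero => exact .refl _
  | succ i ih => exact (ih (by omega)).trans _ _ _ (.rel _ _ (.source i hi))

theorem sink_eqvGen (l w ε : ℕ) (S : Finset (Fin w × Fin l)) {i : ℕ} (hi : i < w) :
    Relation.EqvGen (Link l w ε S) (0, l) (i, l) := by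
  induction i with
  | zero => exact .refl _
  | succ i ih => exact (ih (by omega)).trans _ _ _ (.rel _ _ (.sink i hi))

/-- A forward path to the sink connects, if the nodes `R` of the column `j`, at one of which it
starts, are connected with the source. -/
theorem connects_of_reaches {l w ε : ℕ} {S : Finset (Fin w × Fin l)} (m j : ℕ) (hj : j + m = l)
    {R : List Bool} (hlen : R.length = w)
    (hR : ∀ i, R.getD i false = true → Relation.EqvGen (Link l w ε S) (0, 0) (i, j))
    (σ : Fin m → Fin w → Bool)
    (hσ : ∀ (c : Fin m) (i : Fin w), σ c i = true → (i, (⟨j + c, by omega⟩ : Fin l)) ∈ S)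
    (h : reaches w ε m j R σ = true) : Connects l w ε S := by
  induction m generalizing j R with
  | zero =>
    simp only [reaches, List.any_eq_true, id] at h
    obtain ⟨b, hb, rfl⟩ := h
    obtain ⟨i, hi, hbi⟩ := List.getElem_of_mem hb
    have h1 := hR i (by rw [List.getD_eq_getElem _ _ hi, hbi])
    rw [add_zero] at hj
    subst hj
    exact h1.trans _ _ _ (.symm _ _ (sink_eqvGen j w ε S (by omega)))
  | succ m ih =>
    have step : ∀ i, (mask w R (σ 0)).getD i false = true →
        i < w ∧ Relation.EqvGen (Link l w ε S) (0, 0) (i, j + 1) := by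
      intro i hi
      obtain ⟨h1, hiw, h2⟩ := getD_mask hi
      exact ⟨hiw, (hR i h1).trans _ _ _ (.rel _ _ (.contact _ (hσ 0 ⟨i, hiw⟩ h2)))⟩
    have wired : ∀ i, i + 1 < w → (i + (j + 1) + ε) % 2 = 0 →
        Relation.EqvGen (Link l w ε S) (i, j + 1) (i + 1, j + 1) := by
      intro i hi hp
      rcases (show j + 1 ≤ l by omega).eq_or_lt with hl | hl
      · rw [hl]; exact .rel _ _ (.sink i hi)
      · exact .rel _ _ (.wire i (j + 1) hi (by omega) hl hp)
    refine ih (j + 1) (by omega) (R := joinWires ε (j + 1) (mask w R (σ 0)))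
      (by rw [length_joinWires, length_mask hlen]) ?_ (Fin.tail σ) ?_ h
    · intro i hi
      rcases getD_joinWires hi with h1 | ⟨h0, h1⟩ | ⟨h0, h1, h2⟩
      · exact (step i h1).2
      · obtain ⟨h2, h3⟩ := step _ h1
        exact h3.trans _ _ _ (.symm _ _ (wired i h2 h0))
      · obtain ⟨i, rfl⟩ : ∃ a, i = a + 1 := ⟨i - 1, by omega⟩
        rw [Nat.add_sub_cancel] at h1 h2
        have hiw : i + 1 < w := by
          by_contra hcon
          have : (joinWires ε (j + 1) (mask w R (σ 0))).length ≤ i + 1 := by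
            rw [length_joinWires, length_mask hlen]; omega
          rw [List.getD_eq_default _ _ this] at hi
          exact absurd hi (by simp)
        exact (step i h2).2.trans _ _ _ (wired i hiw h1)
    · intro c i hc
      have := hσ c.succ i hc
      convert this using 3
      simp only [Fin.val_succ]
      omega

/-- The number whose digits in base `2 ^ (l * w)` count the sets of contacts with a forward
path from the source to the sink. -/
def forwardNumber (l w ε : ℕ) : ℕ := forwardSum (2 ^ (l * w)) ε l 0 (List.replicate w true)

theorem digit_forwardNumber_le {l w ε k : ℕ} (hl : 0 < l) (hw : 0 < w) (hk : k ≤ l * w) :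
    digit (l * w) (forwardNumber l w ε) k ≤ coeff l w ε k := by
  have hn : 0 < l * w := Nat.mul_pos hl hw
  set R := List.replicate w true with hR
  set P : (Fin l → Fin w → Bool) → Prop := fun σ => reaches w ε l 0 R σ = true with hP
  set a : ℕ → ℕ := fun k => (univ.filter fun σ => P σ ∧ ∑ c, size (σ c) = k).card with ha
  let toSet : (Fin l → Fin w → Bool) → Finset (Fin w × Fin l) :=
    fun σ => univ.filter fun e => σ e.2 e.1 = true
  have hinj : Function.Injective toSet := by
    intro σ τ h
    funext c i
    have : (i, c) ∈ toSet σ ↔ (i, c) ∈ toSet τ := by rw [h]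
    simp only [toSet, mem_filter, mem_univ, true_and] at this
    exact Bool.eq_iff_iff.2 this
  have hcard : ∀ σ, (toSet σ).card = ∑ c, size (σ c) := by
    intro σ
    simp only [toSet, card_filter, size]
    rw [Fintype.sum_prod_type_right]
    refine sum_congr rfl fun c _ => sum_congr rfl fun i _ => ?_
    cases σ c i <;> rfl
  have hle : ∀ k, a k ≤ coeff l w ε k := by
    intro k
    refine card_le_card_of_injOn toSet ?_ (hinj.injOn)
    intro σ hσ
    simp only [coe_filter, mem_univ, true_and, Set.mem_ofPred_eq, pathsets, mem_filter,
      hcard] at hσ ⊢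
    refine ⟨connects_of_reaches l 0 (by omega) (R := R) (by simp [hR]) ?_ σ ?_ hσ.1, hσ.2⟩
    · intro i hi
      have : i < w := by
        by_contra hcon
        rw [List.getD_eq_default _ _ (by simp [hR]; omega)] at hi
        exact absurd hi (by simp)
      exact source_eqvGen l w ε _ this
    · intro c i hc
      simp only [toSet, mem_filter, mem_univ, true_and, zero_add]
      exact hc
  have hsum : forwardNumber l w ε = ∑ k ∈ range (l * w + 1), a k * (2 ^ (l * w)) ^ k := by
    unfold forwardNumber
    rw [forwardSum_eq _ ε l 0 (w := w) (by simp)]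
    rw [← sum_fiberwise_of_maps_to (s := univ) (t := range (l * w + 1))
      (g := fun σ : Fin l → Fin w → Bool => ∑ c, size (σ c))]
    · refine sum_congr rfl fun k _ => ?_
      rw [ha]
      simp only
      rw [card_filter, sum_mul, sum_filter]
      refine sum_congr rfl fun σ _ => ?_
      by_cases h1 : ∑ c, size (σ c) = k
      · rw [if_pos h1, h1]
        by_cases h2 : P σ
        · rw [if_pos ⟨h2, rfl⟩]
          simp only [hP] at h2
          rw [← hR, h2]; simp
        · rw [if_neg (fun h => h2 h.1)]
          simp only [hP, Bool.not_eq_true] at h2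
          rw [← hR, h2]; simp
      · rw [if_neg h1, if_neg (fun h => h1 h.2), zero_mul]
    · intro σ _
      rw [← hcard, mem_range, Nat.lt_succ_iff]
      have := card_le_univ (toSet σ)
      rwa [Fintype.card_prod, Fintype.card_fin, Fintype.card_fin, mul_comm] at this
  rw [digit_eq, hsum, digit_sum (by positivity) a _ (fun k hk => ?_) k (by omega)]
  · exact hle k
  · exact ((hle k).trans (coeff_le_choose hl (by omega))).trans_lt (choose_lt_two_pow hn k)

/-! ### Peaks of the weights of binomial coefficients -/

theorem succ_pow_mul_pow_le {k j : ℕ} (h : k ≤ j) :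
    (k + 1) ^ k * j ^ j ≤ k ^ k * (j + 1) ^ j := by
  rcases Nat.eq_zero_or_pos k with rfl | hk
  · simpa using Nat.pow_le_pow_left (Nat.le_succ j) j
  have hk' : (0 : ℝ) < k := by exact_mod_cast hk
  have hj' : (0 : ℝ) < j := by exact_mod_cast hk.trans_le h
  have h1 : (1 : ℝ) ≤ j / k := by rw [one_le_div hk']; exact_mod_cast h
  have h2 := one_add_mul_self_le_rpow_one_add
    (s := 1 / (j : ℝ)) (le_trans (by norm_num) (by positivity : (0 : ℝ) ≤ 1 / j)) h1
  have h3 : (1 + (j : ℝ) / k * (1 / j)) ^ k ≤ (1 + 1 / (j : ℝ)) ^ j := by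
    calc (1 + (j : ℝ) / k * (1 / j)) ^ k ≤ ((1 + 1 / (j : ℝ)) ^ ((j : ℝ) / k)) ^ k := by
          gcongr
      _ = (1 + 1 / (j : ℝ)) ^ j := by
          rw [← Real.rpow_mul_natCast (by positivity), div_mul_cancel₀ _ hk'.ne',
            Real.rpow_natCast]
  have e1 : 1 + (j : ℝ) / k * (1 / j) = (k + 1) / k := by field_simp
  have e2 : 1 + 1 / (j : ℝ) = (j + 1) / j := by field_simp
  rw [e1, e2, div_pow, div_pow, div_le_div_iff₀ (by positivity) (by positivity)] at h3
  have : ((k : ℝ) + 1) ^ k * (j : ℝ) ^ j ≤ (k : ℝ) ^ k * ((j : ℝ) + 1) ^ j := by linarith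
  exact_mod_cast this

theorem peak_mul_choose_succ_le {n k : ℕ} (h : 2 * k + 1 ≤ n) :
    peak n (k + 1) * n.choose (k + 1) ≤ peak n k * n.choose k := by
  obtain ⟨j, rfl⟩ : ∃ j, n = k + j + 1 := ⟨n - k - 1, by omega⟩
  have h1 := succ_pow_mul_pow_le (show k ≤ j by omega)
  have h2 := Nat.choose_succ_right_eq (k + j + 1) k
  have e1 : k + j + 1 - k = j + 1 := by omega
  have e2 : k + j + 1 - (k + 1) = j := by omega
  rw [e1] at h2
  unfold peak
  rw [e1, e2, div_mul_eq_mul_div, div_mul_eq_mul_div]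
  refine div_le_div_of_nonneg_right ?_ (by positivity)
  suffices (k + 1) ^ (k + 1) * j ^ j * (k + j + 1).choose (k + 1)
      ≤ k ^ k * (j + 1) ^ (j + 1) * (k + j + 1).choose k by exact_mod_cast this
  calc (k + 1) ^ (k + 1) * j ^ j * (k + j + 1).choose (k + 1)
      = (k + 1) ^ k * j ^ j * ((k + j + 1).choose (k + 1) * (k + 1)) := by ring
    _ ≤ k ^ k * (j + 1) ^ j * ((k + j + 1).choose k * (j + 1)) := by
        rw [h2]; exact Nat.mul_le_mul_right _ h1
    _ = _ := by ring

theorem peak_mul_choose_le_of_le {n i k : ℕ} (hik : i ≤ k) (hk : 2 * k ≤ n) :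
    peak n k * n.choose k ≤ peak n i * n.choose i := by
  induction k, hik using Nat.le_induction with
  | base => exact le_rfl
  | succ k _ ih => exact (peak_mul_choose_succ_le (by omega)).trans (ih (by omega))

/-- The products `peak n k * n.choose k` decrease towards the middle. -/
theorem peak_mul_choose_le {n i k : ℕ} (hik : i ≤ k) (hk : k + i ≤ n) :
    peak n k * n.choose k ≤ peak n i * n.choose i := by
  rcases le_or_gt (2 * k) n with h | h
  · exact peak_mul_choose_le_of_le hik h
  · rw [← peak_symm (show k ≤ n by omega), ← Nat.choose_symm (show k ≤ n by omega)]
    exact peak_mul_choose_le_of_le (by omega) (by omega)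

theorem two_pow_le_succ_mul_choose (n : ℕ) : 2 ^ n ≤ (n + 1) * n.choose (n / 2) := by
  rw [← Nat.sum_range_choose]
  calc ∑ m ∈ range (n + 1), n.choose m ≤ ∑ _m ∈ range (n + 1), n.choose (n / 2) :=
        sum_le_sum fun m _ => Nat.choose_le_middle m n
    _ = _ := by simp

/-- This allows the `1 / 2` in `R - 1 / 2` to be written as a multiple of
`peak n i * n.choose i`. -/
theorem one_le_peak_mul_choose {n i : ℕ} (hi : 2 * i ≤ n) :
    1 ≤ peak n i * n.choose i * (n + 1) := by
  have h1 := peak_mul_choose_le_of_le (n := n) (i := i) (k := n / 2) (by omega) (by omega)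
  have h2 : (1 / 2 : ℝ) ^ n ≤ peak n (n / 2) := by
    have := pow_mul_pow_le_peak (n := n) (k := n / 2) (by omega) (p := 1 / 2) (by norm_num)
      (by norm_num)
    have e : (1 - 1 / 2 : ℝ) = 1 / 2 := by norm_num
    rw [e, ← pow_add] at this
    rwa [show n / 2 + (n - n / 2) = n by omega] at this
  have h3 : (2 : ℝ) ^ n ≤ (n + 1) * n.choose (n / 2) := by
    exact_mod_cast two_pow_le_succ_mul_choose n
  calc (1 : ℝ) = (1 / 2) ^ n * 2 ^ n := by rw [← mul_pow]; norm_num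
    _ ≤ peak n (n / 2) * ((n + 1) * n.choose (n / 2)) := by
        gcongr
        exact peak_nonneg _ _
    _ = peak n (n / 2) * n.choose (n / 2) * (n + 1) := by ring
    _ ≤ _ := by gcongr

/-! ### An estimate that is uniform in the interpolation points -/

/-- The increments of `devC` are at most `W`, even after multiplication by (twice) the distance of
their place to the middle, plus one. -/
def SlopeLe (n A Z : ℕ) (W : ℝ) : Prop :=
  ∀ j, A < j → j + 1 < Z →
    |devC n A Z (j + 1) - devC n A Z j| * (|2 * (j : ℝ) + 1 - n| + 1) ≤ W

/-- The defect is at most of the order of `|p - r|`: a bridge point further away than this lies so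
far above the middle that `SlopeLe` makes up for its distance. -/
theorem IsDefect.abs_le {n A Z p r : ℕ} {δ osc W : ℝ} (hAZ : A < Z) (hp : A < p) (hr : A < r)
    (hrZ : r < Z) (hpr : p ≠ r) (hpn : p ≤ n) (hrn : r ≤ n)
    (h : IsDefect n A Z (min (max p (n - r)) (max r (n - p))) r δ) (hW0 : 0 ≤ W)
    (hosc : ∀ j k, A < j → j < Z → A < k → k < Z → |devC n A Z j - devC n A Z k| ≤ osc)
    (hW : SlopeLe n A Z W) : |δ| ≤ (osc + W) * |(p : ℝ) - r| := by
  have hd : 1 ≤ |(p : ℝ) - r| := by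
    have : (1 : ℤ) ≤ |(p : ℤ) - r| := Int.one_le_abs (by omega)
    exact_mod_cast this
  have hosc0 : 0 ≤ osc := (abs_nonneg _).trans (hosc r r hr hrZ hr hrZ)
  by_cases h0 : δ = 0
  · rw [h0, abs_zero]; positivity
  obtain ⟨x, s, hx, hxZ, rfl, hs1, hs2⟩ := h.exists_slope hAZ h0
  have hAx : A < x := by
    rcases min_lt_iff.1 hx with h1 | h1
    · exact hp.trans ((le_max_left _ _).trans_lt h1)
    · exact hr.trans ((le_max_left _ _).trans_lt h1)
  -- the distance of `r` to the bridge point is made up of a part below the distance of the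
  -- bridge point to the middle, which `SlopeLe` compensates, and of a part below `|p - r|`
  obtain ⟨τ, hτ0, hτ1, hτ2⟩ : ∃ τ : ℝ, 0 ≤ τ ∧ (τ = 0 ∨ τ ≤ 2 * (x : ℝ) - n) ∧
      |(r : ℝ) - x| ≤ τ + |(p : ℝ) - r| := by
    rcases le_total x r with hxr | hxr
    · refine ⟨0, le_rfl, Or.inl rfl, ?_⟩
      have hpx : p < x ∨ n - p < x ∧ r < x := by
        rcases min_lt_iff.1 hx with h1 | h1
        · exact Or.inl ((le_max_left _ _).trans_lt h1)
        · exact Or.inr ⟨(le_max_right _ _).trans_lt h1, (le_max_left _ _).trans_lt h1⟩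
      have hpx : p < x := by omega
      have a1 : (p : ℝ) < x := by exact_mod_cast hpx
      have a2 : (x : ℝ) ≤ r := by exact_mod_cast hxr
      rw [abs_of_nonneg (by linarith), abs_of_neg (by linarith)]
      linarith
    · have a2 : (r : ℝ) ≤ x := by exact_mod_cast hxr
      rw [abs_of_nonpos (by linarith)]
      have hsub : ∀ q ≤ n, n - q < x → (x : ℝ) - q ≤ 2 * (x : ℝ) - n := by
        intro q hq hqx
        have : n ≤ x + q := by omega
        have : (n : ℝ) ≤ x + q := by exact_mod_cast this
        linarith
      rcases min_lt_iff.1 hx with h1 | h1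
      · refine ⟨(x : ℝ) - r, by linarith,
          Or.inr (hsub r hrn ((le_max_right _ _).trans_lt h1)), ?_⟩
        linarith
      · have h2 := hsub p hpn ((le_max_right _ _).trans_lt h1)
        rcases le_total x p with hxp | hxp
        · refine ⟨0, le_rfl, Or.inl rfl, ?_⟩
          have a1 : (x : ℝ) ≤ p := by exact_mod_cast hxp
          have := le_abs_self ((p : ℝ) - r)
          linarith
        · have a1 : (p : ℝ) ≤ x := by exact_mod_cast hxp
          refine ⟨(x : ℝ) - p, by linarith, Or.inr h2, ?_⟩
          have := le_abs_self ((p : ℝ) - r)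
          linarith
  have hslope : |s| ≤ W / (τ + 1) := by
    have key : ∀ j, x ≤ j → j + 1 < Z →
        |devC n A Z (j + 1) - devC n A Z j| ≤ W / (τ + 1) := by
      intro j hj hjZ
      rw [le_div_iff₀ (by linarith)]
      refine le_trans ?_ (hW j (by omega) hjZ)
      gcongr
      rcases hτ1 with h1 | h1
      · rw [h1]; positivity
      · have : (x : ℝ) ≤ j := by exact_mod_cast hj
        have := le_abs_self (2 * (j : ℝ) + 1 - n)
        linarith
    refine _root_.abs_le.2 ⟨?_, ?_⟩
    · have := hs2 _ fun j h1 h2 => ((le_abs_self _).trans_eq (abs_sub_comm _ _)).trans (key j h1 h2)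
      linarith
    · exact hs1 _ fun j h1 h2 => (le_abs_self _).trans (key j h1 h2)
  calc |devC n A Z x - devC n A Z r + s * ((r : ℝ) - x)|
      ≤ |devC n A Z x - devC n A Z r| + |s| * |(r : ℝ) - x| := by
        rw [← abs_mul]; exact abs_add_le _ _
    _ ≤ osc + W / (τ + 1) * (τ + |(p : ℝ) - r|) := by
        gcongr
        exact hosc x r hAx (by omega) hr hrZ
    _ ≤ osc * |(p : ℝ) - r| + W / (τ + 1) * ((τ + 1) * |(p : ℝ) - r|) := by
        gcongr
        · exact le_mul_of_one_le_right hosc0 hd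
        · nlinarith
    _ = _ := by field_simp

theorem chord_nonneg {Y : ℕ → ℝ} {A Z k : ℕ} (h1 : A < k) (h2 : k < Z) (hA : 0 ≤ Y A)
    (hZ : 0 ≤ Y Z) : 0 ≤ chord Y A Z k := by
  have h1' : (A : ℝ) < k := by exact_mod_cast h1
  have h2' : (k : ℝ) < Z := by exact_mod_cast h2
  exact div_nonneg (add_nonneg (mul_nonneg hA (by linarith)) (mul_nonneg hZ (by linarith)))
    (by linarith)

theorem chord_mul_le {Y : ℕ → ℝ} {A Z k : ℕ} {S : ℝ} (h1 : A < k) (h2 : k < Z) (hA : 0 ≤ Y A)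
    (hZ : 0 ≤ Y Z) (hS : Y A + Y Z ≤ S) : chord Y A Z k * ((Z : ℝ) - A) ≤ S * wt A Z k := by
  have h1' : (A : ℝ) + 1 ≤ k := by exact_mod_cast h1
  have h2' : (k : ℝ) + 1 ≤ Z := by exact_mod_cast h2
  unfold chord wt
  rw [div_mul_cancel₀ _ (by linarith)]
  calc Y A * ((Z : ℝ) - k) + Y Z * ((k : ℝ) - A)
      ≤ Y A * (((k : ℝ) - A) * (Z - k)) + Y Z * (((k : ℝ) - A) * (Z - k)) := by
        gcongr
        · nlinarith
        · nlinarith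
    _ = (Y A + Y Z) * (((k : ℝ) - A) * (Z - k)) := by ring
    _ ≤ _ := mul_le_mul_of_nonneg_right hS (mul_nonneg (by linarith) (by linarith))

/-- Extrapolation from two nonnegative values at integer places: the two summands have opposite
signs outside the segment, and sum up to a convex combination inside. -/
theorem abs_extrapolate_le {p r k x y D : ℝ} {Γ : ℝ} (hx : 0 ≤ x) (hy : 0 ≤ y)
    (hpr : 1 ≤ |r - p|) (hkr : |r - k| ≤ D) (hkp : |k - p| ≤ D) (hD : 1 ≤ D) (hxΓ : x * D ≤ Γ)
    (hyΓ : y * D ≤ Γ) : |(r - k) * x + (k - p) * y| ≤ Γ * |r - p| := by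
  have e1 : |(r - k) * x| ≤ Γ := by
    rw [abs_mul, abs_of_nonneg hx]
    nlinarith
  have e2 : |(k - p) * y| ≤ Γ := by
    rw [abs_mul, abs_of_nonneg hy]
    nlinarith
  have hΓ : 0 ≤ Γ := (abs_nonneg _).trans e1
  have hΓ' : Γ ≤ Γ * |r - p| := le_mul_of_one_le_right hΓ hpr
  have hx' : x ≤ Γ := by nlinarith
  have hy' : y ≤ Γ := by nlinarith
  rcases le_total k p with h1 | h1 <;> rcases le_total k r with h2 | h2
  · have a1 : (k - p) * y ≤ 0 := mul_nonpos_of_nonpos_of_nonneg (by linarith) hy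
    have a2 : 0 ≤ (r - k) * x := mul_nonneg (by linarith) hx
    rw [abs_of_nonneg a2] at e1
    rw [abs_of_nonpos a1] at e2
    exact abs_le.2 ⟨by linarith, by linarith⟩
  · rw [abs_of_nonpos (by nlinarith), abs_of_nonpos (by linarith)]
    nlinarith
  · rw [abs_of_nonneg (by nlinarith), abs_of_nonneg (by linarith)]
    nlinarith
  · have a1 : 0 ≤ (k - p) * y := mul_nonneg (by linarith) hy
    have a2 : (r - k) * x ≤ 0 := mul_nonpos_of_nonpos_of_nonneg (by linarith) hx
    rw [abs_of_nonpos a2] at e1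
    rw [abs_of_nonneg a1] at e2
    exact abs_le.2 ⟨by linarith, by linarith⟩

theorem abs_natCast_sub_le {A Z i j : ℕ} (h1 : A < i) (h2 : i < Z) (h3 : A < j) (h4 : j < Z) :
    |(i : ℝ) - j| ≤ (Z : ℝ) - A := by
  have h1' : (A : ℝ) < i := by exact_mod_cast h1
  have h2' : (i : ℝ) < Z := by exact_mod_cast h2
  have h3' : (A : ℝ) < j := by exact_mod_cast h3
  have h4' : (j : ℝ) < Z := by exact_mod_cast h4
  exact abs_le.2 ⟨by linarith, by linarith⟩

/-- A uniform bound for a linear function through two values of `dev Y`, the second one with a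
defect, when `Y` lies between `0` and the binomial coefficients. -/
theorem abs_line_le {n A Z p r k : ℕ} {Y : ℕ → ℝ} {Γ W α β δ : ℝ}
    (hZn : Z ≤ n) (hY : ∀ j, A ≤ j → j ≤ Z → 0 ≤ Y j ∧ Y j ≤ n.choose j)
    (hΓ : ∀ j, A < j → j < Z → (n.choose j : ℝ) * ((Z : ℝ) - A) ≤ Γ * wt A Z j)
    (hW0 : 0 ≤ W) (hW : SlopeLe n A Z (W / ((Z : ℝ) - A)))
    (hp : A < p) (hpZ : p < Z) (hr : A < r) (hrZ : r < Z) (hk : A < k) (hkZ : k < Z) (hpr : p ≠ r)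
    (hδ : IsDefect n A Z (min (max p (n - r)) (max r (n - p))) r δ)
    (e1 : line A Z α β p = dev Y A Z p) (e2 : line A Z α β r = dev Y A Z r + δ) :
    |line A Z α β k| ≤ 2 * Γ + 2 * (n.choose A + n.choose Z) + W := by
  have hAZ : A < Z := by omega
  set S : ℝ := n.choose A + n.choose Z with hS
  set D : ℝ := (Z : ℝ) - A with hDdef
  have hD : 1 ≤ D := by
    have : (A : ℝ) + 1 ≤ Z := by exact_mod_cast hAZ
    linarith
  have hDpos : 0 < D := by linarith
  have hpr1 : 1 ≤ |(r : ℝ) - p| := by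
    have : (1 : ℤ) ≤ |(r : ℤ) - p| := Int.one_le_abs (by omega)
    exact_mod_cast this
  have hYA := hY A le_rfl hAZ.le
  have hYZ := hY Z hAZ.le le_rfl
  have up : ∀ {X : ℕ → ℝ} {j : ℕ}, A < j → j < Z → X j ≤ n.choose j → X j / wt A Z j * D ≤ Γ := by
    intro X j h1 h2 h3
    rw [div_mul_eq_mul_div, div_le_iff₀ (wt_pos h1 h2)]
    exact (mul_le_mul_of_nonneg_right h3 hDpos.le).trans (hΓ j h1 h2)
  have down : ∀ {X : ℕ → ℝ} {j : ℕ}, A < j → j < Z → 0 ≤ X A → 0 ≤ X Z → X A + X Z ≤ S →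
      chord X A Z j / wt A Z j * D ≤ S := by
    intro X j h1 h2 h3 h4 h5
    rw [div_mul_eq_mul_div, div_le_iff₀ (wt_pos h1 h2)]
    exact chord_mul_le h1 h2 h3 h4 h5
  have hosc : ∀ j k, A < j → j < Z → A < k → k < Z →
      |devC n A Z j - devC n A Z k| ≤ (Γ + S) / D := by
    have one : ∀ j k, A < j → j < Z → A < k → k < Z →
        devC n A Z j - devC n A Z k ≤ (Γ + S) / D := by
      intro j k h1 h2 h3 h4
      rw [le_div_iff₀ hDpos]
      have a1 := up (X := fun i => (n.choose i : ℝ)) h1 h2 le_rfl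
      have a2 := down (X := fun i => (n.choose i : ℝ)) h3 h4 (by positivity) (by positivity) le_rfl
      have a3 : 0 ≤ (n.choose k : ℝ) / wt A Z k * D :=
        mul_nonneg (div_nonneg (by positivity) (wt_pos h3 h4).le) hDpos.le
      have a4 : 0 ≤ chord (fun i => (n.choose i : ℝ)) A Z j / wt A Z j * D :=
        mul_nonneg (div_nonneg (chord_nonneg h1 h2 (by positivity) (by positivity))
          (wt_pos h1 h2).le) hDpos.le
      simp only [devC, dev, sub_div]
      linarith
    intro j k h1 h2 h3 h4
    exact abs_sub_le_iff.2 ⟨one j k h1 h2 h3 h4, one k j h3 h4 h1 h2⟩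
  have hδ' := hδ.abs_le hAZ hp hr hrZ hpr (by omega) (by omega) (by positivity) hosc hW
  rw [abs_sub_comm, ← add_div] at hδ'
  have hkp := abs_natCast_sub_le hk hkZ hp hpZ
  have hrk := abs_natCast_sub_le hr hrZ hk hkZ
  have b1 := abs_extrapolate_le (x := Y p / wt A Z p) (y := Y r / wt A Z r)
    (div_nonneg (hY p hp.le hpZ.le).1 (wt_pos hp hpZ).le)
    (div_nonneg (hY r hr.le hrZ.le).1 (wt_pos hr hrZ).le) hpr1 hrk hkp hD
    (up hp hpZ (hY p hp.le hpZ.le).2) (up hr hrZ (hY r hr.le hrZ.le).2)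
  have hYS : Y A + Y Z ≤ S := add_le_add hYA.2 hYZ.2
  have b2 := abs_extrapolate_le (x := chord Y A Z p / wt A Z p) (y := chord Y A Z r / wt A Z r)
    (div_nonneg (chord_nonneg hp hpZ hYA.1 hYZ.1) (wt_pos hp hpZ).le)
    (div_nonneg (chord_nonneg hr hrZ hYA.1 hYZ.1) (wt_pos hr hrZ).le) hpr1 hrk hkp hD
    (down hp hpZ hYA.1 hYZ.1 hYS) (down hr hrZ hYA.1 hYZ.1 hYS)
  have b3 : |((k : ℝ) - p) * δ| ≤ (Γ + S + W) * |(r : ℝ) - p| := by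
    rw [abs_mul]
    calc |(k : ℝ) - p| * |δ| ≤ D * ((Γ + S + W) / D * |(r : ℝ) - p|) := by gcongr
      _ = _ := by field_simp
  have e := line_interp hAZ α β p r k
  rw [e1, e2] at e
  have : |((r : ℝ) - p) * line A Z α β k| ≤ (2 * Γ + 2 * S + W) * |(r : ℝ) - p| := by
    rw [e]
    have e' : ((r : ℝ) - k) * dev Y A Z p + ((k : ℝ) - p) * (dev Y A Z r + δ)
        = (((r : ℝ) - k) * (Y p / wt A Z p) + ((k : ℝ) - p) * (Y r / wt A Z r))
          - (((r : ℝ) - k) * (chord Y A Z p / wt A Z p)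
            + ((k : ℝ) - p) * (chord Y A Z r / wt A Z r)) + ((k : ℝ) - p) * δ := by
      unfold dev; ring
    rw [e']
    refine (abs_add_le _ _).trans ((add_le_add (abs_sub _ _) le_rfl).trans ?_)
    linarith
  rw [abs_mul, mul_comm] at this
  exact le_of_mul_le_mul_right this (by linarith)

theorem wt_mul_abs_dev_sub_le {n A Z k : ℕ} {Y : ℕ → ℝ} {L q : ℝ} (hk : A < k) (hkZ : k < Z)
    (hAZ : A + 2 ≤ Z) (hY : ∀ j, A ≤ j → j ≤ Z → 0 ≤ Y j ∧ Y j ≤ n.choose j) (hq : |q| ≤ L) :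
    wt A Z k * |dev Y A Z k - q|
      ≤ n.choose k + wt A Z k * (L + (n.choose A + n.choose Z) / 2) := by
  have hw := wt_pos hk hkZ
  have hYA := hY A le_rfl (by omega)
  have hYZ := hY Z (by omega) le_rfl
  have hYk := hY k hk.le hkZ.le
  have h0 := chord_nonneg hk hkZ hYA.1 hYZ.1
  have h1 := chord_mul_le hk hkZ hYA.1 hYZ.1 (add_le_add hYA.2 hYZ.2)
  have hD : (2 : ℝ) ≤ (Z : ℝ) - A := by
    have : (A : ℝ) + 2 ≤ Z := by exact_mod_cast hAZ
    linarith
  have h2 : chord Y A Z k ≤ wt A Z k * ((n.choose A + n.choose Z) / 2) := by nlinarith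
  calc wt A Z k * |dev Y A Z k - q| = |wt A Z k * dev Y A Z k - wt A Z k * q| := by
        rw [← mul_sub, abs_mul, abs_of_pos hw]
    _ ≤ |wt A Z k * dev Y A Z k| + |wt A Z k * q| := abs_sub _ _
    _ = |Y k - chord Y A Z k| + wt A Z k * |q| := by
        rw [dev, mul_div_cancel₀ _ hw.ne', abs_mul, abs_of_pos hw]
    _ ≤ (n.choose k + wt A Z k * ((n.choose A + n.choose Z) / 2)) + wt A Z k * L := by
        gcongr
        exact abs_le.2 ⟨by linarith [hYk.1], by linarith [hYk.2]⟩
    _ = _ := by ring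

/-- Either of `l` and `w` may be chosen in both the maximum and the minimum. -/
theorem le_errorBound {l w m : ℕ} (h : l + w + 1 ≤ l * w) (hm : m = l ∨ m = w) :
    peak (l * w) (m + 1) * ((l * w : ℕ) - w - l - 1) *
      ((l * w).choose (l * w / 2) - (l * w).choose (m + 1)) ≤ errorBound l w := by
  have e : ∀ j : ℕ, j + 1 ≤ l * w → peak (l * w) (j + 1) =
      ((j : ℝ) + 1) ^ (j + 1) * (((l * w : ℕ) : ℝ) - j - 1) ^ (l * w - j - 1)
        / ((l * w : ℕ) : ℝ) ^ (l * w) := by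
    intro j hj
    unfold peak
    rw [Nat.sub_sub, Nat.cast_sub hj]
    push_cast
    congr 3
    ring
  have hK : (0 : ℝ) ≤ ((l * w : ℕ) : ℝ) - w - l - 1 := by
    have : ((l + w + 1 : ℕ) : ℝ) ≤ ((l * w : ℕ) : ℝ) := Nat.cast_le.2 h
    push_cast at this ⊢
    linarith
  have hC : ((l * w).choose (m + 1) : ℝ) ≤ ((l * w).choose (l * w / 2) : ℝ) := by
    exact_mod_cast Nat.choose_le_middle _ _
  unfold errorBound
  simp only
  rw [mul_div_right_comm]
  refine mul_le_mul (mul_le_mul_of_nonneg_right ?_ hK) ?_ (by linarith) ?_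
  · rw [e m (by rcases hm with rfl | rfl <;> omega)]
    refine div_le_div_of_nonneg_right ?_ (by positivity)
    rcases hm with rfl | rfl
    · exact le_max_left _ _
    · exact le_max_right _ _
  · refine le_trans ?_ (le_abs_self _)
    gcongr
    rcases hm with rfl | rfl
    · exact min_le_left _ _
    · exact min_le_right _ _
  · refine mul_nonneg (div_nonneg (le_max_of_le_left ?_) (by positivity)) hK
    have : ((l + 1 : ℕ) : ℝ) ≤ ((l * w : ℕ) : ℝ) := Nat.cast_le.2 (by omega)
    rw [Nat.cast_add, Nat.cast_one] at this
    exact mul_nonneg (by positivity) (pow_nonneg (by linarith) _)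

/-- The error when the linear function is bounded by `L`: the coefficients contribute the first
summand, the linear function and the chord the second one. -/
theorem errSum_le {n A Z m : ℕ} {Y : ℕ → ℝ} {α β L : ℝ} (hmA : m ≤ A) (hZ : Z + m ≤ n)
    (hAZ : A + 2 ≤ Z) (hY : ∀ j, A ≤ j → j ≤ Z → 0 ≤ Y j ∧ Y j ≤ n.choose j)
    (hL : ∀ k, A < k → k < Z → |line A Z α β k| ≤ L) :
    errSum n A Z Y α β ≤ peak n (m + 1) * (n.choose (m + 1) * ((Z : ℝ) - A - 1) +
      (L + (n.choose A + n.choose Z) / 2) *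
        ∑ k ∈ Ioo A Z, wt A Z k * n.choose (m + 1) / n.choose k) := by
  have hL0 : 0 ≤ L := (abs_nonneg _).trans (hL (A + 1) (by omega) (by omega))
  have hterm : ∀ k ∈ Ioo A Z, peak n k * (wt A Z k * |dev Y A Z k - line A Z α β k|)
      ≤ peak n (m + 1) * n.choose (m + 1) + peak n (m + 1) *
        ((L + (n.choose A + n.choose Z) / 2) * (wt A Z k * n.choose (m + 1) / n.choose k)) := by
    intro k hk
    obtain ⟨h1, h2⟩ := mem_Ioo.1 hk
    have hC : (0 : ℝ) < n.choose k := by exact_mod_cast Nat.choose_pos (by omega)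
    have hpk := peak_mul_choose_le (n := n) (i := m + 1) (k := k) (by omega) (by omega)
    have hw := wt_pos h1 h2
    calc _ ≤ peak n k * (n.choose k + wt A Z k * (L + (n.choose A + n.choose Z) / 2)) :=
          mul_le_mul_of_nonneg_left (wt_mul_abs_dev_sub_le h1 h2 hAZ hY (hL k h1 h2))
            (peak_nonneg _ _)
      _ = peak n k * n.choose k * (1 + wt A Z k * (L + (n.choose A + n.choose Z) / 2)
            / n.choose k) := by field_simp
      _ ≤ peak n (m + 1) * n.choose (m + 1) *
            (1 + wt A Z k * (L + (n.choose A + n.choose Z) / 2) / n.choose k) := by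
          gcongr
      _ = _ := by ring
  unfold errSum
  refine (sum_le_sum hterm).trans_eq ?_
  rw [sum_add_distrib, sum_const, Nat.card_Ioo, nsmul_eq_mul, ← mul_sum, ← mul_sum,
    Nat.sub_sub, Nat.cast_sub (by omega)]
  push_cast
  ring

/-- An estimate of the binomial coefficients over `[A, Z]` under which the error of every
interpolating cubic is small, wherever the interpolation points are: `Γ` bounds the divided
coefficients, `W` their increments, and `V` the total weight of a linear function. -/
def UniformBound (n A Z m : ℕ) : Prop :=
  ∃ Γ W V : ℝ,
    (∀ j, A < j → j < Z → (n.choose j : ℝ) * ((Z : ℝ) - A) ≤ Γ * wt A Z j) ∧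
    0 ≤ W ∧ SlopeLe n A Z (W / ((Z : ℝ) - A)) ∧
    ∑ k ∈ Ioo A Z, wt A Z k * n.choose (m + 1) / n.choose k ≤ V ∧
    n.choose (m + 1) * (2 * ((Z : ℝ) - A - 1) + (n + 1) / 2)
      + (2 * Γ + 5 / 2 * (n.choose A + n.choose Z) + W) * V
      ≤ ((Z : ℝ) - A - 1) * n.choose (n / 2)

/-- The bridge points only have to be beyond the smaller one of the two bounds, so that this serves
for the network as well as for its dual. -/
theorem errLe_of_uniformBound {l w m : ℕ} {m' : ℕ → ℕ → ℕ} {Y : ℕ → ℝ}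
    (h : l + w + 2 ≤ l * w) (hm : m = l ∨ m = w) (hml : m ≤ l) (hmw : m ≤ w)
    (hm' : ∀ p r, min (max p (l * w - r)) (max r (l * w - p)) ≤ m' p r)
    (hY : ∀ j, l ≤ j → j ≤ l * w - w → 0 ≤ Y j ∧ Y j ≤ (l * w).choose j)
    (hU : UniformBound (l * w) l (l * w - w) m) :
    ErrLe (l * w) l (l * w - w) m' Y (errorBound l w - 1 / 2) := by
  obtain ⟨Γ, W, V, hΓ, hW0, hW, hV, hcrit⟩ := hU
  intro p r α β δ hp hpZ hr hrZ hpr hδ e1 e2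
  have hl : 0 < l := Nat.pos_of_ne_zero (by rintro rfl; simp at h)
  have hw : 0 < w := Nat.pos_of_ne_zero (by rintro rfl; simp at h)
  have h2m : 2 * (m + 1) ≤ l * w := by
    rcases hm with rfl | rfl <;> omega
  have hL := fun k (h1 : l < k) (h2 : k < l * w - w) =>
    abs_line_le (k := k) (Nat.sub_le _ _) hY hΓ hW0 hW hp hpZ hr hrZ h1 h2 hpr
      (hδ.mono (hm' p r)) e1 e2
  have h1 := errSum_le (n := l * w) (m := m) hml (by omega) (by omega) hY hL
  have h2 := le_errorBound (m := m) (by omega) hm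
  have h3 := one_le_peak_mul_choose h2m
  have hΓ0 : 0 ≤ Γ := by
    have := hΓ p hp hpZ
    have hwt := wt_pos hp hpZ
    have hD : (0 : ℝ) ≤ ((l * w - w : ℕ) : ℝ) - l := by
      have : (l : ℝ) ≤ ((l * w - w : ℕ) : ℝ) := by exact_mod_cast (by omega)
      linarith
    by_contra hcon
    have := mul_neg_of_neg_of_pos (not_le.1 hcon) hwt
    have : (0 : ℝ) ≤ ((l * w).choose p : ℝ) * (((l * w - w : ℕ) : ℝ) - l) := by positivity
    linarith
  have hcast : (((l * w - w : ℕ) : ℝ) - l - 1) = ((l * w : ℕ) : ℝ) - w - l - 1 := by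
    rw [Nat.cast_sub (by omega)]
  rw [hcast] at h1 hcrit
  have h4 : (2 * Γ + 2 * ((l * w).choose l + (l * w).choose (l * w - w)) + W +
      ((l * w).choose l + (l * w).choose (l * w - w)) / 2) *
        ∑ k ∈ Ioo l (l * w - w), wt l (l * w - w) k * (l * w).choose (m + 1) / (l * w).choose k
      ≤ (2 * Γ + 5 / 2 * ((l * w).choose l + (l * w).choose (l * w - w)) + W) * V := by
    refine (mul_le_mul_of_nonneg_left hV (by positivity)).trans_eq (by ring)
  have hμ := peak_nonneg (l * w) (m + 1)
  have h5 : peak (l * w) (m + 1) * ((l * w).choose (m + 1) *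
      (2 * (((l * w : ℕ) : ℝ) - w - l - 1) + ((l * w : ℕ) + 1) / 2)
      + (2 * Γ + 5 / 2 * ((l * w).choose l + (l * w).choose (l * w - w)) + W) * V)
      ≤ peak (l * w) (m + 1) * ((((l * w : ℕ) : ℝ) - w - l - 1) * (l * w).choose (l * w / 2)) :=
    mul_le_mul_of_nonneg_left hcrit hμ
  have h6 := mul_le_mul_of_nonneg_left h4 hμ
  push_cast at h1 h2 h3 h5 h6 ⊢
  linarith

theorem wt_reflect {n A Z k : ℕ} (hAZ : A ≤ Z) (hZ : Z ≤ n) (hk : k ≤ n) :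
    wt (n - Z) (n - A) (n - k) = wt A Z k := by
  unfold wt
  rw [Nat.cast_sub hk, Nat.cast_sub hZ, Nat.cast_sub (hAZ.trans hZ)]
  ring

theorem devC_reflect {n A Z k : ℕ} (hAZ : A ≤ Z) (hZ : Z ≤ n) (hk : k ≤ n) :
    devC n (n - Z) (n - A) (n - k) = devC n A Z k := by
  unfold devC dev chord
  simp only
  rw [wt_reflect hAZ hZ hk, Nat.choose_symm hk, Nat.choose_symm hZ,
    Nat.choose_symm (hAZ.trans hZ), Nat.cast_sub hk, Nat.cast_sub hZ,
    Nat.cast_sub (hAZ.trans hZ)]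
  have e1 : (n : ℝ) - A - (n - k) = k - A := by ring
  have e2 : (n : ℝ) - k - (n - Z) = Z - k := by ring
  have e3 : (n : ℝ) - A - (n - Z) = Z - A := by ring
  rw [e1, e2, e3, add_comm]

theorem UniformBound.reflect {n A Z m : ℕ} (hAZ : A ≤ Z) (hZ : Z ≤ n)
    (h : UniformBound n A Z m) : UniformBound n (n - Z) (n - A) m := by
  obtain ⟨Γ, W, V, hΓ, hW0, hW, hV, hcrit⟩ := h
  have e : ((n - A : ℕ) : ℝ) - (n - Z : ℕ) = Z - A := by
    rw [Nat.cast_sub hZ, Nat.cast_sub (hAZ.trans hZ)]; ring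
  refine ⟨Γ, W, V, ?_, hW0, ?_, ?_, ?_⟩
  · intro j h1 h2
    have := hΓ (n - j) (by omega) (by omega)
    rw [Nat.choose_symm (by omega)] at this
    rwa [e, ← Nat.sub_sub_self (show j ≤ n by omega), wt_reflect hAZ hZ (by omega),
      Nat.sub_sub_self (show j ≤ n by omega)]
  · intro j h1 h2
    have := hW (n - (j + 1)) (by omega) (by omega)
    rw [show n - (j + 1) + 1 = n - j by omega, abs_sub_comm] at this
    have e1 := devC_reflect hAZ hZ (show n - j ≤ n by omega)
    have e2 := devC_reflect hAZ hZ (show n - (j + 1) ≤ n by omega)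
    rw [Nat.sub_sub_self (by omega)] at e1 e2
    rw [e, e1, e2]
    refine le_trans (le_of_eq ?_) this
    congr 2
    rw [Nat.cast_sub (by omega), ← abs_neg]
    push_cast
    congr 1
    ring
  · refine le_trans (le_of_eq ?_) hV
    refine sum_bij' (fun k _ => n - k) (fun k _ => n - k) ?_ ?_ ?_ ?_ ?_
    · intro k hk; have := mem_Ioo.1 hk; exact mem_Ioo.2 ⟨by omega, by omega⟩
    · intro k hk; have := mem_Ioo.1 hk; exact mem_Ioo.2 ⟨by omega, by omega⟩
    · intro k hk; have := mem_Ioo.1 hk; omega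
    · intro k hk; have := mem_Ioo.1 hk; omega
    · intro k hk
      have := mem_Ioo.1 hk
      rw [Nat.choose_symm (show k ≤ n by omega), ← wt_reflect hAZ hZ (show n - k ≤ n by omega),
        Nat.sub_sub_self (show k ≤ n by omega)]
  · rw [e, Nat.choose_symm hZ, Nat.choose_symm (hAZ.trans hZ), add_comm (n.choose Z : ℝ)]
    exact hcrit

/-! ### Finite verification of the uniform estimate -/

/-- The maximum of `g i` over `i < K`. -/
noncomputable def maxBelow (g : ℕ → ℕ) (K : ℕ) : ℕ := Nat.rec 0 (fun i x => mx x (g i)) K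

/-- The sum of `g i` over `i < K`. -/
noncomputable def sumBelow (g : ℕ → ℕ) (K : ℕ) : ℕ :=
  Nat.rec 0 (fun i x => force x fun x => Nat.add x (g i)) K

theorem le_maxBelow (g : ℕ → ℕ) {K i : ℕ} (h : i < K) : g i ≤ maxBelow g K := by
  induction K with
  | zero => omega
  | succ K ih =>
    change g i ≤ mx (maxBelow g K) (g K)
    rw [mx_eq]
    rcases Nat.lt_succ_iff_lt_or_eq.1 h with h | rfl
    · exact (ih h).trans (le_max_left _ _)
    · exact le_max_right _ _

theorem sumBelow_eq (g : ℕ → ℕ) (K : ℕ) : sumBelow g K = ∑ i ∈ range K, g i := by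
  induction K with
  | zero => rfl
  | succ K ih =>
    change force (sumBelow g K) (fun x => x + g K) = _
    rw [force_eq, ih, sum_range_succ]

/-- An upper bound for the quotient of `x` by `y`. -/
def upDiv (x y : ℕ) : ℕ := Nat.succ (Nat.div x y)

theorem div_le_upDiv (x y : ℕ) : (x : ℝ) / y ≤ upDiv x y := by
  change _ ≤ ((x / y + 1 : ℕ) : ℝ)
  rcases Nat.eq_zero_or_pos y with rfl | hy
  · rw [Nat.cast_zero, div_zero]; positivity
  · rw [div_le_iff₀ (by exact_mod_cast hy)]
    have := Nat.lt_mul_div_succ x hy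
    have : x ≤ (x / y + 1) * y := by rw [mul_comm]; exact this.le
    exact_mod_cast this

/-- The increment of the deviations at `l + 1 + i`, times its distance to the middle. -/
def slopeTerm (n A D CA CZ C C' i : ℕ) : ℕ :=
  force (Nat.mul (i + 1) (D - (i + 1))) fun v => force (Nat.mul (i + 2) (D - (i + 2))) fun v' =>
  force (D * C' * v + (CA * (D - (i + 1)) + CZ * (i + 1)) * v') fun x =>
  force (D * C * v' + (CA * (D - (i + 2)) + CZ * (i + 2)) * v) fun y =>
  force (2 * (A + 1 + i) + 1) fun z =>
    upDiv (((x - y) + (y - x)) * ((z - n) + (n - z) + 1)) (Nat.mul v v')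

/-- The criterion of `UniformBound`, with all quantities rounded up to integers; `G`, `W`, `V` are
the `Γ`, `W`, `V` there, and `V` is scaled by `2 ^ 20`. -/
noncomputable def uniformCheck (l w : ℕ) : Bool :=
  force (l * w) fun n => force (n - w) fun Z => force (binomialNumber n) fun T =>
  force (Z - l) fun D => force (D - 1) fun K =>
  force (digit n T l) fun CA => force (digit n T Z) fun CZ =>
  force (digit n T (l - (l - w) + 1)) fun CM =>
  force (maxBelow (fun i => upDiv (D * digit n T (l + 1 + i))
    (Nat.mul (i + 1) (D - (i + 1)))) K) fun G =>
  force (maxBelow (fun i => slopeTerm n l D CA CZ (digit n T (l + 1 + i))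
    (digit n T (l + 2 + i)) i) (K - 1)) fun W =>
  force (sumBelow (fun i => upDiv (2 ^ 20 * Nat.mul (Nat.mul (i + 1) (D - (i + 1))) CM)
    (digit n T (l + 1 + i))) K) fun V =>
    Nat.ble (2 ^ 20 * (CM * (4 * K + (n + 1))) + (4 * G + 5 * (CA + CZ) + 2 * W) * V)
      (2 ^ 20 * (2 * K * digit n T (n / 2)))

theorem abs_cast_sub_eq (x y : ℕ) : |(x : ℝ) - y| = ((x - y + (y - x) : ℕ) : ℝ) := by
  rcases le_total x y with h | h
  · have h' : (x : ℝ) ≤ y := by exact_mod_cast h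
    rw [Nat.sub_eq_zero_of_le h, zero_add, Nat.cast_sub h, abs_of_nonpos (by linarith)]
    ring
  · have h' : (y : ℝ) ≤ x := by exact_mod_cast h
    rw [Nat.sub_eq_zero_of_le h, add_zero, Nat.cast_sub h, abs_of_nonneg (by linarith)]

theorem slope_le_slopeTerm {n A D i : ℕ} (hi : i + 2 < D) :
    |devC n A (A + D) (A + 1 + i + 1) - devC n A (A + D) (A + 1 + i)|
      * (|2 * ((A + 1 + i : ℕ) : ℝ) + 1 - n| + 1) ≤
    (slopeTerm n A D (n.choose A) (n.choose (A + D)) (n.choose (A + 1 + i))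
      (n.choose (A + 2 + i)) i : ℝ) / D := by
  obtain ⟨b, rfl⟩ : ∃ b, D = i + 3 + b := ⟨D - (i + 3), by omega⟩
  have hD : (0 : ℝ) < ((i + 3 + b : ℕ) : ℝ) := by positivity
  rw [le_div_iff₀ hD]
  simp only [slopeTerm, force_eq, Nat.mul_eq]
  refine le_trans (le_of_eq ?_) (div_le_upDiv _ _)
  have e1 : i + 3 + b - (i + 1) = b + 2 := by omega
  have e2 : i + 3 + b - (i + 2) = b + 1 := by omega
  rw [e1, e2]
  rw [Nat.cast_mul, Nat.cast_mul, ← abs_cast_sub_eq,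
    Nat.cast_add (_ + _) 1, ← abs_cast_sub_eq]
  push_cast
  rw [show A + 1 + i + 1 = A + 2 + i by omega]
  have key : devC n A (A + (i + 3 + b)) (A + 2 + i) - devC n A (A + (i + 3 + b)) (A + 1 + i)
      = (((i + 3 + b : ℝ) * n.choose (A + 2 + i) * ((i + 1) * (b + 2))
          + (n.choose A * (b + 2) + n.choose (A + (i + 3 + b)) * (i + 1)) * ((i + 2) * (b + 1)))
        - ((i + 3 + b : ℝ) * n.choose (A + 1 + i) * ((i + 2) * (b + 1))
          + (n.choose A * (b + 1) + n.choose (A + (i + 3 + b)) * (i + 2)) * ((i + 1) * (b + 2))))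
        / (((i + 1) * (b + 2)) * ((i + 2) * (b + 1)) * (i + 3 + b)) := by
    unfold devC dev chord wt
    push_cast
    have f1 : (A : ℝ) + (i + 3 + b) - A = i + 3 + b := by ring
    have f2 : (A : ℝ) + (i + 3 + b) - (A + 2 + i) = b + 1 := by ring
    have f3 : (A : ℝ) + (i + 3 + b) - (A + 1 + i) = b + 2 := by ring
    have f4 : (A : ℝ) + 2 + i - A = i + 2 := by ring
    have f5 : (A : ℝ) + 1 + i - A = i + 1 := by ring
    rw [f1, f2, f3, f4, f5]
    have : (i : ℝ) + 3 + b ≠ 0 := by positivity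
    field_simp
    ring
  rw [key, abs_div, abs_of_pos (a := ((i + 1 : ℝ) * (b + 2)) * ((i + 2) * (b + 1)) * (i + 3 + b))
    (by positivity)]
  field_simp

theorem uniformBound_of_uniformCheck {l w : ℕ} (h : l + w + 2 ≤ l * w)
    (hc : uniformCheck l w = true) : UniformBound (l * w) l (l * w - w) (min l w) := by
  have hn : 0 < l * w := by omega
  have hbc : ∀ k ≤ l * w, digit (l * w) (binomialNumber (l * w)) k = (l * w).choose k :=
    fun k hk => digit_binomialNumber hn hk
  have hl : 0 < l := Nat.pos_of_ne_zero (by rintro rfl; simp at h)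
  have hw : 0 < w := Nat.pos_of_ne_zero (by rintro rfl; simp at h)
  obtain ⟨D, hD, hD3⟩ : ∃ D, l * w - w = l + D ∧ 2 ≤ D := ⟨l * w - w - l, by omega, by omega⟩
  have hmm : l - (l - w) = min l w := by omega
  simp only [uniformCheck, force_eq, hmm, hD, Nat.add_sub_cancel_left, Nat.ble_eq] at hc
  set T := binomialNumber (l * w)
  set G := maxBelow (fun i => upDiv (D * digit (l * w) T (l + 1 + i))
    (Nat.mul (i + 1) (D - (i + 1)))) (D - 1) with hG
  set W := maxBelow (fun i => slopeTerm (l * w) l D (digit (l * w) T l) (digit (l * w) T (l + D))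
    (digit (l * w) T (l + 1 + i)) (digit (l * w) T (l + 2 + i)) i) (D - 1 - 1) with hW
  set V := sumBelow (fun i => upDiv (2 ^ 20 * Nat.mul (Nat.mul (i + 1) (D - (i + 1)))
    (digit (l * w) T (min l w + 1))) (digit (l * w) T (l + 1 + i))) (D - 1) with hV
  have hcD : ((l * w - w : ℕ) : ℝ) - l = D := by rw [hD]; push_cast; ring
  have hcD0 : (0 : ℝ) < D := by exact_mod_cast (by omega : 0 < D)
  have hwt : ∀ i, i < D - 1 →
      wt l (l * w - w) (l + 1 + i) = ((Nat.mul (i + 1) (D - (i + 1)) : ℕ) : ℝ) := by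
    intro i hi
    unfold wt
    rw [hD, Nat.mul_eq, Nat.cast_mul, Nat.cast_sub (by omega)]
    push_cast; ring
  refine ⟨G, W, V / 2 ^ 20, ?_, Nat.cast_nonneg _, ?_, ?_, ?_⟩
  · intro j h1 h2
    obtain ⟨i, rfl⟩ : ∃ i, j = l + 1 + i := ⟨j - (l + 1), by omega⟩
    have hi : i < D - 1 := by omega
    have := le_maxBelow (fun i => upDiv (D * digit (l * w) T (l + 1 + i))
      (Nat.mul (i + 1) (D - (i + 1)))) hi
    have h3 := (div_le_upDiv _ _).trans (Nat.cast_le (α := ℝ).2 this)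
    have hpos := wt_pos h1 h2
    rw [hbc _ (by omega), ← hwt i hi, div_le_iff₀ hpos] at h3
    rw [hcD]
    push_cast at h3
    linarith
  · intro j h1 h2
    obtain ⟨i, rfl⟩ : ∃ i, j = l + 1 + i := ⟨j - (l + 1), by omega⟩
    have hi : i < D - 1 - 1 := by omega
    have h3 := le_maxBelow (fun i => slopeTerm (l * w) l D (digit (l * w) T l)
      (digit (l * w) T (l + D)) (digit (l * w) T (l + 1 + i))
      (digit (l * w) T (l + 2 + i)) i) hi
    have h4 := slope_le_slopeTerm (n := l * w) (A := l) (D := D) (i := i) (by omega)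
    rw [← hD] at h4
    rw [hcD]
    refine h4.trans (div_le_div_of_nonneg_right ?_ hcD0.le)
    rw [← hW, hbc _ (by omega), hbc _ (by omega), hbc _ (by omega), hbc _ (by omega), ← hD] at h3
    exact_mod_cast h3
  · have e : ∑ k ∈ Ioo l (l * w - w),
        wt l (l * w - w) k * (l * w).choose (min l w + 1) / (l * w).choose k
        = ∑ i ∈ range (D - 1), wt l (l * w - w) (l + 1 + i) * (l * w).choose (min l w + 1)
          / (l * w).choose (l + 1 + i) := by
      rw [hD, show Ioo l (l + D) = Ico (l + 1) (l + D) from rfl, sum_Ico_eq_sum_range,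
        show l + D - (l + 1) = D - 1 by omega]
    rw [e, hV, sumBelow_eq, Nat.cast_sum, sum_div]
    refine sum_le_sum fun i hi => ?_
    have hi := mem_range.1 hi
    rw [le_div_iff₀ (by positivity)]
    refine le_trans (le_of_eq ?_) (div_le_upDiv _ _)
    rw [hwt i hi, hbc _ (by omega), hbc _ (by omega)]
    simp only [Nat.mul_eq]
    push_cast
    ring
  · rw [hbc _ (by omega), hbc _ (by omega), hbc _ (by omega), hbc _ (by omega)] at hc
    have hc' := (Nat.cast_le (α := ℝ)).2 hc
    rw [hcD, hD]
    have hcK : ((D - 1 : ℕ) : ℝ) = D - 1 := by rw [Nat.cast_sub (by omega), Nat.cast_one]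
    push_cast [hcK] at hc' ⊢
    field_simp
    linarith

/-! ### The uniform estimate for large networks -/

theorem one_sub_le_mul_exp {t : ℝ} (h0 : 0 ≤ t) (h1 : t < 1) :
    1 - t ≤ (1 + t) * Real.exp (-(2 * t)) := by
  have h := Real.hasSum_log_sub_log_of_abs_lt_one (by rwa [abs_of_nonneg h0] : |t| < 1)
  have h2 : 2 * t ≤ Real.log (1 + t) - Real.log (1 - t) := by
    have := le_hasSum h 0 fun j _ => by positivity
    simpa using this
  rw [← Real.log_div (by linarith) (by linarith), Real.le_log_iff_exp_le (by
    apply div_pos <;> linarith), le_div_iff₀ (by linarith)] at h2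
  calc 1 - t = Real.exp (2 * t) * (1 - t) * Real.exp (-(2 * t)) := by
        rw [mul_right_comm, ← Real.exp_add, add_neg_cancel, Real.exp_zero, one_mul]
    _ ≤ _ := by gcongr

/-- The decay of the binomial coefficients away from the middle. -/
theorem choose_le_exp {n k : ℕ} (hk : k ≤ n) : (n.choose k : ℝ) ≤
    n.choose (n / 2) * Real.exp (-(((2 * (k : ℝ) - n) ^ 2 - 1) / (2 * (n + 1)))) := by
  have right : ∀ k, n / 2 ≤ k → k ≤ n → (n.choose k : ℝ) ≤
      n.choose (n / 2) * Real.exp (-(((2 * (k : ℝ) - n) ^ 2 - 1) / (2 * (n + 1)))) := by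
    intro k h1 h2
    induction k, h1 using Nat.le_induction with
    | base =>
      refine le_mul_of_one_le_right (by positivity) (Real.one_le_exp ?_)
      rw [← neg_div]
      refine div_nonneg ?_ (by positivity)
      have a1 : n ≤ 2 * (n / 2) + 1 := by omega
      have a2 : 2 * (n / 2) ≤ n := by omega
      have a1 : (n : ℝ) ≤ 2 * ((n / 2 : ℕ) : ℝ) + 1 := by exact_mod_cast a1
      have a2 : 2 * ((n / 2 : ℕ) : ℝ) ≤ n := by exact_mod_cast a2
      nlinarith
    | succ k h1 ih =>
      have ih := ih (by omega)
      have hn : (0 : ℝ) < n + 1 := by positivity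
      have hζ0 : (n : ℝ) ≤ 2 * k + 1 := by exact_mod_cast (by omega : n ≤ 2 * k + 1)
      have hkn : (k : ℝ) + 1 ≤ n := by exact_mod_cast h2
      set t : ℝ := (2 * k + 1 - n) / (n + 1) with ht
      have ht0 : 0 ≤ t := div_nonneg (by linarith) hn.le
      have ht1 : t < 1 := by rw [ht, div_lt_one hn]; linarith
      have e : (n.choose (k + 1) : ℝ) * (1 + t) = n.choose k * (1 - t) := by
        have := Nat.choose_succ_right_eq n k
        have : (n.choose (k + 1) : ℝ) * (k + 1) = n.choose k * (n - k) := by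
          rw [← Nat.cast_sub (by omega)]; exact_mod_cast this
        rw [ht]
        field_simp
        linarith
      have h3 : (n.choose (k + 1) : ℝ) ≤ n.choose k * Real.exp (-(2 * t)) := by
        refine le_of_mul_le_mul_right ?_ (by linarith : 0 < 1 + t)
        rw [e, mul_assoc]
        refine mul_le_mul_of_nonneg_left ?_ (by positivity)
        rw [mul_comm]
        exact one_sub_le_mul_exp ht0 ht1
      refine h3.trans ((mul_le_mul_of_nonneg_right ih (Real.exp_pos _).le).trans_eq ?_)
      rw [mul_assoc, ← Real.exp_add, ht]
      congr 2
      push_cast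
      field_simp
      ring
  rcases le_total (n / 2) k with h | h
  · exact right k h hk
  · have := right (n - k) (by omega) (by omega)
    rw [Nat.choose_symm hk] at this
    refine this.trans_eq ?_
    rw [Nat.cast_sub hk]
    congr 4
    ring

/-- Binomial coefficients far from the middle are negligible. -/
theorem choose_le_of_far {n k : ℕ} (hn : 300 ≤ n) (hk : k ≤ n)
    (h : 3 / 10 * (n : ℝ) - 2 ≤ |2 * (k : ℝ) - n|) :
    (n.choose k : ℝ) ≤ n.choose (n / 2) * (2 / (n : ℝ) ^ 2) := by
  have hn' : (300 : ℝ) ≤ n := by exact_mod_cast hn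
  refine (choose_le_exp hk).trans (mul_le_mul_of_nonneg_left ?_ (by positivity))
  have h1 : (3 / 10 * (n : ℝ) - 2) ^ 2 ≤ (2 * (k : ℝ) - n) ^ 2 := by
    rw [← sq_abs (2 * (k : ℝ) - n)]
    exact pow_le_pow_left₀ (by linarith) h 2
  have h2 : 85 / 2000 * (n : ℝ) ≤ ((2 * (k : ℝ) - n) ^ 2 - 1) / (2 * (n + 1)) := by
    rw [le_div_iff₀ (by positivity)]
    nlinarith
  have h3 : (387 : ℝ) ≤ Real.exp (6375 / 1000) := by
    have e1 := Real.exp_one_gt_d9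
    calc (387 : ℝ) ≤ 2.7 ^ 6 := by norm_num
      _ ≤ Real.exp 1 ^ 6 := by gcongr; linarith
      _ = Real.exp 6 := by rw [← Real.exp_nat_mul]; norm_num
      _ ≤ _ := Real.exp_le_exp.2 (by norm_num)
  have h4 : (n : ℝ) / 10 * 7.1 ≤ Real.exp (2125 / 100000 * n) := by
    calc (n : ℝ) / 10 * 7.1 ≤ 387 * (2125 / 100000 * (n - 300) + 1) := by linarith
      _ ≤ Real.exp (6375 / 1000) * Real.exp (2125 / 100000 * (n - 300)) := by
          gcongr
          exact Real.add_one_le_exp _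
      _ = _ := by rw [← Real.exp_add]; congr 1; ring
  calc Real.exp (-(((2 * (k : ℝ) - n) ^ 2 - 1) / (2 * (n + 1))))
      ≤ Real.exp (-(85 / 2000 * (n : ℝ))) := Real.exp_le_exp.2 (by linarith)
    _ = (Real.exp (2125 / 100000 * n) ^ 2)⁻¹ := by
        rw [Real.exp_neg, ← Real.exp_nat_mul]; congr 2; push_cast; ring
    _ ≤ (((n : ℝ) / 10 * 7.1) ^ 2)⁻¹ := by gcongr
    _ ≤ 2 / (n : ℝ) ^ 2 := by
        rw [inv_eq_one_div, div_le_div_iff₀ (by positivity) (by positivity)]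
        nlinarith [sq_nonneg (n : ℝ)]

/-- The divided binomial coefficients near the middle: the factor `(Z - A) / wt A Z k` is `12 / n`
in the middle of `[n / 3, 2 n / 3]`, and grows slower than the binomial coefficients decay. -/
theorem sub_div_wt_le_of_near {n A Z k : ℕ} (hn : 300 ≤ n) (hA : 3 * A ≤ n) (hZ : 2 * n ≤ 3 * Z)
    (h1 : A < k) (h2 : k < Z) {ξ : ℝ} (hξ : |2 * (k : ℝ) - n| ≤ ξ)
    (hnear : ξ ≤ 3 / 10 * n) :
    ((Z : ℝ) - A) / wt A Z k ≤ 12 / n * Real.exp (4 / 25 * (ξ ^ 2 / n)) := by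
  have hn' : (300 : ℝ) ≤ n := by exact_mod_cast hn
  have hA' : 3 * (A : ℝ) ≤ n := by exact_mod_cast hA
  have hZ' : 2 * (n : ℝ) ≤ 3 * Z := by exact_mod_cast hZ
  have h1' : (0 : ℝ) < (k : ℝ) - A := by rw [sub_pos]; exact_mod_cast h1
  have h2' : (0 : ℝ) < (Z : ℝ) - k := by rw [sub_pos]; exact_mod_cast h2
  have hξ0 : 0 ≤ ξ := (abs_nonneg _).trans hξ
  obtain ⟨b1, b2⟩ := abs_le.1 hξ
  set y : ℝ := 2 * (k : ℝ) - n with hy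
  have hyy : y ^ 2 ≤ ξ ^ 2 := sq_le_sq' (by linarith) (by linarith)
  have a1 : (n + 3 * y) / 6 ≤ (k : ℝ) - A := by rw [hy]; linarith
  have a2 : (n - 3 * y) / 6 ≤ (Z : ℝ) - k := by rw [hy]; linarith
  have p1 : 0 < (n + 3 * y) / 6 := by linarith
  have p2 : 0 < (n - 3 * y) / 6 := by linarith
  have hs : 9 * ξ ^ 2 ≤ 81 / 100 * (n : ℝ) ^ 2 := by nlinarith
  have hpos : 0 < (n : ℝ) ^ 2 - 9 * ξ ^ 2 := by nlinarith
  calc ((Z : ℝ) - A) / wt A Z k = 1 / ((k : ℝ) - A) + 1 / ((Z : ℝ) - k) := by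
        unfold wt; field_simp; ring
    _ ≤ 1 / ((n + 3 * y) / 6) + 1 / ((n - 3 * y) / 6) := by gcongr
    _ = 12 * n / (n ^ 2 - 9 * y ^ 2) := by
        have : (n : ℝ) + 3 * y ≠ 0 := by linarith
        have : (n : ℝ) - 3 * y ≠ 0 := by linarith
        have : (n : ℝ) ^ 2 - 9 * y ^ 2 ≠ 0 := by
          have : 0 < (n : ℝ) ^ 2 - 9 * y ^ 2 := by linarith
          exact this.ne'
        rw [one_div_div, one_div_div, div_add_div _ _ (by assumption) (by assumption),
          div_eq_div_iff (by positivity) this]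
        ring
    _ ≤ 12 * n / (n ^ 2 - 9 * ξ ^ 2) := by gcongr
    _ ≤ 12 / n * (4 / 25 * (ξ ^ 2 / n) + 1) := by
        rw [div_le_iff₀ hpos]
        have e : 12 / (n : ℝ) * (4 / 25 * (ξ ^ 2 / n) + 1) * (n ^ 2 - 9 * ξ ^ 2)
            = 12 * n + 12 * ξ ^ 2 / n ^ 2 * (4 / 25 * (n ^ 2 - 9 * ξ ^ 2) - 9 * n) := by
          field_simp; ring
        rw [e]
        have : 0 ≤ 4 / 25 * ((n : ℝ) ^ 2 - 9 * ξ ^ 2) - 9 * n := by nlinarith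
        have : 0 ≤ 12 * ξ ^ 2 / (n : ℝ) ^ 2 * (4 / 25 * ((n : ℝ) ^ 2 - 9 * ξ ^ 2) - 9 * n) := by
          positivity
        linarith
    _ ≤ _ := by gcongr; exact Real.add_one_le_exp _

theorem sub_div_wt_le_two {A Z k : ℕ} (h1 : A < k) (h2 : k < Z) :
    ((Z : ℝ) - A) / wt A Z k ≤ 2 := by
  have h1' : (A : ℝ) + 1 ≤ k := by exact_mod_cast h1
  have h2' : (k : ℝ) + 1 ≤ Z := by exact_mod_cast h2
  rw [div_le_iff₀ (wt_pos h1 h2)]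
  unfold wt
  nlinarith

theorem mul_exp_neg_le {c x : ℝ} (hc : 0 < c) : x * Real.exp (-(c * x)) ≤ 368 / 1000 / c := by
  have h1 := Real.add_one_le_exp (c * x - 1)
  have h2 : Real.exp (-1) ≤ 368 / 1000 := by have := Real.exp_neg_one_lt_d9; linarith
  have h3 : c * x * Real.exp (-(c * x)) ≤ Real.exp (-1) := by
    calc c * x * Real.exp (-(c * x)) ≤ Real.exp (c * x - 1) * Real.exp (-(c * x)) := by
          gcongr; linarith
      _ = _ := by rw [← Real.exp_add]; congr 1; ring
  rw [le_div_iff₀ hc]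
  linarith

theorem exp_le_of_small {x c : ℝ} (h0 : 0 ≤ x) (h1 : x ≤ c) (hc : c ≤ 1) :
    Real.exp x ≤ 1 + 2 * c := by
  have := Real.abs_exp_sub_one_le (x := c) (by rw [abs_of_nonneg (h0.trans h1)]; exact hc)
  rw [abs_of_nonneg (h0.trans h1)] at this
  have := (abs_le.1 this).2
  have := Real.exp_le_exp.2 h1
  linarith

theorem choose_mul_le_of_large {n A Z k : ℕ} (hn : 300 ≤ n) (hA : 3 * A ≤ n) (hZ : 2 * n ≤ 3 * Z)
    (hZn : Z ≤ n) (h1 : A < k) (h2 : k < Z) :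
    n.choose k * (((Z : ℝ) - A) / wt A Z k) ≤ 13 / n * n.choose (n / 2) := by
  have hn' : (300 : ℝ) ≤ n := by exact_mod_cast hn
  have hg0 : 0 ≤ ((Z : ℝ) - A) / wt A Z k := by
    have : (A : ℝ) < Z := by exact_mod_cast (h1.trans h2)
    exact div_nonneg (by linarith) (wt_pos h1 h2).le
  rcases le_total |2 * (k : ℝ) - n| (3 / 10 * n) with h | h
  · set y := |2 * (k : ℝ) - n| with hy
    have e1 := choose_le_exp (n := n) (k := k) (by omega)
    have e2 := sub_div_wt_le_of_near hn hA hZ h1 h2 le_rfl h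
    rw [← hy] at e2
    rw [← sq_abs, ← hy] at e1
    calc n.choose k * (((Z : ℝ) - A) / wt A Z k)
        ≤ (n.choose (n / 2) * Real.exp (-((y ^ 2 - 1) / (2 * (n + 1))))) *
          (12 / n * Real.exp (4 / 25 * (y ^ 2 / n))) := by gcongr
      _ = 12 / n * n.choose (n / 2) *
          Real.exp (-((y ^ 2 - 1) / (2 * (n + 1))) + 4 / 25 * (y ^ 2 / n)) := by
          rw [Real.exp_add]; ring
      _ ≤ 12 / n * n.choose (n / 2) * (1 + 2 * (1 / 600)) := by
          gcongr
          refine le_trans (Real.exp_le_exp.2 ?_)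
            (exp_le_of_small (x := 1 / 600) (by norm_num) le_rfl (by norm_num))
          have a1 : y ^ 2 / n * (4 / 25) ≤ y ^ 2 / (2 * (n + 1)) := by
            rw [div_mul_eq_mul_div, div_le_div_iff₀ (by positivity) (by positivity)]
            have : 0 ≤ y ^ 2 * ((n : ℝ) - 8 / 25 * (n + 1)) :=
              mul_nonneg (sq_nonneg _) (by linarith)
            linarith
          have a2 : 1 / (2 * ((n : ℝ) + 1)) ≤ 1 / 600 :=
            one_div_le_one_div_of_le (by norm_num) (by linarith)
          rw [sub_div]
          linarith
      _ ≤ _ := by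
          have : (0 : ℝ) ≤ 1 / n * n.choose (n / 2) := by positivity
          have e : 12 / (n : ℝ) * n.choose (n / 2) = 12 * (1 / n * n.choose (n / 2)) := by ring
          have e' : 13 / (n : ℝ) * n.choose (n / 2) = 13 * (1 / n * n.choose (n / 2)) := by ring
          rw [e, e']
          linarith
  · have e1 := choose_le_of_far hn (show k ≤ n by omega) (by linarith)
    calc n.choose k * (((Z : ℝ) - A) / wt A Z k) ≤ (n.choose (n / 2) * (2 / (n : ℝ) ^ 2)) * 2 := by
          gcongr
          exact sub_div_wt_le_two h1 h2
      _ = 4 / n * (1 / n * n.choose (n / 2)) := by field_simp; ring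
      _ ≤ 13 * (1 / n * n.choose (n / 2)) := by
          gcongr
          rw [div_le_iff₀ (by linarith)]
          linarith
      _ = _ := by ring

theorem abs_choose_succ_sub_le {n j : ℕ} (hj : j < n) {E : ℝ} (h1 : (n.choose j : ℝ) ≤ E)
    (h2 : (n.choose (j + 1) : ℝ) ≤ E) :
    |(n.choose (j + 1) : ℝ) - n.choose j| ≤ E * (2 * |2 * (j : ℝ) + 1 - n| / (n + 1)) := by
  have h : (n.choose (j + 1) : ℝ) * (j + 1) = n.choose j * (n - j) := by
    rw [← Nat.cast_sub hj.le]; exact_mod_cast Nat.choose_succ_right_eq n j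
  have hjn : (j : ℝ) + 1 ≤ n := by exact_mod_cast hj
  have hE : 0 ≤ E := le_trans (by positivity) h1
  have hn : (0 : ℝ) < n + 1 := by positivity
  rcases le_total (n : ℝ) (2 * j + 1) with hc | hc
  · rw [abs_of_nonneg (a := 2 * (j : ℝ) + 1 - n) (by linarith)]
    have e : (n.choose (j + 1) : ℝ) - n.choose j
        = -(n.choose j * ((2 * j + 1 - n) / (j + 1))) := by field_simp; linarith
    have h0 : 0 ≤ (2 * (j : ℝ) + 1 - n) / (j + 1) := div_nonneg (by linarith) (by positivity)
    rw [e, abs_neg, abs_of_nonneg (mul_nonneg (by positivity) h0)]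
    refine mul_le_mul h1 ?_ h0 hE
    rw [div_le_div_iff₀ (by positivity) hn]
    nlinarith
  · rw [abs_of_nonpos (a := 2 * (j : ℝ) + 1 - n) (by linarith)]
    have hnj : (0 : ℝ) < n - j := by linarith
    have e : (n.choose (j + 1) : ℝ) - n.choose j
        = n.choose (j + 1) * (-(2 * j + 1 - n) / (n - j)) := by field_simp; linarith
    have h0 : 0 ≤ -(2 * (j : ℝ) + 1 - n) / (n - j) := div_nonneg (by linarith) hnj.le
    rw [e, abs_of_nonneg (mul_nonneg (by positivity) h0)]
    refine mul_le_mul h2 ?_ h0 hE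
    rw [div_le_div_iff₀ hnj hn]
    nlinarith

theorem abs_sub_div_wt_succ_le {A Z j : ℕ} (h1 : A < j) (h2 : j + 1 < Z) :
    |((Z : ℝ) - A) / wt A Z (j + 1) - ((Z : ℝ) - A) / wt A Z j|
      ≤ ((Z : ℝ) - A) / wt A Z (j + 1) * (((Z : ℝ) - A) / wt A Z j) := by
  have w1 := wt_pos h1 (by omega : j < Z)
  have w2 := wt_pos (by omega : A < j + 1) h2
  have h1' : (A : ℝ) + 1 ≤ j := by exact_mod_cast h1
  have h2' : (j : ℝ) + 1 + 1 ≤ Z := by exact_mod_cast h2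
  have e : ((Z : ℝ) - A) / wt A Z (j + 1) - ((Z : ℝ) - A) / wt A Z j
      = ((Z : ℝ) - A) * (wt A Z j - wt A Z (j + 1)) / (wt A Z (j + 1) * wt A Z j) := by
    field_simp
  have e' : ((Z : ℝ) - A) / wt A Z (j + 1) * (((Z : ℝ) - A) / wt A Z j)
      = ((Z : ℝ) - A) * ((Z : ℝ) - A) / (wt A Z (j + 1) * wt A Z j) := by
    field_simp
  rw [e, e', abs_div, abs_of_pos (mul_pos w2 w1), abs_mul, abs_of_pos (by linarith : 0 < (Z : ℝ) - A)]
  refine div_le_div_of_nonneg_right (mul_le_mul_of_nonneg_left ?_ (by linarith))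
    (mul_pos w2 w1).le
  unfold wt
  push_cast
  exact abs_le.2 ⟨by nlinarith, by nlinarith⟩

/-- The decay of the larger one of two neighbouring binomial coefficients, in terms of their common
distance to the middle. -/
theorem choose_le_exp_of_near {n k : ℕ} (hn : 300 ≤ n) (hk : k ≤ n) {y : ℝ}
    (hy : 0 ≤ y) (h : y - 2 ≤ |2 * (k : ℝ) - n|) :
    (n.choose k : ℝ) ≤ 21 / 20 * n.choose (n / 2) * Real.exp (-(37 / 100 * (y ^ 2 / n))) := by
  have hn' : (300 : ℝ) ≤ n := by exact_mod_cast hn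
  have h1 : (y - 2) ^ 2 - 1 ≤ (2 * (k : ℝ) - n) ^ 2 - 1 ∨ y ≤ 2 := by
    rcases le_total y 2 with h2 | h2
    · exact Or.inr h2
    · left
      rw [← sq_abs (2 * (k : ℝ) - n)]
      have := pow_le_pow_left₀ (by linarith) h 2
      linarith
  have h2 : -((((2 * (k : ℝ) - n) ^ 2 - 1) / (2 * (n + 1)))) ≤ 1 / 40 - 37 / 100 * (y ^ 2 / n) := by
    have a1 : 37 / 100 * (y ^ 2 / n) ≤ 743 / 1000 * y ^ 2 / (2 * (n + 1)) := by
      rw [← mul_div_assoc, div_le_div_iff₀ (by positivity) (by positivity)]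
      have : 0 ≤ y ^ 2 * (743 / 1000 * (n : ℝ) - 74 / 100 * (n + 1)) :=
        mul_nonneg (sq_nonneg _) (by linarith)
      linarith
    have a2 : 743 / 1000 * y ^ 2 / (2 * (n + 1))
        ≤ ((2 * (k : ℝ) - n) ^ 2 - 1 + 15) / (2 * (n + 1)) := by
      refine div_le_div_of_nonneg_right ?_ (by positivity)
      rcases h1 with h1 | h1
      · nlinarith [sq_nonneg (y - 8)]
      · nlinarith [sq_nonneg (2 * (k : ℝ) - n)]
    have a3 : 15 / (2 * ((n : ℝ) + 1)) ≤ 1 / 40 := by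
      rw [div_le_div_iff₀ (by positivity) (by norm_num)]; linarith
    rw [add_div] at a2
    linarith
  calc (n.choose k : ℝ) ≤ n.choose (n / 2) * Real.exp (1 / 40 - 37 / 100 * (y ^ 2 / n)) :=
        (choose_le_exp hk).trans (by gcongr)
    _ = n.choose (n / 2) * (Real.exp (1 / 40) * Real.exp (-(37 / 100 * (y ^ 2 / n)))) := by
        rw [← Real.exp_add, sub_eq_add_neg]
    _ ≤ n.choose (n / 2) * ((1 + 2 * (1 / 40)) * Real.exp (-(37 / 100 * (y ^ 2 / n)))) := by
        gcongr
        exact exp_le_of_small (by norm_num) le_rfl (by norm_num)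
    _ = _ := by ring

/-- The Gaussian factor bounds the increments of the binomial coefficients near the middle; `y` is
the distance to the middle. -/
theorem near_slope_le {n : ℝ} (hn : 300 ≤ n) (y : ℝ) :
    y * (21 / 20 * Real.exp (-(37 / 100 * (y ^ 2 / n))) *
      ((2 * y / n + 12 / n * Real.exp (4 / 25 * (y ^ 2 / n))) *
        (12 / n * Real.exp (4 / 25 * (y ^ 2 / n))))) ≤ 62 / n := by
  set u := y ^ 2 / n with hu
  have hn0 : 0 < n := by linarith
  have hu0 : 0 ≤ u := by positivity
  have b1 := mul_exp_neg_le (c := 21 / 100) (x := u) (by norm_num)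
  -- the maximum of `√u * exp (-u / 20)` is attained at `u = 10`
  have b2 : y * Real.exp (-(1 / 20 * u)) ≤ 117 / 1000 * n := by
    have b3 := mul_exp_neg_le (c := 1 / 10) (x := u) (by norm_num)
    refine abs_le_of_sq_le_sq' ?_ (by positivity) |>.2
    have e : (y * Real.exp (-(1 / 20 * u))) ^ 2 = n * (u * Real.exp (-(1 / 10 * u))) := by
      rw [mul_pow, ← Real.exp_nat_mul, hu]
      field_simp
      congr 1
      push_cast
      ring_nf
    rw [e]
    nlinarith
  have e1 : Real.exp (-(37 / 100 * u)) * Real.exp (4 / 25 * u) = Real.exp (-(21 / 100 * u)) := by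
    rw [← Real.exp_add]; congr 1; ring
  have e2 : Real.exp (-(37 / 100 * u)) * Real.exp (4 / 25 * u) * Real.exp (4 / 25 * u)
      = Real.exp (-(1 / 20 * u)) := by
    rw [← Real.exp_add, ← Real.exp_add]; congr 1; ring
  calc _ = 21 / 20 * (24 / n * (y ^ 2 / n * (Real.exp (-(37 / 100 * u)) * Real.exp (4 / 25 * u)))
        + 144 / n ^ 2 * (y * (Real.exp (-(37 / 100 * u)) * Real.exp (4 / 25 * u)
          * Real.exp (4 / 25 * u)))) := by
        generalize Real.exp (-(37 / 100 * u)) = a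
        generalize Real.exp (4 / 25 * u) = b
        field_simp
        ring
    _ ≤ 21 / 20 * (24 / n * (368 / 1000 / (21 / 100)) + 144 / n ^ 2 * (117 / 1000 * n)) := by
        rw [e2, e1, ← hu]
        gcongr
    _ ≤ _ := by
        rw [show 144 / n ^ 2 * (117 / 1000 * n) = 144 * 117 / 1000 / n by field_simp]
        rw [show 24 / n * (368 / 1000 / (21 / 100)) = 24 * (368 / 1000 / (21 / 100)) / n by ring,
          ← add_div, ← mul_div_assoc]
        gcongr
        norm_num

theorem sub_mul_devC (n A Z k : ℕ) :
    ((Z : ℝ) - A) * devC n A Z k = n.choose k * (((Z : ℝ) - A) / wt A Z k)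
      - chord (fun i => (n.choose i : ℝ)) A Z k * ((Z : ℝ) - A) / wt A Z k := by
  unfold devC dev
  ring

/-- The increments of `devC`, close to the middle by Gaussian bounds, far from it because the
binomial coefficients are negligible. -/
theorem slopeLe_of_large {n A Z : ℕ} (hn : 300 ≤ n) (hA : 3 * A ≤ n) (hZ : 2 * n ≤ 3 * Z)
    (hZn : Z ≤ n) {S : ℝ} (hS : (n.choose A : ℝ) + n.choose Z ≤ S)
    (hS' : S ≤ 4 / (n : ℝ) ^ 2 * n.choose (n / 2)) :
    SlopeLe n A Z (70 / n * n.choose (n / 2) / ((Z : ℝ) - A)) := by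
  intro j h1 h2
  have hn' : (300 : ℝ) ≤ n := by exact_mod_cast hn
  have hAZ : A < Z := by omega
  have hD : (0 : ℝ) < (Z : ℝ) - A := by rw [sub_pos]; exact_mod_cast hAZ
  have h1' : (A : ℝ) + 1 ≤ j := by exact_mod_cast h1
  have h2' : (j : ℝ) + 1 + 1 ≤ Z := by exact_mod_cast h2
  have hZn' : (Z : ℝ) ≤ n := by exact_mod_cast hZn
  have hA0 : (0 : ℝ) ≤ A := by positivity
  set C : ℝ := ((n.choose (n / 2) : ℕ) : ℝ) with hC
  have hC0 : 0 ≤ C := by positivity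
  set ζ := |2 * (j : ℝ) + 1 - n| with hζ
  have hζn : ζ + 1 ≤ n := by
    have : ζ ≤ n - 1 := abs_le.2 ⟨by linarith, by linarith⟩
    linarith
  have hζ0 : 0 ≤ ζ := abs_nonneg _
  have x1 : ζ + 1 - 2 ≤ |2 * (j : ℝ) - n| := by
    have := abs_add_le (2 * (j : ℝ) - n) 1
    rw [abs_one, show 2 * (j : ℝ) - n + 1 = 2 * j + 1 - n by ring] at this
    linarith
  have x1' : |2 * (j : ℝ) - n| ≤ ζ + 1 := by
    have := abs_sub (2 * (j : ℝ) + 1 - n) 1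
    rw [abs_one, show 2 * (j : ℝ) + 1 - n - 1 = 2 * j - n by ring] at this
    linarith
  have x2 : ζ + 1 - 2 ≤ |2 * ((j + 1 : ℕ) : ℝ) - n| := by
    have := abs_sub (2 * ((j + 1 : ℕ) : ℝ) - n) 1
    push_cast at this ⊢
    rw [abs_one, show 2 * ((j : ℝ) + 1) - n - 1 = 2 * j + 1 - n by ring] at this
    linarith
  have x2' : |2 * ((j + 1 : ℕ) : ℝ) - n| ≤ ζ + 1 := by
    have := abs_add_le (2 * (j : ℝ) + 1 - n) 1
    rw [abs_one, show 2 * (j : ℝ) + 1 - n + 1 = 2 * ((j + 1 : ℕ) : ℝ) - n by push_cast; ring]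
      at this
    linarith
  set g := ((Z : ℝ) - A) / wt A Z j with hg
  set g' := ((Z : ℝ) - A) / wt A Z (j + 1) with hg'
  have w1 := wt_pos h1 (by omega : j < Z)
  have w2 := wt_pos (by omega : A < j + 1) h2
  have hg0 : 0 ≤ g := div_nonneg hD.le w1.le
  have hg0' : 0 ≤ g' := div_nonneg hD.le w2.le
  have main : |(n.choose (j + 1) : ℝ) * g' - n.choose j * g| * (ζ + 1) ≤ 62 / n * C := by
    rcases le_or_gt (ζ + 1) (3 / 10 * n) with hc | hc
    · set y := ζ + 1 with hy
      set G := 12 / (n : ℝ) * Real.exp (4 / 25 * (y ^ 2 / n)) with hG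
      set E := 21 / 20 * C * Real.exp (-(37 / 100 * (y ^ 2 / n))) with hE
      have c1 : (n.choose j : ℝ) ≤ E := choose_le_exp_of_near hn (by omega) (by linarith) x1
      have c2 : (n.choose (j + 1) : ℝ) ≤ E :=
        choose_le_exp_of_near hn (by omega) (by linarith) x2
      have d1 : g ≤ G := sub_div_wt_le_of_near hn hA hZ h1 (by omega) x1' hc
      have d2 : g' ≤ G := sub_div_wt_le_of_near hn hA hZ (by omega) h2 x2' hc
      have hE0 : 0 ≤ E := by positivity
      have hG0 : 0 ≤ G := by positivity
      have a1 := abs_choose_succ_sub_le (by omega : j < n) c1 c2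
      have a2 := abs_sub_div_wt_succ_le h1 h2
      rw [← hg, ← hg'] at a2
      have a3 : 2 * ζ / ((n : ℝ) + 1) ≤ 2 * y / n := by gcongr <;> linarith
      calc |(n.choose (j + 1) : ℝ) * g' - n.choose j * g| * y
          = |((n.choose (j + 1) : ℝ) - n.choose j) * g' + n.choose j * (g' - g)| * y := by
            congr 2; ring
        _ ≤ (|(n.choose (j + 1) : ℝ) - n.choose j| * g' + n.choose j * |g' - g|) * y := by
            refine mul_le_mul_of_nonneg_right ((abs_add_le _ _).trans_eq ?_) (by linarith)
            rw [abs_mul, abs_mul, abs_of_nonneg hg0', Nat.abs_cast]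
        _ ≤ (E * (2 * y / n) * G + E * (G * G)) * y := by
            gcongr
            · exact a1.trans (mul_le_mul_of_nonneg_left a3 hE0)
            · exact a2.trans (by gcongr)
        _ = C * (y * (21 / 20 * Real.exp (-(37 / 100 * (y ^ 2 / n))) *
              ((2 * y / n + G) * G))) := by rw [hE]; ring
        _ ≤ C * (62 / n) := mul_le_mul_of_nonneg_left (near_slope_le hn' y) hC0
        _ = _ := mul_comm _ _
    · have c1 := choose_le_of_far hn (show j ≤ n by omega) (by linarith)
      have c2 := choose_le_of_far hn (show j + 1 ≤ n by omega) (by linarith)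
      have d1 : g ≤ 2 := sub_div_wt_le_two h1 (by omega)
      have d2 : g' ≤ 2 := sub_div_wt_le_two (by omega) h2
      have b1 : (n.choose j : ℝ) * g ≤ C * (2 / (n : ℝ) ^ 2) * 2 := by gcongr
      have b2 : (n.choose (j + 1) : ℝ) * g' ≤ C * (2 / (n : ℝ) ^ 2) * 2 := by gcongr
      have b3 : (0 : ℝ) ≤ (n.choose j : ℝ) * g := by positivity
      have b4 : (0 : ℝ) ≤ (n.choose (j + 1) : ℝ) * g' := by positivity
      calc |(n.choose (j + 1) : ℝ) * g' - n.choose j * g| * (ζ + 1)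
          ≤ (C * (2 / (n : ℝ) ^ 2) * 2) * n := by
            gcongr
            exact abs_le.2 ⟨by linarith, by linarith⟩
        _ = 4 / n * C := by field_simp; ring
        _ ≤ _ := by gcongr; norm_num
  have hch : ∀ k, A < k → k < Z →
      0 ≤ chord (fun i => (n.choose i : ℝ)) A Z k * ((Z : ℝ) - A) / wt A Z k ∧
      chord (fun i => (n.choose i : ℝ)) A Z k * ((Z : ℝ) - A) / wt A Z k ≤ S := by
    intro k i1 i2
    have := wt_pos i1 i2
    refine ⟨div_nonneg (mul_nonneg (chord_nonneg i1 i2 (by positivity) (by positivity)) hD.le)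
      this.le, ?_⟩
    rw [div_le_iff₀ this]
    exact chord_mul_le i1 i2 (by positivity) (by positivity) hS
  have p1 := hch j h1 (by omega)
  have p2 := hch (j + 1) (by omega) h2
  set c := chord (fun i => (n.choose i : ℝ)) A Z j * ((Z : ℝ) - A) / wt A Z j
  set c' := chord (fun i => (n.choose i : ℝ)) A Z (j + 1) * ((Z : ℝ) - A) / wt A Z (j + 1)
  have e : (|devC n A Z (j + 1) - devC n A Z j| * (ζ + 1)) * ((Z : ℝ) - A)
      = |((n.choose (j + 1) : ℝ) * g' - n.choose j * g) + (c - c')| * (ζ + 1) := by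
    have i1 := sub_mul_devC n A Z j
    have i2 := sub_mul_devC n A Z (j + 1)
    have : ((n.choose (j + 1) : ℝ) * g' - n.choose j * g) + (c - c')
        = ((Z : ℝ) - A) * (devC n A Z (j + 1) - devC n A Z j) := by
      rw [mul_sub, i1, i2]; ring
    rw [this, abs_mul, abs_of_pos hD]
    ring
  rw [le_div_iff₀ hD, e]
  have hcc : |c - c'| ≤ S := abs_le.2 ⟨by linarith [p1.1, p2.2], by linarith [p1.2, p2.1]⟩
  calc _ ≤ (|(n.choose (j + 1) : ℝ) * g' - n.choose j * g| + |c - c'|) * (ζ + 1) := by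
        gcongr
        exact abs_add_le _ _
    _ = |(n.choose (j + 1) : ℝ) * g' - n.choose j * g| * (ζ + 1) + |c - c'| * (ζ + 1) := by ring
    _ ≤ 62 / n * C + 4 / (n : ℝ) ^ 2 * C * n := by
        refine add_le_add main (mul_le_mul (hcc.trans hS') hζn (by linarith) (by positivity))
    _ = 66 / n * C := by field_simp; ring
    _ ≤ _ := by gcongr; norm_num

theorem pow_mul_choose_le {n m t : ℕ} {q : ℝ} (hq : 0 ≤ q)
    (h : ∀ i < t, q * (m + i + 1) ≤ n - m - i) (ht : m + t ≤ n) :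
    q ^ t * n.choose m ≤ n.choose (m + t) := by
  induction t with
  | zero => simp
  | succ t ih =>
    have h1 := ih (fun i hi => h i (by omega)) (by omega)
    have h2 := h t (by omega)
    have h3 : (n.choose (m + t + 1) : ℝ) * (m + t + 1) = n.choose (m + t) * (n - m - t) := by
      have := Nat.choose_succ_right_eq n (m + t)
      rw [sub_sub, ← Nat.cast_add, ← Nat.cast_sub (by omega)]
      exact_mod_cast this
    rw [← add_assoc]
    refine le_of_mul_le_mul_right ?_ (by positivity : (0 : ℝ) < m + t + 1)
    rw [h3]
    calc q ^ (t + 1) * n.choose m * (m + t + 1) = q ^ t * n.choose m * (q * (m + t + 1)) := by ring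
      _ ≤ n.choose (m + t) * (n - m - t) :=
        mul_le_mul h1 h2 (by positivity) (by positivity)

theorem choose_le_choose_of_le {n i k : ℕ} (hik : i ≤ k) (hk : 2 * k ≤ n) :
    n.choose i ≤ n.choose k := by
  induction k, hik using Nat.le_induction with
  | base => exact le_rfl
  | succ k _ ih => exact (ih (by omega)).trans (Nat.choose_le_succ_of_lt_half_left (by omega))

/-- The reciprocals of the binomial coefficients decay at least geometrically at first, and stay
small up to the middle. -/
theorem mul_choose_div_le {n m i : ℕ} (hn : 300 ≤ n) (hm : m * m ≤ n) (hi : 2 * (m + 1 + i) ≤ n) :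
    ((i : ℝ) + 1) * n.choose (m + 1) / n.choose (m + 1 + i)
      ≤ (i + 1) / 10 ^ i + 1 / (2 * n) := by
  have hn' : (300 : ℝ) ≤ n := by exact_mod_cast hn
  have hm' : (m : ℝ) * m ≤ n := by exact_mod_cast hm
  have hi' : 2 * ((m : ℝ) + 1 + i) ≤ n := by exact_mod_cast hi
  have hm0 : (0 : ℝ) ≤ m := by positivity
  have hmn : 18 * (m : ℝ) ≤ n + 24 := by nlinarith [sq_nonneg ((m : ℝ) - 9), sq_nonneg ((m:ℝ) - 17)]
  have hC : (0 : ℝ) < n.choose (m + 1 + i) := by exact_mod_cast Nat.choose_pos (by omega)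
  have hC1 : (0 : ℝ) < n.choose (m + 1) := by exact_mod_cast Nat.choose_pos (by omega)
  rw [div_le_iff₀ hC]
  rcases Nat.lt_or_ge i 7 with h | h
  · have h1 := pow_mul_choose_le (n := n) (m := m + 1) (t := i) (q := 10) (by norm_num)
      (fun j hj => by
        have : (j : ℝ) + 1 ≤ 6 := by exact_mod_cast (by omega : j + 1 ≤ 6)
        push_cast
        linarith) (by omega)
    calc ((i : ℝ) + 1) * n.choose (m + 1) = (i + 1) / 10 ^ i * (10 ^ i * n.choose (m + 1)) := by
          field_simp
      _ ≤ (i + 1) / 10 ^ i * n.choose (m + 1 + i) := by gcongr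
      _ ≤ _ := by
          gcongr
          exact le_add_of_nonneg_right (by positivity)
  · set q : ℝ := (n - m - 6) / (m + 7) with hq
    have hq0 : 0 ≤ q := div_nonneg (by linarith) (by positivity)
    have hqe : q * (m + 7) = n - m - 6 := by rw [hq]; field_simp
    have h1 := pow_mul_choose_le (n := n) (m := m + 1) (t := 6) (q := q) hq0
      (fun j hj => by
        have : (j : ℝ) + 1 ≤ 6 := by exact_mod_cast (by omega : j + 1 ≤ 6)
        push_cast
        nlinarith) (by omega)
    have h2 : n.choose (m + 1 + 6) ≤ n.choose (m + 1 + i) :=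
      choose_le_choose_of_le (by omega) hi
    have h2' : (n.choose (m + 1 + 6) : ℝ) ≤ n.choose (m + 1 + i) := by exact_mod_cast h2
    have h3 : (n : ℝ) ≤ q ^ 3 := by
      rw [hq, div_pow, le_div_iff₀ (by positivity)]
      have a1 : ((m : ℝ) + 7) ^ 2 ≤ 2 * n := by nlinarith [sq_nonneg ((m : ℝ) - 17)]
      have a2 : 9 / 10 * (n : ℝ) ≤ n - m - 6 := by linarith
      have a3 : (m : ℝ) + 7 ≤ 9 / 100 * n := by linarith
      calc (n : ℝ) * (m + 7) ^ 3 = n * ((m + 7) ^ 2 * (m + 7)) := by ring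
        _ ≤ (n : ℝ) * (2 * n * (9 / 100 * n)) := by gcongr
        _ ≤ (9 / 10 * (n : ℝ)) ^ 3 := by nlinarith [pow_pos (by linarith : (0 : ℝ) < n) 3]
        _ ≤ _ := by gcongr
    have h4 : (n : ℝ) ^ 2 * n.choose (m + 1) ≤ n.choose (m + 1 + i) := by
      refine le_trans ?_ (h1.trans h2')
      gcongr
      calc (n : ℝ) ^ 2 ≤ (q ^ 3) ^ 2 := by gcongr
        _ = q ^ 6 := by ring
    calc ((i : ℝ) + 1) * n.choose (m + 1) ≤ n / 2 * n.choose (m + 1) := by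
          gcongr; linarith
      _ = 1 / (2 * n) * (n ^ 2 * n.choose (m + 1)) := by field_simp
      _ ≤ 1 / (2 * n) * n.choose (m + 1 + i) := by gcongr
      _ ≤ _ := by
          gcongr
          exact le_add_of_nonneg_left (by positivity)

theorem sum_succ_div_pow_le (N : ℕ) :
    ∑ i ∈ range N, ((i : ℝ) + 1) / 10 ^ i ≤ 100 / 81 := by
  have : ∑ i ∈ range N, ((i : ℝ) + 1) / 10 ^ i = 100 / 81 - 10 * (9 * N + 10) / (81 * 10 ^ N) := by
    induction N with
    | zero => norm_num
    | succ N ih =>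
      rw [sum_range_succ, ih]
      push_cast
      field_simp
      ring
  rw [this]
  have : (0 : ℝ) ≤ 10 * (9 * N + 10) / (81 * 10 ^ N) := by positivity
  linarith

theorem sum_wt_div_choose_le {n m Z : ℕ} (hn : 300 ≤ n) (hm : m * m ≤ n) (hZ : Z + m ≤ n)
    (hmZ : m < Z) :
    ∑ k ∈ Ioo m Z, wt m Z k * n.choose (m + 1) / n.choose k ≤ 3 * ((Z : ℝ) - m - 1) := by
  have hn' : (300 : ℝ) ≤ n := by exact_mod_cast hn
  obtain ⟨N, hN⟩ : ∃ N, n = 2 * m + 1 + N := ⟨n - (2 * m + 1), by omega⟩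
  have hK : (0 : ℝ) ≤ (Z : ℝ) - m - 1 := by
    have : (m : ℝ) + 1 ≤ Z := by exact_mod_cast hmZ
    linarith
  set t : ℕ → ℝ := fun i => ((i : ℝ) + 1) / 10 ^ i with ht
  have ht0 : ∀ i, 0 ≤ t i := fun i => by positivity
  have hterm : ∀ k ∈ Ioo m Z, wt m Z k * n.choose (m + 1) / n.choose k
      ≤ ((Z : ℝ) - m - 1) * (t (k - (m + 1)) + t (N - 1 - (k - (m + 1))) + 1 / (2 * n)) := by
    intro k hk
    obtain ⟨h1, h2⟩ := mem_Ioo.1 hk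
    have h1' : (m : ℝ) + 1 ≤ k := by exact_mod_cast h1
    have h2' : (k : ℝ) + 1 ≤ Z := by exact_mod_cast h2
    rcases le_total (2 * k) n with hc | hc
    · obtain ⟨i, rfl⟩ : ∃ i, k = m + 1 + i := ⟨k - (m + 1), by omega⟩
      have h3 := mul_choose_div_le hn hm hc
      rw [Nat.add_sub_cancel_left]
      calc wt m Z (m + 1 + i) * n.choose (m + 1) / n.choose (m + 1 + i)
          = ((Z : ℝ) - (m + 1 + i : ℕ)) *
            (((i : ℝ) + 1) * n.choose (m + 1) / n.choose (m + 1 + i)) := by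
            unfold wt; push_cast; ring
        _ ≤ ((Z : ℝ) - m - 1) * (t i + 1 / (2 * n)) := by
            refine mul_le_mul ?_ h3 (by positivity) hK
            push_cast
            linarith [(Nat.cast_nonneg i : (0 : ℝ) ≤ i)]
        _ ≤ _ := by
            gcongr
            exact le_add_of_nonneg_right (ht0 _)
    · obtain ⟨i, hi⟩ : ∃ i, n - k = m + 1 + i := ⟨n - k - (m + 1), by omega⟩
      have h3 := mul_choose_div_le (i := i) hn hm (by omega)
      rw [← hi, Nat.choose_symm (by omega)] at h3
      have e : N - 1 - (k - (m + 1)) = i := by omega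
      rw [e]
      have hki : (Z : ℝ) - k ≤ i + 1 := by
        have : Z ≤ i + 1 + k := by omega
        have : (Z : ℝ) ≤ i + 1 + k := by exact_mod_cast this
        linarith
      have hC : (0 : ℝ) < n.choose k := by exact_mod_cast Nat.choose_pos (by omega)
      calc wt m Z k * n.choose (m + 1) / n.choose k
          = ((k : ℝ) - m) * (((Z : ℝ) - k) * n.choose (m + 1) / n.choose k) := by
            unfold wt; ring
        _ ≤ ((Z : ℝ) - m - 1) * ((i + 1) * n.choose (m + 1) / n.choose k) := by
            have h4 : 0 ≤ (Z : ℝ) - k := by linarith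
            have h5 : (k : ℝ) - m ≤ (Z : ℝ) - m - 1 := by linarith
            gcongr
        _ ≤ ((Z : ℝ) - m - 1) * (t i + 1 / (2 * n)) := by gcongr
        _ ≤ _ := by
            gcongr
            exact le_add_of_nonneg_left (ht0 _)
  calc _ ≤ ∑ k ∈ Ioo m (m + 1 + N),
        ((Z : ℝ) - m - 1) * (t (k - (m + 1)) + t (N - 1 - (k - (m + 1))) + 1 / (2 * n)) := by
        refine (sum_le_sum hterm).trans (sum_le_sum_of_subset_of_nonneg ?_ fun k _ _ => ?_)
        · intro k hk
          have := mem_Ioo.1 hk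
          exact mem_Ioo.2 ⟨by omega, by omega⟩
        · exact mul_nonneg hK (add_nonneg (add_nonneg (ht0 _) (ht0 _)) (by positivity))
    _ = ((Z : ℝ) - m - 1) * (2 * ∑ i ∈ range N, t i + N * (1 / (2 * n))) := by
        rw [show Ioo m (m + 1 + N) = Ico (m + 1) (m + 1 + N) from rfl, sum_Ico_eq_sum_range,
          Nat.add_sub_cancel_left]
        simp only [Nat.add_sub_cancel_left]
        rw [← mul_sum, sum_add_distrib, sum_add_distrib, sum_range_reflect t N, sum_const,
          card_range, nsmul_eq_mul]
        ring
    _ ≤ ((Z : ℝ) - m - 1) * (2 * (100 / 81) + 1 / 2) := by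
        gcongr
        · exact sum_succ_div_pow_le N
        · rw [mul_one_div, div_le_div_iff₀ (by positivity) (by norm_num)]
          have : (N : ℝ) ≤ n := by exact_mod_cast (by omega : N ≤ n)
          linarith
    _ ≤ _ := by nlinarith

/-- The uniform estimate holds in all networks with at least `300` contacts. -/
theorem uniformBound_of_large {l w : ℕ} (hl : 3 ≤ l) (hlw : l ≤ w) (hn : 300 ≤ l * w) :
    UniformBound (l * w) l (l * w - w) l := by
  have hll : l * l ≤ l * w := Nat.mul_le_mul_left l hlw
  have h3l : 3 * l ≤ l * w := by nlinarith
  have h3w : 3 * w ≤ l * w := Nat.mul_le_mul_right w hl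
  have hK : l * w + 1 ≤ 2 * (l * w - w - l - 1) := by
    have : 2 * w + 2 * l + 3 ≤ l * w := by nlinarith
    omega
  generalize l * w = n at *
  have hn' : (300 : ℝ) ≤ n := by exact_mod_cast hn
  have h3l' : 3 * (l : ℝ) ≤ n := by exact_mod_cast h3l
  have hZ1 : 2 * n ≤ 3 * (n - w) := by omega
  have far : ∀ k, 3 * k ≤ n + 6 → (n.choose k : ℝ) ≤ n.choose (n / 2) * (2 / (n : ℝ) ^ 2) := by
    intro k hk
    refine choose_le_of_far hn (by omega) ?_
    have : 3 * (k : ℝ) ≤ n + 6 := by exact_mod_cast hk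
    rw [abs_sub_comm]
    exact le_trans (by linarith) (le_abs_self _)
  have f1 := far (l + 1) (by omega)
  have f2 := far l (by omega)
  have f3 := far w (by omega)
  rw [← Nat.choose_symm (by omega)] at f3
  set C : ℝ := ((n.choose (n / 2) : ℕ) : ℝ) with hC
  have hC0 : 0 ≤ C := by positivity
  have hcK : (n : ℝ) + 1 ≤ 2 * (((n - w : ℕ) : ℝ) - l - 1) := by
    have : n + 1 + 2 * l + 2 ≤ 2 * (n - w) := by omega
    have : (n : ℝ) + 1 + 2 * l + 2 ≤ 2 * ((n - w : ℕ) : ℝ) := by exact_mod_cast this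
    linarith
  set K : ℝ := ((n - w : ℕ) : ℝ) - l - 1 with hKdef
  refine ⟨13 / n * C, 70 / n * C, 3 * K, ?_, by positivity, ?_, ?_, ?_⟩
  · intro j h1 h2
    have := choose_mul_le_of_large hn h3l hZ1 (Nat.sub_le n w) h1 h2
    rwa [← mul_div_assoc, div_le_iff₀ (wt_pos h1 h2)] at this
  · exact slopeLe_of_large hn h3l hZ1 (Nat.sub_le n w) le_rfl
      ((add_le_add f2 f3).trans_eq (by ring))
  · exact sum_wt_div_choose_le hn hll (by omega) (by omega)
  · calc _ ≤ C * (2 / (n : ℝ) ^ 2) * (2 * K + K) + (2 * (13 / n * C)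
          + 5 / 2 * (C * (2 / (n : ℝ) ^ 2) + C * (2 / (n : ℝ) ^ 2)) + 70 / n * C) * (3 * K) := by
          have : 0 ≤ K := by linarith
          gcongr
          linarith
      _ = K * C * (288 / n + 36 / n ^ 2) := by ring
      _ ≤ K * C * 1 := by
          refine mul_le_mul_of_nonneg_left ?_ (mul_nonneg (by linarith) hC0)
          rw [div_add_div _ _ (by positivity) (by positivity), div_le_one (by positivity)]
          have : 0 < (n : ℝ) ^ 2 := by positivity
          nlinarith
      _ = _ := mul_one _

/-! ### Networks of length two -/

theorem connects_of_row {m ε : ℕ} {S : Finset (Fin m × Fin 2)} {i : Fin m} (h0 : (i, 0) ∈ S)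
    (h1 : (i, 1) ∈ S) : Connects 2 m ε S :=
  (source_eqvGen 2 m ε S i.2).trans _ _ _
    ((Relation.EqvGen.rel _ _ (Link.contact (i, 0) h0)).trans _ _ _
      ((Relation.EqvGen.rel _ _ (Link.contact (i, 1) h1)).trans _ _ _
        (.symm _ _ (sink_eqvGen 2 m ε S i.2))))

/-- A set of contacts that does not connect contains at most one contact of each row, so that it is
given by its rows and the choice of a contact in each of them. -/
theorem choose_le_coeff_two (m ε k : ℕ) :
    (2 * m).choose k ≤ coeff 2 m ε k + 2 ^ k * m.choose k := by
  classical
  set U : Finset (Finset (Fin m × Fin 2)) := powersetCard k univ with hU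
  have hcard : U.card = (2 * m).choose k := by
    rw [hU, card_powersetCard, card_univ, Fintype.card_prod, Fintype.card_fin, Fintype.card_fin,
      mul_comm]
  have hc : coeff 2 m ε k = (U.filter (Connects 2 m ε)).card := by
    unfold coeff pathsets
    congr 1
    ext S
    simp only [mem_filter, mem_univ, true_and, hU, mem_powersetCard, subset_univ]
    exact and_comm
  have hnot : (U.filter fun S => ¬ Connects 2 m ε S).card ≤ 2 ^ k * m.choose k := by
    set V : Finset (Σ _ : Finset (Fin m), Finset (Fin m)) :=
      (powersetCard k (univ : Finset (Fin m))).sigma fun R => R.powerset with hV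
    have hVc : V.card = 2 ^ k * m.choose k := by
      rw [hV, card_sigma, sum_congr rfl (g := fun _ => 2 ^ k), sum_const, card_powersetCard,
        card_univ, Fintype.card_fin, smul_eq_mul, mul_comm]
      intro R hR
      rw [card_powerset, (mem_powersetCard.1 hR).2]
    rw [← hVc]
    have hrow : ∀ S ∈ (U.filter fun S => ¬ Connects 2 m ε S), ∀ i : Fin m,
        (i, 0) ∈ S → (i, 1) ∉ S :=
      fun S hS i h0 h1 => (mem_filter.1 hS).2 (connects_of_row h0 h1)
    have htwo : ∀ a : Fin 2, a = 0 ∨ a = 1 := by decide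
    refine card_le_card_of_injOn
      (fun S => ⟨S.image Prod.fst, univ.filter fun i => (i, (1 : Fin 2)) ∈ S⟩) ?_ ?_
    · intro S hS
      have hS : S ∈ (U.filter fun S => ¬ Connects 2 m ε S) := hS
      simp only [hV, coe_sigma, Set.mem_sigma_iff, mem_coe, mem_powersetCard, subset_univ,
        true_and, mem_powerset]
      constructor
      · rw [card_image_of_injOn]
        · exact (mem_powersetCard.1 (mem_filter.1 hS).1).2
        · rintro ⟨i, a⟩ ha ⟨j, b⟩ hb hij
          simp only at hij
          subst hij
          have := hrow S hS i
          rcases htwo a with rfl | rfl <;> rcases htwo b with rfl | rfl <;>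
            first | rfl | exact absurd hb (this ha) | exact absurd ha (this hb)
      · intro i hi
        exact mem_image.2 ⟨(i, 1), (mem_filter.1 hi).2, rfl⟩
    · intro S hS S' hS' h
      have hS : S ∈ (U.filter fun S => ¬ Connects 2 m ε S) := hS
      have hS' : S' ∈ (U.filter fun S => ¬ Connects 2 m ε S) := hS'
      simp only [Sigma.mk.injEq, heq_eq_eq] at h
      obtain ⟨hi, ho⟩ := h
      have one : ∀ i : Fin m, (i, (1 : Fin 2)) ∈ S ↔ (i, (1 : Fin 2)) ∈ S' := by
        intro i
        have : i ∈ (univ.filter fun i => (i, (1 : Fin 2)) ∈ S) ↔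
          i ∈ (univ.filter fun i => (i, (1 : Fin 2)) ∈ S') := by rw [ho]
        simpa using this
      have zero : ∀ T ∈ (U.filter fun S => ¬ Connects 2 m ε S), ∀ i : Fin m,
          (i, (0 : Fin 2)) ∈ T ↔ i ∈ T.image Prod.fst ∧ (i, (1 : Fin 2)) ∉ T := by
        intro T hT i
        constructor
        · intro h0
          exact ⟨mem_image.2 ⟨_, h0, rfl⟩, hrow T hT i h0⟩
        · rintro ⟨h0, h1⟩
          obtain ⟨⟨j, a⟩, ha, rfl⟩ := mem_image.1 h0
          rcases htwo a with rfl | rfl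
          · exact ha
          · exact absurd ha h1
      ext ⟨i, a⟩
      rcases htwo a with rfl | rfl
      · rw [zero S hS, zero S' hS', hi, one]
      · exact one i
  rw [hc, ← hcard, ← card_filter_add_card_filter_not (s := U) (Connects 2 m ε)]
  omega

theorem abs_line_le_of_dev_le {A Z p r k : ℕ} {Y : ℕ → ℝ} {α β b : ℝ} (hp : A < p) (hpZ : p < Z)
    (hr : A < r) (hrZ : r < Z) (hk : A < k) (hkZ : k < Z) (hpr : p ≠ r)
    (hY : ∀ j, A < j → j < Z → ((Z : ℝ) - A) * |dev Y A Z j| ≤ b)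
    (e1 : line A Z α β p = dev Y A Z p) (e2 : line A Z α β r = dev Y A Z r) :
    |line A Z α β k| ≤ 2 * b := by
  have hpr1 : 1 ≤ |(r : ℝ) - p| := by
    have : (1 : ℤ) ≤ |(r : ℤ) - p| := Int.one_le_abs (by omega)
    exact_mod_cast this
  have h := line_interp (by omega : A < Z) α β p r k
  rw [e1, e2] at h
  calc |line A Z α β k| ≤ |(r : ℝ) - p| * |line A Z α β k| :=
        le_mul_of_one_le_left (abs_nonneg _) hpr1
    _ = |((r : ℝ) - k) * dev Y A Z p + ((k : ℝ) - p) * dev Y A Z r| := by rw [← abs_mul, h]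
    _ ≤ |(r : ℝ) - k| * |dev Y A Z p| + |(k : ℝ) - p| * |dev Y A Z r| := by
        rw [← abs_mul, ← abs_mul]; exact abs_add_le _ _
    _ ≤ ((Z : ℝ) - A) * |dev Y A Z p| + ((Z : ℝ) - A) * |dev Y A Z r| := by
        gcongr
        · exact abs_natCast_sub_le hr hrZ hk hkZ
        · exact abs_natCast_sub_le hk hkZ hp hpZ
    _ ≤ _ := by linarith [hY p hp hpZ, hY r hr hrZ]

theorem IsDefect.eq_zero {n A Z r : ℕ} {δ : ℝ} (h : IsDefect n A Z Z r δ) : δ = 0 := by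
  rcases h with h | ⟨_, _, x₁, x₂, h1, h2, h3, _⟩
  · exact h
  · omega

theorem errSum_le_of_dev_le {n A Z m : ℕ} {Y : ℕ → ℝ} {α β b : ℝ} (hmA : m ≤ A) (hZ : Z + m ≤ n)
    (hAZ : A + 4 ≤ Z) (hb : 0 ≤ b)
    (hY : ∀ j, A < j → j < Z → ((Z : ℝ) - A) * |dev Y A Z j| ≤ b)
    (hL : ∀ k, A < k → k < Z → |line A Z α β k| ≤ 2 * b) :
    errSum n A Z Y α β ≤ peak n (m + 1) * (9 / 4 * b *
        ∑ k ∈ Ioo A Z, wt A Z k * n.choose (m + 1) / n.choose k) := by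
  have hD : (4 : ℝ) ≤ (Z : ℝ) - A := by
    have : (A : ℝ) + 4 ≤ Z := by exact_mod_cast hAZ
    linarith
  unfold errSum
  rw [mul_sum, mul_sum]
  refine sum_le_sum fun k hk => ?_
  obtain ⟨h1, h2⟩ := mem_Ioo.1 hk
  have hC : (0 : ℝ) < n.choose k := by exact_mod_cast Nat.choose_pos (by omega)
  have hpk := peak_mul_choose_le (n := n) (i := m + 1) (k := k) (by omega) (by omega)
  have hw := wt_pos h1 h2
  have hd : |dev Y A Z k| ≤ b / 4 := by
    rw [le_div_iff₀ (by norm_num)]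
    have := hY k h1 h2
    nlinarith [abs_nonneg (dev Y A Z k)]
  have h3 : |dev Y A Z k - line A Z α β k| ≤ 9 / 4 * b := by
    refine (abs_sub _ _).trans ?_
    linarith [hL k h1 h2]
  calc peak n k * (wt A Z k * |dev Y A Z k - line A Z α β k|)
      ≤ peak n k * (wt A Z k * (9 / 4 * b)) := by
        have := peak_nonneg n k
        gcongr
    _ = peak n k * n.choose k * (wt A Z k * (9 / 4 * b) / n.choose k) := by field_simp
    _ ≤ peak n (m + 1) * n.choose (m + 1) * (wt A Z k * (9 / 4 * b) / n.choose k) := by gcongr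
    _ = _ := by ring

theorem choose_sub_le (m b : ℕ) (hb : b ≤ m) :
    ((2 * m).choose m : ℝ) - (2 * m).choose (m - b)
      ≤ (2 * m).choose m * ((b : ℝ) ^ 2 / (m + 1)) := by
  induction b with
  | zero => simp
  | succ b ih =>
    have ih := ih (by omega)
    obtain ⟨k, hk⟩ : ∃ k, m - b = k + 1 := ⟨m - b - 1, by omega⟩
    rw [show m - (b + 1) = k by omega]
    rw [hk] at ih
    have hm : (m : ℝ) = k + 1 + b := by exact_mod_cast (by omega : m = k + 1 + b)
    have h1 : ((2 * m).choose (k + 1) : ℝ) * (k + 1) = (2 * m).choose k * (2 * m - k) := by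
      have := Nat.choose_succ_right_eq (2 * m) k
      have h2 : ((2 * m - k : ℕ) : ℝ) = 2 * m - k := by
        rw [Nat.cast_sub (by omega)]; push_cast; ring
      rw [← h2]
      exact_mod_cast this
    have hle : ((2 * m).choose k : ℝ) ≤ (2 * m).choose m := by
      have := Nat.choose_le_middle k (2 * m)
      rw [Nat.mul_div_cancel_left m (by norm_num)] at this
      exact_mod_cast this
    have hle' : ((2 * m).choose (k + 1) : ℝ) ≤ (2 * m).choose m := by
      have := Nat.choose_le_middle (k + 1) (2 * m)
      rw [Nat.mul_div_cancel_left m (by norm_num)] at this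
      exact_mod_cast this
    have h3 : ((2 * m).choose (k + 1) : ℝ) - (2 * m).choose k
        ≤ (2 * m).choose m * ((2 * b + 1) / (m + 1)) := by
      rw [← mul_div_assoc, le_div_iff₀ (by positivity)]
      have : ((2 * m).choose (k + 1) : ℝ) * (m + 1 + b)
          = (2 * m).choose (k + 1) * (2 * b + 1) + (2 * m).choose k * (m + 1 + b) := by
        have e : (2 * (m : ℝ) - k) = m + 1 + b := by rw [hm]; ring
        rw [e] at h1
        rw [← h1, hm]; ring
      have mono : ((2 * m).choose k : ℝ) ≤ (2 * m).choose (k + 1) := by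
        exact_mod_cast choose_le_choose_of_le (n := 2 * m) (Nat.le_succ k) (by omega)
      have hb0 : (0 : ℝ) ≤ b := by positivity
      nlinarith
    calc ((2 * m).choose m : ℝ) - (2 * m).choose k
        ≤ (2 * m).choose m * ((b : ℝ) ^ 2 / (m + 1))
          + (2 * m).choose m * ((2 * b + 1) / (m + 1)) := by linarith
      _ = _ := by push_cast; ring

theorem choose_succ_cast {n k : ℕ} (hk : k ≤ n) :
    (n.choose (k + 1) : ℝ) * (k + 1) = n.choose k * (n - k) := by
  rw [← Nat.cast_sub hk]
  exact_mod_cast Nat.choose_succ_right_eq n k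

theorem sq_mul_choose_three_le {m : ℕ} (hm : 22 ≤ m) :
    5 * (m : ℝ) ^ 2 * (2 * m).choose 3 ≤ (2 * m).choose 7 := by
  have hm' : (22 : ℝ) ≤ m := by exact_mod_cast hm
  have h3 := choose_succ_cast (n := 2 * m) (k := 3) (by omega)
  have h4 := choose_succ_cast (n := 2 * m) (k := 4) (by omega)
  have h5 := choose_succ_cast (n := 2 * m) (k := 5) (by omega)
  have h6 := choose_succ_cast (n := 2 * m) (k := 6) (by omega)
  norm_num at h3 h4 h5 h6
  have e : ((2 * m).choose 7 : ℝ) * 840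
      = (2 * m).choose 3 * ((2 * m - 3) * (2 * m - 4) * (2 * m - 5) * (2 * m - 6)) := by
    linear_combination 120 * h6 + 20 * (2 * m - 6) * h5 + 4 * (2 * m - 6) * (2 * m - 5) * h4
      + (2 * m - 6) * (2 * m - 5) * (2 * m - 4) * h3
  have hp : 840 * (5 * (m : ℝ) ^ 2) ≤ (2 * m - 3) * (2 * m - 4) * (2 * m - 5) * (2 * m - 6) := by
    obtain ⟨x, hx⟩ : ∃ x : ℝ, x = m - 22 := ⟨_, rfl⟩
    have hx0 : 0 ≤ x := by rw [hx]; linarith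
    have : (m : ℝ) = x + 22 := by rw [hx]; ring
    rw [this]
    have : 0 ≤ 16 * x ^ 4 + 1264 * x ^ 3 + 33236 * x ^ 2 + 279000 * x + 30000 := by positivity
    nlinarith [pow_nonneg hx0 2, pow_nonneg hx0 3, pow_nonneg hx0 4]
  have h0 : (0 : ℝ) ≤ (2 * m).choose 3 := by positivity
  nlinarith

theorem three_pow_le_choose {m : ℕ} (hm : 22 ≤ m) : 67 * 3 ^ m ≤ (2 * m).choose m := by
  induction m, hm using Nat.le_induction with
  | base => decide +kernel
  | succ m hm ih =>
    have h := Nat.succ_mul_centralBinom_succ m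
    rw [Nat.centralBinom_eq_two_mul_choose, Nat.centralBinom_eq_two_mul_choose] at h
    have : 3 * (m + 1) * (2 * m).choose m ≤ (m + 1) * (2 * (m + 1)).choose (m + 1) := by
      rw [h]
      exact Nat.mul_le_mul_right _ (by omega)
    have h2 : 3 * (2 * m).choose m ≤ (2 * (m + 1)).choose (m + 1) := by
      refine Nat.le_of_mul_le_mul_left ?_ (Nat.succ_pos m)
      calc (m + 1) * (3 * (2 * m).choose m) = 3 * (m + 1) * (2 * m).choose m := by ring
        _ ≤ _ := this
    rw [pow_succ]
    omega

theorem choose_le_middle_two_mul (m k : ℕ) : ((2 * m).choose k : ℝ) ≤ (2 * m).choose m := by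
  have := Nat.choose_le_middle k (2 * m)
  rw [Nat.mul_div_cancel_left m (by norm_num)] at this
  exact_mod_cast this

/-- Near the middle the binomial coefficients vary slowly, and near the other end they are
small. -/
theorem sub_mul_abs_devC_le {m k : ℕ} (hm : 22 ≤ m) (h1 : 2 < k) (h2 : k < m) :
    ((m : ℝ) - (2 : ℕ)) * |dev (fun j => ((2 * m).choose j : ℝ)) 2 m k|
      ≤ (2 * m).choose m / 5 := by
  have hm' : (22 : ℝ) ≤ m := by exact_mod_cast hm
  have h1' : (2 : ℝ) + 1 ≤ k := by exact_mod_cast h1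
  have h2' : (k : ℝ) + 1 ≤ m := by exact_mod_cast h2
  have hC0 : (0 : ℝ) ≤ (2 * m).choose m := by positivity
  have hCk := choose_le_middle_two_mul m k
  have hCA : ((2 * m).choose 2 : ℝ) ≤ (2 * m).choose k := by
    exact_mod_cast choose_le_choose_of_le (n := 2 * m) h1.le (by omega)
  have e : ((m : ℝ) - (2 : ℕ)) * dev (fun j => ((2 * m).choose j : ℝ)) 2 m k
      = ((2 * m).choose k - (2 * m).choose 2 : ℝ) / (k - 2)
        - ((2 * m).choose m - (2 * m).choose k : ℝ) / (m - k) := by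
    have a1 : (k : ℝ) - 2 ≠ 0 := by linarith
    have a2 : (m : ℝ) - k ≠ 0 := by linarith
    have a3 : (m : ℝ) - 2 ≠ 0 := by linarith
    unfold dev chord wt
    push_cast
    field_simp
    ring
  have hup : ((2 * m).choose k - (2 * m).choose 2 : ℝ) / (k - 2) ≤ (2 * m).choose m / 5 := by
    rw [div_le_div_iff₀ (by linarith) (by norm_num)]
    have hA0 : (0 : ℝ) ≤ (2 * m).choose 2 := by positivity
    rcases le_or_gt 7 k with h | h
    · have : (7 : ℝ) ≤ k := by exact_mod_cast h
      nlinarith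
    · have a1 : ((2 * m).choose k : ℝ) ≤ (2 * m).choose 6 := by
        exact_mod_cast choose_le_choose_of_le (n := 2 * m) (by omega : k ≤ 6) (by omega)
      have a2 := choose_succ_cast (n := 2 * m) (k := 6) (by omega)
      have a3 := choose_le_middle_two_mul m 7
      have a4 : (0 : ℝ) ≤ (2 * m).choose 6 := by positivity
      norm_num at a2
      have a5 : 5 * ((2 * m).choose 6 : ℝ) ≤ (2 * m).choose 7 := by nlinarith
      nlinarith
  have hdown : ((2 * m).choose m - (2 * m).choose k : ℝ) / (m - k) ≤ (2 * m).choose m / 5 := by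
    obtain ⟨b, rfl⟩ : ∃ b, m = k + b := ⟨m - k, by omega⟩
    have hb : (0 : ℝ) < b := by push_cast at h2'; linarith
    have eb : ((k + b : ℕ) : ℝ) - k = b := by push_cast; ring
    rw [eb, div_le_div_iff₀ hb (by norm_num)]
    rcases le_or_gt 5 b with h | h
    · have : (5 : ℝ) ≤ b := by exact_mod_cast h
      have : (0 : ℝ) ≤ (2 * (k + b)).choose k := by positivity
      nlinarith
    · have a1 := choose_sub_le (k + b) b (by omega)
      rw [Nat.add_sub_cancel] at a1
      have a2 : 5 * (b : ℝ) ^ 2 / (((k + b : ℕ) : ℝ) + 1) ≤ b := by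
        rw [div_le_iff₀ (by positivity)]
        have : (b : ℝ) ≤ 4 := by exact_mod_cast (by omega : b ≤ 4)
        nlinarith
      calc _ ≤ ((2 * (k + b)).choose (k + b) : ℝ) * ((b : ℝ) ^ 2 / (((k + b : ℕ) : ℝ) + 1)) * 5 := by
            gcongr
        _ = ((2 * (k + b)).choose (k + b) : ℝ) * (5 * (b : ℝ) ^ 2 / (((k + b : ℕ) : ℝ) + 1)) := by
            ring
        _ ≤ _ := by gcongr
  have hup0 : (0 : ℝ) ≤ ((2 * m).choose k - (2 * m).choose 2 : ℝ) / (k - 2) :=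
    div_nonneg (by linarith) (by linarith)
  have hdown0 : (0 : ℝ) ≤ ((2 * m).choose m - (2 * m).choose k : ℝ) / (m - k) :=
    div_nonneg (by linarith) (by linarith)
  have hD : (0 : ℝ) ≤ (m : ℝ) - (2 : ℕ) := by push_cast; linarith
  rw [← abs_of_nonneg hD, ← abs_mul, e]
  exact abs_le.2 ⟨by linarith, by linarith⟩

theorem sub_mul_abs_dev_le {A Z k : ℕ} {Y : ℕ → ℝ} {b : ℝ} (h1 : A < k) (h2 : k < Z)
    (hY : ∀ j, A ≤ j → j ≤ Z → 0 ≤ Y j ∧ Y j ≤ b) : ((Z : ℝ) - A) * |dev Y A Z k| ≤ 2 * b := by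
  have hw := wt_pos h1 h2
  have hYA := hY A le_rfl (by omega)
  have hYZ := hY Z (by omega) le_rfl
  have hYk := hY k h1.le h2.le
  have hD : (0 : ℝ) ≤ (Z : ℝ) - A := by
    have : (A : ℝ) ≤ Z := by exact_mod_cast (h1.trans h2).le
    linarith
  have a1 := chord_mul_le h1 h2 hYA.1 hYZ.1 (by linarith [hYA.2, hYZ.2] : Y A + Y Z ≤ 2 * b)
  have a2 := mul_nonneg (chord_nonneg h1 h2 hYA.1 hYZ.1) hD
  have a3 : Y k * ((Z : ℝ) - A) ≤ 2 * b * wt A Z k := by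
    have := sub_div_wt_le_two h1 h2
    rw [div_le_iff₀ hw] at this
    nlinarith [hYk.1, hYk.2]
  have a4 := mul_nonneg hYk.1 hD
  rw [dev, abs_div, abs_of_pos hw, ← mul_div_assoc, div_le_iff₀ hw]
  nth_rewrite 1 [← abs_of_nonneg hD]
  rw [← abs_mul]
  exact abs_le.2 ⟨by linarith, by linarith⟩

theorem sum_wt_div_choose_le_two {m : ℕ} (hm : 22 ≤ m) :
    ∑ k ∈ Ioo 2 m, wt 2 m k * (2 * m).choose (2 + 1) / (2 * m).choose k
      ≤ 141 / 80 * ((m : ℝ) - 3) := by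
  have hm' : (22 : ℝ) ≤ m := by exact_mod_cast hm
  obtain ⟨N, rfl⟩ : ∃ N, m = 3 + N := ⟨m - 3, by omega⟩
  have hN : (0 : ℝ) ≤ N := by positivity
  set n := 2 * (3 + N) with hn
  have hterm : ∀ i ∈ range N, wt 2 (3 + N) (3 + i) * n.choose 3 / n.choose (3 + i)
      ≤ (N : ℝ) * ((i + 1) / 5 ^ i + 1 / (5 * ((3 + N : ℕ) : ℝ))) := by
    intro i hi
    have hi := mem_range.1 hi
    have hi' : (i : ℝ) + 1 ≤ N := by exact_mod_cast hi
    have hC : (0 : ℝ) < n.choose (3 + i) := by exact_mod_cast Nat.choose_pos (by omega)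
    have hC3 : (0 : ℝ) < n.choose 3 := by exact_mod_cast Nat.choose_pos (by omega)
    have key : ((i : ℝ) + 1) * n.choose 3 / n.choose (3 + i)
        ≤ (i + 1) / 5 ^ i + 1 / (5 * ((3 + N : ℕ) : ℝ)) := by
      rw [div_le_iff₀ hC]
      rcases Nat.lt_or_ge i 4 with h | h
      · have h1 := pow_mul_choose_le (n := n) (m := 3) (t := i) (q := 5) (by norm_num)
          (fun j hj => by
            have : (j : ℝ) + 1 ≤ 3 := by exact_mod_cast (by omega : j + 1 ≤ 3)
            rw [hn]
            push_cast at hm' ⊢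
            linarith) (by omega)
        calc ((i : ℝ) + 1) * n.choose 3 = (i + 1) / 5 ^ i * (5 ^ i * n.choose 3) := by
              field_simp
          _ ≤ (i + 1) / 5 ^ i * n.choose (3 + i) := by gcongr
          _ ≤ _ := by
              gcongr
              exact le_add_of_nonneg_right (by positivity)
      · have h1 := sq_mul_choose_three_le hm
        have h2 : (n.choose 7 : ℝ) ≤ n.choose (3 + i) := by
          exact_mod_cast choose_le_choose_of_le (n := n) (by omega : 7 ≤ 3 + i) (by omega)
        have h3 : (i : ℝ) + 1 ≤ ((3 + N : ℕ) : ℝ) := by push_cast; linarith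
        calc ((i : ℝ) + 1) * n.choose 3 ≤ ((3 + N : ℕ) : ℝ) * n.choose 3 := by gcongr
          _ = 1 / (5 * ((3 + N : ℕ) : ℝ)) * (5 * ((3 + N : ℕ) : ℝ) ^ 2 * n.choose 3) := by
              field_simp
          _ ≤ 1 / (5 * ((3 + N : ℕ) : ℝ)) * n.choose (3 + i) := by
              gcongr
              exact h1.trans h2
          _ ≤ _ := by
              gcongr
              exact le_add_of_nonneg_left (by positivity)
    calc wt 2 (3 + N) (3 + i) * n.choose 3 / n.choose (3 + i)
        = ((N : ℝ) - i) * (((i : ℝ) + 1) * n.choose 3 / n.choose (3 + i)) := by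
          unfold wt; push_cast; ring
      _ ≤ (N : ℝ) * ((i + 1) / 5 ^ i + 1 / (5 * ((3 + N : ℕ) : ℝ))) := by
          refine mul_le_mul ?_ key (by positivity) hN
          linarith [(Nat.cast_nonneg i : (0 : ℝ) ≤ i)]
  have hgeo : ∑ i ∈ range N, ((i : ℝ) + 1) / 5 ^ i ≤ 25 / 16 := by
    have : ∑ i ∈ range N, ((i : ℝ) + 1) / 5 ^ i
        = 25 / 16 - 5 * (4 * N + 5) / (16 * 5 ^ N) := by
      clear * -
      induction N with
      | zero => norm_num
      | succ N ih =>
        rw [sum_range_succ, ih]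
        push_cast
        field_simp
        ring
    rw [this]
    have : (0 : ℝ) ≤ 5 * (4 * N + 5) / (16 * 5 ^ N) := by positivity
    linarith
  rw [show Ioo 2 (3 + N) = Ico 3 (3 + N) from rfl, sum_Ico_eq_sum_range, Nat.add_sub_cancel_left]
  refine (sum_le_sum hterm).trans ?_
  rw [← mul_sum, sum_add_distrib, sum_const, card_range, nsmul_eq_mul]
  have : (N : ℝ) * (1 / (5 * ((3 + N : ℕ) : ℝ))) ≤ 1 / 5 := by
    rw [mul_one_div, div_le_div_iff₀ (by positivity) (by norm_num)]
    push_cast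
    linarith
  push_cast at this ⊢
  nlinarith

/-- Only the size of the deviation matters: `Y` may be the small numbers `C(2 * m, k) - N_k` or
their complements. -/
theorem errLe_two_of_large {m : ℕ} (hm : 22 ≤ m) {Y : ℕ → ℝ}
    (hY : ∀ k, 2 < k → k < m → ((m : ℝ) - (2 : ℕ)) * |dev Y 2 m k|
      ≤ (2 * m).choose m / 5 + 2 * 3 ^ m) :
    ErrLe (2 * m) 2 m (fun _ _ => m) Y (errorBound 2 m - 1 / 2) := by
  intro p r α β δ hp hpZ hr hrZ hpr hδ e1 e2
  rw [hδ.eq_zero, add_zero] at e2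
  have hm' : (22 : ℝ) ≤ m := by exact_mod_cast hm
  have hL := fun k (h1 : 2 < k) (h2 : k < m) =>
    abs_line_le_of_dev_le (k := k) hp hpZ hr hrZ h1 h2 hpr hY e1 e2
  have h1 := errSum_le_of_dev_le (n := 2 * m) (m := 2) le_rfl (by omega) (by omega)
    (by positivity) hY hL
  have h2 := le_errorBound (l := 2) (w := m) (m := 2) (by omega) (Or.inl rfl)
  rw [Nat.mul_div_cancel_left m (by norm_num)] at h2
  have h3 := one_le_peak_mul_choose (n := 2 * m) (i := 2 + 1) (by omega)
  have h4 := sum_wt_div_choose_le_two hm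
  have h5 : (67 : ℝ) * 3 ^ m ≤ (2 * m).choose m := by exact_mod_cast three_pow_le_choose hm
  have h6 : (2420 : ℝ) * (2 * m).choose (2 + 1) ≤ (2 * m).choose m := by
    have a1 := sq_mul_choose_three_le hm
    have a2 := choose_le_middle_two_mul m 7
    have a3 : (0 : ℝ) ≤ (2 * m).choose 3 := by positivity
    have a4 : (2420 : ℝ) ≤ 5 * (m : ℝ) ^ 2 := by nlinarith
    exact (mul_le_mul_of_nonneg_right a4 a3).trans (a1.trans a2)
  have hμ := peak_nonneg (2 * m) (2 + 1)
  set μ := peak (2 * m) (2 + 1)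
  set C : ℝ := (((2 * m).choose m : ℕ) : ℝ)
  set C3 : ℝ := (((2 * m).choose (2 + 1) : ℕ) : ℝ)
  have hC0 : 0 ≤ C := by positivity
  have h7 : 9 / 4 * (C / 5 + 2 * 3 ^ m) * ∑ k ∈ Ioo 2 m, wt 2 m k * C3 / (2 * m).choose k
      ≤ 9 / 4 * (C / 5 + 2 * (C / 67)) * (141 / 80 * ((m : ℝ) - 3)) := by
    have a1 : (3 : ℝ) ^ m ≤ C / 67 := by rw [le_div_iff₀ (by norm_num)]; linarith
    have a2 : 0 ≤ 141 / 80 * ((m : ℝ) - 3) := by linarith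
    calc _ ≤ 9 / 4 * (C / 5 + 2 * 3 ^ m) * (141 / 80 * ((m : ℝ) - 3)) :=
          mul_le_mul_of_nonneg_left h4 (by positivity)
      _ ≤ _ := by gcongr
  have h8 : 9 / 4 * (C / 5 + 2 * (C / 67)) * (141 / 80 * ((m : ℝ) - 3))
      ≤ ((m : ℝ) - 3) * (C - C3) - C3 * (2 * m + 1) / 2 := by
    have a3 : C3 ≤ C / 2420 := by rw [le_div_iff₀ (by norm_num)]; linarith
    have a4 : (0 : ℝ) ≤ C3 := by positivity
    nlinarith
  have h9 := h1.trans (mul_le_mul_of_nonneg_left (h7.trans h8) hμ)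
  push_cast at h2 h3 h9 ⊢
  have e : (2 * (m : ℝ) - m - 2 - 1) = m - 3 := by ring
  rw [e] at h2
  linarith

/-- The estimate for small coefficients and for their complements. -/
theorem errLe_coeff_two_of_large {m : ℕ} (hm : 22 ≤ m) {Y : ℕ → ℝ}
    (hY : ∀ j, 2 ≤ j → j ≤ m → 0 ≤ Y j ∧ Y j ≤ 3 ^ m) :
    ErrLe (2 * m) 2 m (fun _ _ => m) Y (errorBound 2 m - 1 / 2) ∧
    ErrLe (2 * m) 2 m (fun _ _ => m) (fun j => ((2 * m).choose j : ℝ) - Y j)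
      (errorBound 2 m - 1 / 2) := by
  have hD : (0 : ℝ) ≤ (m : ℝ) - (2 : ℕ) := by
    have : (2 : ℝ) ≤ m := by exact_mod_cast (by omega : 2 ≤ m)
    push_cast; linarith
  constructor
  · refine errLe_two_of_large hm fun k h1 h2 => (sub_mul_abs_dev_le h1 h2 hY).trans ?_
    have : (0 : ℝ) ≤ (2 * m).choose m / 5 := by positivity
    linarith
  · refine errLe_two_of_large hm fun k h1 h2 => ?_
    rw [dev_sub]
    refine (mul_le_mul_of_nonneg_left (abs_sub _ _) hD).trans ?_
    rw [mul_add]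
    exact add_le_add (sub_mul_abs_devC_le hm h1 h2) (sub_mul_abs_dev_le h1 h2 hY)

/-! ### Small dimensions -/

/-- Only the parity of `ε` matters. -/
theorem coeff_mod_two (l w ε k : ℕ) : coeff l w (ε % 2) k = coeff l w ε k := by
  have h : ∀ S, Link l w (ε % 2) S = Link l w ε S := by
    intro S
    have hp : ∀ i j : ℕ, (i + j + ε % 2) % 2 = (i + j + ε) % 2 := fun i j => by omega
    funext a b
    refine propext ⟨?_, ?_⟩
    · rintro (⟨_, h⟩ | ⟨_, h⟩ | ⟨_, h⟩ | ⟨i, j, h1, h2, h3, h4⟩)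
      · exact .contact _ h
      · exact .source _ h
      · exact .sink _ h
      · exact .wire i j h1 h2 h3 (by rw [← hp]; exact h4)
    · rintro (⟨_, h⟩ | ⟨_, h⟩ | ⟨_, h⟩ | ⟨i, j, h1, h2, h3, h4⟩)
      · exact .contact _ h
      · exact .source _ h
      · exact .sink _ h
      · exact .wire i j h1 h2 h3 (by rw [hp]; exact h4)
  have h' : Connects l w (ε % 2) = Connects l w ε := by
    funext S
    unfold Connects
    rw [h]
  unfold coeff pathsets
  rw [h']

/-- The test with the lower bounds for the coefficients of the hammock and of its dual that come
from the paths running forward in every column. -/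
noncomputable def forwardCheck (l w ε : ℕ) (dual : Bool) : Bool :=
  force (l * w) fun n => force (binomialNumber n) fun T =>
  force (forwardNumber l w ε) fun F => force (forwardNumber w l (ε + 1)) fun F' =>
    bif dual then exactCheck l w true (fun k => digit n F' (n - k))
      (fun k => digit n T k - digit n F k)
    else exactCheck l w false (digit n F) (fun k => digit n T k - digit n F' (n - k))

theorem errLe_of_forwardCheck {l w ε : ℕ} (hl : 0 < l) (hw : 0 < w) (h : l + w + 1 ≤ l * w)
    (hc : ∀ dual, forwardCheck l w ε dual = true) :
    ErrLe (l * w) l (l * w - w) (fun p r => max p (l * w - r)) (fun k => (coeff l w ε k : ℝ))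
      (errorBound l w - 1 / 2) ∧
    ErrLe (l * w) l (l * w - w) (fun p r => max r (l * w - p))
      (fun k => ((l * w).choose k : ℝ) - coeff l w ε k) (errorBound l w - 1 / 2) := by
  have hn : 0 < l * w := Nat.mul_pos hl hw
  have key : ∀ j, j ≤ l * w - w → digit (l * w) (forwardNumber l w ε) j ≤ coeff l w ε j ∧
      digit (l * w) (forwardNumber w l (ε + 1)) (l * w - j) ≤ coeff w l (ε + 1) (l * w - j) ∧
      coeff l w ε j + coeff w l (ε + 1) (l * w - j) = (l * w).choose j ∧
      digit (l * w) (binomialNumber (l * w)) j = (l * w).choose j := by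
    intro j hj
    have h2 := digit_forwardNumber_le (l := w) (w := l) (ε := ε + 1) (k := l * w - j) hw hl
      (by rw [mul_comm w l]; omega)
    rw [mul_comm w l] at h2
    exact ⟨digit_forwardNumber_le hl hw (by omega), h2,
      coeff_add_coeff_dual l w ε j hl (by omega), digit_binomialNumber hn (by omega)⟩
  have hf := hc false
  have ht := hc true
  simp only [forwardCheck, force_eq, cond_false, cond_true] at hf ht
  constructor
  · refine errLe_of_exactCheck (dual := false) hl hw h ?_ hf
    intro j _ hj
    obtain ⟨k1, k2, k3, k4⟩ := key j hj
    exact ⟨by exact_mod_cast k1, by rw [Nat.cast_le]; omega⟩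
  · refine errLe_of_exactCheck (dual := true) hl hw h ?_ ht
    intro j _ hj
    obtain ⟨k1, k2, k3, k4⟩ := key j hj
    have e : ((l * w).choose j : ℝ) - coeff l w ε j = (coeff w l (ε + 1) (l * w - j) : ℝ) := by
      rw [← k3]; push_cast; ring
    simp only [e, Nat.cast_le]
    omega

/-- The test for the hammocks of length two, whose coefficients are at least
`C(2 m, k) - 2 ^ k C(m, k)`. -/
noncomputable def thinCheck (m : ℕ) : Bool :=
  force (binomialNumber (2 * m)) fun T => force (binomialNumber m) fun T' =>
    exactCheck 2 m false (fun k => digit (2 * m) T k - 2 ^ k * digit m T' k) (digit (2 * m) T) &&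
    exactCheck 2 m false (fun _ => 0)
      (fun k => digit (2 * m) T k - (digit (2 * m) T k - 2 ^ k * digit m T' k))

/-- For hammocks of length two there is no room for bridge points, and hence no defect. -/
theorem errLe_of_thinCheck {m ε : ℕ} (hm : 3 ≤ m) (hc : thinCheck m = true) :
    ErrLe (2 * m) 2 m (fun _ _ => m) (fun k => (coeff 2 m ε k : ℝ))
      (errorBound 2 m - 1 / 2) ∧
    ErrLe (2 * m) 2 m (fun _ _ => m) (fun k => ((2 * m).choose k : ℝ) - coeff 2 m ε k)
      (errorBound 2 m - 1 / 2) := by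
  have hZ : 2 * m - m = m := by omega
  have key : ∀ j, j ≤ m → (2 * m).choose j ≤ coeff 2 m ε j + 2 ^ j * m.choose j ∧
      coeff 2 m ε j ≤ (2 * m).choose j ∧
      digit (2 * m) (binomialNumber (2 * m)) j = (2 * m).choose j ∧
      digit m (binomialNumber m) j = m.choose j := by
    intro j hj
    exact ⟨choose_le_coeff_two m ε j, coeff_le_choose (by omega) (by omega),
      digit_binomialNumber (by omega) (by omega), digit_binomialNumber (by omega) hj⟩
  simp only [thinCheck, force_eq, Bool.and_eq_true] at hc
  constructor
  · have a := errLe_of_exactCheck (Y := fun k => (coeff 2 m ε k : ℝ)) (by omega) (by omega)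
      (by omega) (fun j _ hj => by
        obtain ⟨k1, k2, k3, k4⟩ := key j (by omega)
        rw [k3, k4, Nat.cast_le, Nat.cast_le]
        omega) hc.1
    rw [hZ] at a
    intro p r α β δ h1 h2 h3 h4 h5 h6
    exact a p r α β δ h1 h2 h3 h4 h5 (Or.inl h6.eq_zero)
  · have a := errLe_of_exactCheck (Y := fun k => ((2 * m).choose k : ℝ) - coeff 2 m ε k) (by omega)
      (by omega) (by omega) (fun j _ hj => by
        obtain ⟨k1, k2, k3, k4⟩ := key j (by omega)
        rw [k3, k4, ← Nat.cast_sub k2, Nat.cast_le, Nat.cast_le]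
        omega) hc.2
    rw [hZ] at a
    intro p r α β δ h1 h2 h3 h4 h5 h6
    exact a p r α β δ h1 h2 h3 h4 h5 (Or.inl h6.eq_zero)

/-! ### Kernel computations -/

section Computations

set_option maxRecDepth 100000

theorem uniformCheck_three : ∀ i < 83, uniformCheck 3 (17 + i) = true := by decide +kernel

theorem uniformCheck_four : ∀ i < 65, uniformCheck 4 (10 + i) = true := by decide +kernel

theorem uniformCheck_five : ∀ i < 52, uniformCheck 5 (8 + i) = true := by decide +kernel

theorem uniformCheck_six : ∀ i < 42, uniformCheck 6 (8 + i) = true := by decide +kernel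

theorem uniformCheck_seven : ∀ i < 35, uniformCheck 7 (8 + i) = true := by decide +kernel

theorem uniformCheck_of_eight_le : ∀ i < 10, ∀ j < 30, (8 + i) * (8 + i + j) < 300 →
    uniformCheck (8 + i) (8 + i + j) = true := by decide +kernel

theorem coarseCheck_three : ∀ i < 9, coarseCheck 3 (8 + i) = true := by decide +kernel

theorem coarseCheck_four : ∀ i < 5, coarseCheck 4 (5 + i) = true := by decide +kernel

theorem coarseCheck_five : ∀ i < 2, coarseCheck 5 (6 + i) = true := by decide +kernel

theorem coarseCheck_six : ∀ i < 2, coarseCheck 6 (6 + i) = true := by decide +kernel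

theorem coarseCheck_seven : coarseCheck 7 7 = true := by decide +kernel

theorem coarseCheck_width_three : ∀ i < 6, coarseCheck (11 + i) 3 = true := by decide +kernel

theorem coarseCheck_width_four : ∀ i < 4, coarseCheck (6 + i) 4 = true := by decide +kernel

theorem coarseCheck_width_five : ∀ i < 2, coarseCheck (6 + i) 5 = true := by decide +kernel

theorem coarseCheck_width_six : coarseCheck 7 6 = true := by decide +kernel

theorem forwardCheck_three : ∀ i < 4, ∀ ε < 2, ∀ dual, forwardCheck 3 (4 + i) ε dual = true := by
  decide +kernel

theorem forwardCheck_four : ∀ ε < 2, ∀ dual, forwardCheck 4 4 ε dual = true := by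
  decide +kernel

theorem forwardCheck_five : ∀ ε < 2, ∀ dual, forwardCheck 5 5 ε dual = true := by
  decide +kernel

theorem forwardCheck_width_four : ∀ ε < 2, ∀ dual, forwardCheck 5 4 ε dual = true := by
  decide +kernel

theorem forwardCheck_width_three : ∀ i < 7, ∀ ε < 2, ∀ dual,
    forwardCheck (4 + i) 3 ε dual = true := by
  decide +kernel

theorem thinCheck_of_lt : ∀ i < 16, thinCheck (6 + i) = true := by decide +kernel

end Computations

/-! ### All dimensions -/

/-- The uniform estimate, in all but finitely many dimensions. -/
theorem uniformBound_of_le {l w : ℕ} (hl : 3 ≤ l) (hlw : l ≤ w)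
    (h3 : l = 3 → 17 ≤ w) (h4 : l = 4 → 10 ≤ w) (h8 : 8 ≤ w) :
    UniformBound (l * w) l (l * w - w) l := by
  rcases le_or_gt 300 (l * w) with hn | hn
  · exact uniformBound_of_large hl hlw hn
  have h : l + w + 2 ≤ l * w := by nlinarith
  have hc : uniformCheck l w = true := by
    have hl18 : l < 18 := by nlinarith
    obtain rfl | rfl | rfl | rfl | rfl | hl8 :
        l = 3 ∨ l = 4 ∨ l = 5 ∨ l = 6 ∨ l = 7 ∨ 8 ≤ l := by omega
    · have := uniformCheck_three (w - 17) (by omega)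
      rwa [show 17 + (w - 17) = w by omega] at this
    · have := uniformCheck_four (w - 10) (by omega)
      rwa [show 10 + (w - 10) = w by omega] at this
    · have := uniformCheck_five (w - 8) (by omega)
      rwa [show 8 + (w - 8) = w by omega] at this
    · have := uniformCheck_six (w - 8) (by omega)
      rwa [show 8 + (w - 8) = w by omega] at this
    · have := uniformCheck_seven (w - 8) (by omega)
      rwa [show 8 + (w - 8) = w by omega] at this
    · have hw : w < 38 := by nlinarith
      have e1 : 8 + (l - 8) = l := by omega
      have e2 : l + (w - l) = w := by omega
      have := uniformCheck_of_eight_le (l - 8) (by omega) (w - l) (by omega)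
      rw [e1, e2] at this
      exact this hn
  have := uniformBound_of_uniformCheck h hc
  rwa [min_eq_left hlw] at this

/-- The bounds for the errors of the coefficients of a hammock and of its dual. -/
theorem errLe_coeff {l w : ℕ} (ε : ℕ) (hl : 3 ≤ l) (hw : 3 ≤ w) (h33 : ¬ (l = 3 ∧ w = 3)) :
    ErrLe (l * w) l (l * w - w) (fun p r => max p (l * w - r)) (fun k => (coeff l w ε k : ℝ))
      (errorBound l w - 1 / 2) ∧
    ErrLe (l * w) l (l * w - w) (fun p r => max r (l * w - p))
      (fun k => ((l * w).choose k : ℝ) - coeff l w ε k) (errorBound l w - 1 / 2) := by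
  have h : l + w + 2 ≤ l * w := by
    rcases Nat.lt_or_ge 3 l with h | h
    · nlinarith
    · have : 4 ≤ w := by omega
      nlinarith
  have hwn : w ≤ l * w := by omega
  have hY : ∀ j, l ≤ j → j ≤ l * w - w →
      0 ≤ (coeff l w ε j : ℝ) ∧ (coeff l w ε j : ℝ) ≤ (l * w).choose j := fun j _ hj =>
    ⟨Nat.cast_nonneg _, by exact_mod_cast coeff_le_choose (by omega) (by omega)⟩
  have hY' : ∀ j, l ≤ j → j ≤ l * w - w →
      0 ≤ ((l * w).choose j : ℝ) - coeff l w ε j ∧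
        ((l * w).choose j : ℝ) - coeff l w ε j ≤ (l * w).choose j := fun j h1 h2 =>
    ⟨by linarith [(hY j h1 h2).2], by linarith [(hY j h1 h2).1]⟩
  have uniform : UniformBound (l * w) l (l * w - w) l → l ≤ w → _ := fun hU hlw =>
    And.intro
      (errLe_of_uniformBound (m' := fun p r => max p (l * w - r)) h (.inl rfl) le_rfl hlw
        (fun _ _ => min_le_left _ _) hY hU)
      (errLe_of_uniformBound (m' := fun p r => max r (l * w - p)) h (.inl rfl) le_rfl hlw
        (fun _ _ => min_le_right _ _) hY' hU)
  have uniform' : UniformBound (l * w) l (l * w - w) w → w ≤ l → _ := fun hU hlw =>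
    And.intro
      (errLe_of_uniformBound (m' := fun p r => max p (l * w - r)) h (.inr rfl) hlw le_rfl
        (fun _ _ => min_le_left _ _) hY hU)
      (errLe_of_uniformBound (m' := fun p r => max r (l * w - p)) h (.inr rfl) hlw le_rfl
        (fun _ _ => min_le_right _ _) hY' hU)
  have coarse : coarseCheck l w = true → _ := fun hc =>
    And.intro
      (errLe_of_coarseCheck (m := fun p r => max p (l * w - r)) (by omega) (by omega) (by omega)
        hY hc fun p r => min_le_left _ _)
      (errLe_of_coarseCheck (m := fun p r => max r (l * w - p)) (by omega) (by omega) (by omega)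
        hY' hc fun p r => min_le_right _ _)
  have forward : (∀ ε < 2, ∀ dual, forwardCheck l w ε dual = true) → _ := fun hc => by
    have := errLe_of_forwardCheck (ε := ε % 2) (by omega) (by omega) (by omega)
      (hc (ε % 2) (Nat.mod_lt _ two_pos))
    simp only [coeff_mod_two] at this
    exact this
  have large : l ≤ w → (l = 3 → 17 ≤ w) → (l = 4 → 10 ≤ w) → 8 ≤ w → _ :=
    fun h1 h2 h3 h4 => uniform (uniformBound_of_le hl h1 h2 h3 h4) h1
  have large' : w ≤ l → (w = 3 → 17 ≤ l) → (w = 4 → 10 ≤ l) → 8 ≤ l → _ :=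
    fun h1 h2 h3 h4 => uniform' (by
      have := (uniformBound_of_le hw h1 h2 h3 h4).reflect (by rw [mul_comm]; omega) (by omega)
      rw [mul_comm w l] at this
      have hln : l ≤ l * w := by omega
      rwa [Nat.sub_sub_self hln] at this) h1
  rcases le_total l w with hlw | hlw
  · by_cases hL : (l = 3 → 17 ≤ w) ∧ (l = 4 → 10 ≤ w) ∧ 8 ≤ w
    · exact large hlw hL.1 hL.2.1 hL.2.2
    obtain rfl | rfl | rfl | rfl | rfl : l = 3 ∨ l = 4 ∨ l = 5 ∨ l = 6 ∨ l = 7 := by omega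
    · rcases Nat.lt_or_ge w 8 with h8 | h8
      · have := forwardCheck_three (w - 4) (by omega)
        rw [show 4 + (w - 4) = w by omega] at this
        exact forward this
      · have := coarseCheck_three (w - 8) (by omega)
        rw [show 8 + (w - 8) = w by omega] at this
        exact coarse this
    · rcases hlw.eq_or_lt with rfl | hw4
      · exact forward forwardCheck_four
      · have := coarseCheck_four (w - 5) (by omega)
        rw [show 5 + (w - 5) = w by omega] at this
        exact coarse this
    · rcases hlw.eq_or_lt with rfl | hw4
      · exact forward forwardCheck_five
      · have := coarseCheck_five (w - 6) (by omega)
        rw [show 6 + (w - 6) = w by omega] at this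
        exact coarse this
    · have := coarseCheck_six (w - 6) (by omega)
      rw [show 6 + (w - 6) = w by omega] at this
      exact coarse this
    · obtain rfl : w = 7 := by omega
      exact coarse coarseCheck_seven
  · by_cases hL : (w = 3 → 17 ≤ l) ∧ (w = 4 → 10 ≤ l) ∧ 8 ≤ l
    · exact large' hlw hL.1 hL.2.1 hL.2.2
    obtain rfl | rfl | rfl | rfl | rfl : w = 3 ∨ w = 4 ∨ w = 5 ∨ w = 6 ∨ w = 7 := by omega
    · rcases Nat.lt_or_ge l 11 with h8 | h8
      · have := forwardCheck_width_three (l - 4) (by omega)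
        rw [show 4 + (l - 4) = l by omega] at this
        exact forward this
      · have := coarseCheck_width_three (l - 11) (by omega)
        rw [show 11 + (l - 11) = l by omega] at this
        exact coarse this
    · obtain rfl | rfl | h6 : l = 4 ∨ l = 5 ∨ 6 ≤ l := by omega
      · exact forward forwardCheck_four
      · exact forward forwardCheck_width_four
      · have := coarseCheck_width_four (l - 6) (by omega)
        rw [show 6 + (l - 6) = l by omega] at this
        exact coarse this
    · rcases hlw.eq_or_lt with rfl | h6
      · exact forward forwardCheck_five
      · have := coarseCheck_width_five (l - 6) (by omega)
        rw [show 6 + (l - 6) = l by omega] at this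
        exact coarse this
    · rcases hlw.eq_or_lt with rfl | h6
      · exact coarse (coarseCheck_six 0 (by omega))
      · obtain rfl : l = 7 := by omega
        exact coarse coarseCheck_width_six
    · obtain rfl : l = 7 := by omega
      exact coarse coarseCheck_seven

/-! ### Both interpolation errors -/

/-- The sum of the two linear functions is the secant of `devC` through the bridge points. It
differs from `devC` at `u` and `y` by the defects, which vanish if these are the bridge points. -/
theorem Interpolates.errSum_le {n A Z u y x₁ x₂ : ℕ} {X : ℕ → ℝ} {α β α' β' T : ℝ}
    {m₁ m₂ : ℕ → ℕ → ℕ}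
    (h : Interpolates n A Z u y x₁ x₂ X α β α' β') (hAu : A < u) (huZ : u < Z) (hAy : A < y)
    (hyZ : y < Z) (huy : u ≠ y)
    (hx : (x₁ = u ∧ x₂ = y) ∨ (x₁ ≠ x₂ ∧ (max (m₁ u y) (m₂ y u) < x₁ ∧ x₁ < Z) ∧
      max (m₁ u y) (m₂ y u) < x₂ ∧ x₂ < Z))
    (h1 : ErrLe n A Z m₁ X T) (h2 : ErrLe n A Z m₂ (fun k => (n.choose k : ℝ) - X k) T) :
    errSum n A Z X α β ≤ T ∧ errSum n A Z (fun k => (n.choose k : ℝ) - X k) α' β' ≤ T := by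
  have b1 := h.bridge₁
  have b2 := h.bridge₂
  rw [← line_add] at b1 b2
  have key : ∀ r, r = u ∨ r = y → IsDefect n A Z (max (m₁ u y) (m₂ y u)) r
      (line A Z (α + α') (β + β') r - devC n A Z r) := by
    intro r hr
    rcases hx with ⟨rfl, rfl⟩ | ⟨hne, hx1, hx2⟩
    · left
      rcases hr with rfl | rfl
      · rw [b1]; exact sub_self _
      · rw [b2]; exact sub_self _
    · right
      rcases lt_or_gt_of_ne hne with hlt | hlt
      · exact ⟨_, _, x₁, x₂, hx1.1, hlt, hx2.2, b1, b2, rfl⟩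
      · exact ⟨_, _, x₂, x₁, hx2.1, hlt, hx1.2, b2, b1, rfl⟩
  constructor
  · refine h1 u y α β _ hAu huZ hAy hyZ huy ((key y (Or.inr rfl)).mono (le_max_left _ _)) h.left ?_
    have := h.right
    rw [dev_sub] at this
    rw [line_add, this, devC]
    ring
  · refine h2 y u α' β' _ hAy hyZ hAu huZ huy.symm ((key u (Or.inl rfl)).mono (le_max_right _ _))
      h.right ?_
    have := h.left
    rw [line_add, this, dev_sub, devC]
    ring

/-! ### Length or width two -/

/-- The estimate for networks of length two. There are no defects, as no bridge point lies between
`m` and `Z = m`. -/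
theorem errLe_coeff_two {m : ℕ} (ε : ℕ) (hm : 6 ≤ m) :
    ErrLe (2 * m) 2 m (fun _ _ => m) (fun k => (coeff 2 m ε k : ℝ)) (errorBound 2 m - 1 / 2) ∧
    ErrLe (2 * m) 2 m (fun _ _ => m) (fun k => ((2 * m).choose k : ℝ) - coeff 2 m ε k)
      (errorBound 2 m - 1 / 2) := by
  rcases Nat.lt_or_ge m 22 with h | h
  · have := thinCheck_of_lt (m - 6) (by omega)
    rw [show 6 + (m - 6) = m by omega] at this
    exact errLe_of_thinCheck (by omega) this
  · have key := errLe_coeff_two_of_large h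
      (Y := fun k => ((2 * m).choose k : ℝ) - coeff 2 m ε k) (fun j _ hj => by
        have h1 := choose_le_coeff_two m ε j
        have h2 := coeff_le_choose (l := 2) (w := m) (ε := ε) (k := j) (by omega) (by omega)
        have h3 : 2 ^ j * m.choose j ≤ 3 ^ m := by
          have := add_pow 2 1 m
          simp only [one_pow, mul_one] at this
          rw [show (3 : ℕ) = 2 + 1 from rfl, this]
          exact single_le_sum (f := fun i => 2 ^ i * (m.choose i)) (fun i _ => Nat.zero_le _)
            (mem_range.2 (by omega))
        rw [← Nat.cast_sub h2]
        exact ⟨Nat.cast_nonneg _, by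
          exact_mod_cast (by omega : (2 * m).choose j - coeff 2 m ε j ≤ 3 ^ m)⟩)
    simp only [sub_sub_cancel] at key
    exact ⟨key.2, key.1⟩

theorem dev_reflect {Y : ℕ → ℝ} {n A Z k : ℕ} (hAZ : A ≤ Z) (hZ : Z ≤ n) (hk : k ≤ n) :
    dev (fun j => Y (n - j)) (n - Z) (n - A) (n - k) = dev Y A Z k := by
  unfold dev chord
  simp only
  rw [wt_reflect hAZ hZ hk, Nat.sub_sub_self hk, Nat.sub_sub_self hZ,
    Nat.sub_sub_self (hAZ.trans hZ), Nat.cast_sub hk, Nat.cast_sub hZ, Nat.cast_sub (hAZ.trans hZ)]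
  have e1 : (n : ℝ) - A - (n - k) = k - A := by ring
  have e2 : (n : ℝ) - k - (n - Z) = Z - k := by ring
  have e3 : (n : ℝ) - A - (n - Z) = Z - A := by ring
  rw [e1, e2, e3, add_comm]

theorem line_reflect {n A Z k : ℕ} (hAZ : A ≤ Z) (hZ : Z ≤ n) (hk : k ≤ n) (α β : ℝ) :
    line (n - Z) (n - A) α β (n - k) = line A Z β α k := by
  unfold line
  rw [Nat.cast_sub hk, Nat.cast_sub hZ, Nat.cast_sub (hAZ.trans hZ)]
  have e1 : (n : ℝ) - A - (n - k) = k - A := by ring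
  have e2 : (n : ℝ) - k - (n - Z) = Z - k := by ring
  have e3 : (n : ℝ) - A - (n - Z) = Z - A := by ring
  rw [e1, e2, e3, add_comm]

/-- Reflection of the error bound, in the absence of defects. -/
theorem ErrLe.reflect {n A Z : ℕ} {Y : ℕ → ℝ} {T : ℝ} (hAZ : A < Z) (hZ : Z ≤ n)
    (h : ErrLe n A Z (fun _ _ => Z) Y T) :
    ErrLe n (n - Z) (n - A) (fun _ _ => n - A) (fun k => Y (n - k)) T := by
  intro p r α β δ h1 h2 h3 h4 h5 h6 h7 h8
  obtain rfl := h6.eq_zero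
  have e := errSum_reflect (N := fun _ => 0) (N' := fun k => Y (n - k)) (C := Y)
    (n := n) (fun k hk => by rw [Nat.sub_sub_self hk, zero_add]) hAZ hZ α β
  simp only [sub_zero] at e
  rw [e]
  have i1 := line_reflect hAZ.le hZ (Nat.sub_le n p) α β
  have i2 := line_reflect hAZ.le hZ (Nat.sub_le n r) α β
  have i3 := dev_reflect (Y := Y) hAZ.le hZ (Nat.sub_le n p)
  have i4 := dev_reflect (Y := Y) hAZ.le hZ (Nat.sub_le n r)
  rw [Nat.sub_sub_self (by omega)] at i1 i2 i3 i4
  exact h (n - p) (n - r) β α 0 (by omega) (by omega) (by omega) (by omega) (by omega)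
    (Or.inl rfl) (by rw [← i1, ← i3, h7]) (by rw [← i2, ← i4, h8])

/-- A hammock of width two is the dual of one of length two. -/
theorem errLe_coeff_width_two {m : ℕ} (ε : ℕ) (hm : 6 ≤ m) :
    ErrLe (m * 2) m (m * 2 - 2) (fun _ _ => m * 2 - 2) (fun k => (coeff m 2 ε k : ℝ))
      (errorBound m 2 - 1 / 2) ∧
    ErrLe (m * 2) m (m * 2 - 2) (fun _ _ => m * 2 - 2)
      (fun k => ((m * 2).choose k : ℝ) - coeff m 2 ε k) (errorBound m 2 - 1 / 2) := by
  have hR : errorBound m 2 = errorBound 2 m := by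
    unfold errorBound
    simp only [mul_comm m 2]
    rw [max_comm, min_comm]
    have e : ((2 * m : ℕ) : ℝ) - 2 - m - 1 = ((2 * m : ℕ) : ℝ) - m - 2 - 1 := by ring
    push_cast at e ⊢
    rw [e]
  have hZ : 2 * m - m = m := by omega
  rw [hR, mul_comm m 2]
  have hd : ∀ k ≤ 2 * m, (coeff 2 m (ε + 1) (2 * m - k) : ℝ)
      = ((2 * m).choose k : ℝ) - coeff m 2 ε k := by
    intro k hk
    have := coeff_add_coeff_dual m 2 ε k (by omega) (by omega)
    rw [mul_comm m 2] at this
    rw [← this]; push_cast; ring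
  have congr : ∀ {Y Y' : ℕ → ℝ} {T : ℝ}, (∀ k ≤ 2 * m, Y k = Y' k) →
      ErrLe (2 * m) m (2 * m - 2) (fun _ _ => 2 * m - 2) Y T →
      ErrLe (2 * m) m (2 * m - 2) (fun _ _ => 2 * m - 2) Y' T := by
    intro Y Y' T hY h p r α β δ h1 h2 h3 h4 h5 h6 h7 h8
    have hdev : ∀ k ≤ 2 * m, dev Y m (2 * m - 2) k = dev Y' m (2 * m - 2) k := by
      intro k hk
      unfold dev chord
      rw [hY k hk, hY m (by omega), hY (2 * m - 2) (by omega)]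
    have := h p r α β δ h1 h2 h3 h4 h5 h6 (by rw [h7, hdev p (by omega)])
      (by rw [h8, hdev r (by omega)])
    refine le_trans (le_of_eq ?_) this
    refine sum_congr rfl fun k hk => ?_
    have := mem_Ioo.1 hk
    rw [hdev k (by omega)]
  have h1 := (errLe_coeff_two (ε + 1) hm).1.reflect (by omega) (by omega)
  have h2 := (errLe_coeff_two (ε + 1) hm).2.reflect (by omega) (by omega)
  rw [hZ] at h1 h2
  refine ⟨congr (fun k hk => ?_) h2, congr (fun k hk => ?_) h1⟩
  · have := hd k hk
    rw [Nat.choose_symm hk, this, sub_sub_cancel]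
  · exact hd k hk

/-! ### Two inner points -/

/-- If there are just two integers between `A` and `Z`, then a cubic that interpolates at both of
them makes no error. -/
theorem errLe_of_eq_add_three (n A : ℕ) (Y : ℕ → ℝ) :
    ErrLe n A (A + 3) (fun _ _ => A + 3) Y 0 := by
  intro p r α β δ h1 h2 h3 h4 h5 h6 h7 h8
  rw [h6.eq_zero, add_zero] at h8
  refine le_of_eq (sum_eq_zero fun k hk => ?_)
  have := mem_Ioo.1 hk
  obtain rfl | rfl : k = p ∨ k = r := by omega
  · rw [h7, sub_self, abs_zero, mul_zero, mul_zero]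
  · rw [h8, sub_self, abs_zero, mul_zero, mul_zero]

theorem errorBound_three_three : errorBound 3 3 = 0 := by
  norm_num [errorBound, Nat.choose]

theorem half_le_errorBound_two_five : 1 / 2 ≤ errorBound 2 5 := by
  norm_num [errorBound, Nat.choose]

theorem half_le_errorBound_five_two : 1 / 2 ≤ errorBound 5 2 := by
  norm_num [errorBound, Nat.choose]

end Hammock

theorem mainTheorem3 (l w ε t s x₁ x₂ : ℕ)
    (ht : 1 ≤ t) (htn : (l : ℤ) + t < l * w - w)
    (hs : 1 ≤ s) (hsn : (w : ℤ) + s < l * w - l)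
    (hts : (l : ℤ) + t ≠ l * w - w - s)
    (hx : Hammock.Admissible l w t s x₁ x₂)
    (a b c d : ℝ) (hsys : Hammock.SplineSystem l w ε t s x₁ x₂ a b c d) :
    (∀ p ∈ Set.Icc (0 : ℝ) 1,
      |Hammock.reliability l w ε p - Hammock.approx l w ε a b p| ≤ Hammock.errorBound l w ∧
      |Hammock.reliability w l (ε + 1) p - Hammock.approx w l (ε + 1) c d p|
        ≤ Hammock.errorBound l w ∧
      |1 - Hammock.approx l w ε a b p - Hammock.approx w l (ε + 1) c d (1 - p)|
        ≤ 2 * Hammock.errorBound l w ∧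
      (¬ (l = 3 ∧ w = 3) →
        |1 - Hammock.approx l w ε a b p - Hammock.approx w l (ε + 1) c d p|
          ≤ 2 * Hammock.errorBound l w)) ∧
    Hammock.chebyshevNorm (fun p => Hammock.reliability l w ε p - Hammock.approx l w ε a b p)
      ≤ Hammock.errorBound l w ∧
    Hammock.chebyshevNorm
      (fun p => Hammock.reliability w l (ε + 1) p - Hammock.approx w l (ε + 1) c d p)
      ≤ Hammock.errorBound l w ∧
    Hammock.chebyshevNorm
      (fun p => 1 - Hammock.approx l w ε a b p - Hammock.approx w l (ε + 1) c d (1 - p))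
      ≤ 2 * Hammock.errorBound l w ∧
    (¬ (l = 3 ∧ w = 3) →
      Hammock.chebyshevNorm
        (fun p => 1 - Hammock.approx l w ε a b p - Hammock.approx w l (ε + 1) c d p)
        ≤ 2 * Hammock.errorBound l w) := by
  have htn' : l + t + w < l * w := by zify; linarith
  have hsn' : w + s + l < l * w := by zify; linarith
  have hl : 0 < l := Nat.pos_of_ne_zero (by rintro rfl; simp at htn')
  have hw : 0 < w := Nat.pos_of_ne_zero (by rintro rfl; simp at htn')
  have hwn : w ≤ l * w := by omega
  have hsn₀ : s ≤ l * w - w := by omega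
  have huy : l + t ≠ l * w - w - s := fun h => hts (by zify [hwn, hsn₀] at h; exact h)
  obtain ⟨α, β, α', β', e1, e2, hI⟩ := Hammock.exists_interpolates ht htn hs hsn hx hsys
  have hx' : (x₁ = l + t ∧ x₂ = l * w - w - s) ∨ (x₁ ≠ x₂ ∧
      (l + t < x₁ ∧ w + s < x₁ ∧ x₁ + w < l * w + s ∧ x₁ + l < l * w + t ∧ x₁ + w < l * w) ∧
      (l + t < x₂ ∧ w + s < x₂ ∧ x₂ + w < l * w + s ∧ x₂ + l < l * w + t ∧ x₂ + w < l * w)) := by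
    rcases hx with ⟨hne, ⟨h1, h2, h3⟩, h4, h5, h6⟩ | ⟨h1, h2⟩
    · rw [max_lt_iff] at h1 h4
      rw [lt_min_iff] at h2 h5
      refine .inr ⟨hne, ⟨?_, ?_, ?_, ?_, ?_⟩, ?_, ?_, ?_, ?_, ?_⟩ <;> zify <;> linarith
    · refine .inl ⟨?_, ?_⟩
      · zify; exact h1
      · zify [hwn, hsn₀]; exact h2
  -- It suffices to bound both sums of errors by some `T` that is small enough.
  suffices h : ∃ (T : ℝ) (m₁ m₂ : ℕ → ℕ → ℕ),
      (T ≤ Hammock.errorBound l w ∧ (¬ (l = 3 ∧ w = 3) → 1 + 2 * T ≤ 2 * Hammock.errorBound l w)) ∧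
      Hammock.ErrLe (l * w) l (l * w - w) m₁ (fun k => (Hammock.coeff l w ε k : ℝ)) T ∧
      Hammock.ErrLe (l * w) l (l * w - w) m₂
        (fun k => ((l * w).choose k : ℝ) - Hammock.coeff l w ε k) T ∧
      ((x₁ = l + t ∧ x₂ = l * w - w - s) ∨ (x₁ ≠ x₂ ∧
        (max (m₁ (l + t) (l * w - w - s)) (m₂ (l * w - w - s) (l + t)) < x₁ ∧ x₁ < l * w - w) ∧
        max (m₁ (l + t) (l * w - w - s)) (m₂ (l * w - w - s) (l + t)) < x₂ ∧ x₂ < l * w - w)) by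
    obtain ⟨T, m₁, m₂, hT, h1, h2, h3⟩ := h
    have := hI.errSum_le (by omega) (by omega) (by omega) (by omega) huy h3 h1 h2
    exact Hammock.bounds_of_sum_le hl hw (e1.trans_le this.1) (e2.trans_le this.2) hT.1 hT.2
  have half : ∀ r : ℝ, r - 1 / 2 ≤ r ∧ (¬ (l = 3 ∧ w = 3) → 1 + 2 * (r - 1 / 2) ≤ 2 * r) :=
    fun r => ⟨by linarith, fun _ => by linarith⟩
  -- Two different interpolation points leave no room for smaller dimensions.
  have hK : l + w + 3 ≤ l * w := by omega
  have hl2 : l ≠ 1 := by rintro rfl; omega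
  have hw2 : w ≠ 1 := by rintro rfl; omega
  rcases Nat.lt_or_ge l 3 with hl3 | hl3
  · obtain rfl : l = 2 := by omega
    have hZ : 2 * w - w = w := by omega
    rcases Nat.lt_or_ge w 6 with h6 | h6
    · obtain rfl : w = 5 := by omega
      exact ⟨0, _, _, ⟨by linarith [Hammock.half_le_errorBound_two_five], fun _ => by
        linarith [Hammock.half_le_errorBound_two_five]⟩, Hammock.errLe_of_eq_add_three _ _ _,
        Hammock.errLe_of_eq_add_three _ _ _, .inl (by omega)⟩
    · have := Hammock.errLe_coeff_two ε h6
      rw [hZ]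
      rw [hZ] at hx'
      exact ⟨_, _, _, half _, this.1, this.2, .inl (by omega)⟩
  rcases Nat.lt_or_ge w 3 with hw3 | hw3
  · obtain rfl : w = 2 := by omega
    rcases Nat.lt_or_ge l 6 with h6 | h6
    · obtain rfl : l = 5 := by omega
      exact ⟨0, _, _, ⟨by linarith [Hammock.half_le_errorBound_five_two], fun _ => by
        linarith [Hammock.half_le_errorBound_five_two]⟩, Hammock.errLe_of_eq_add_three _ _ _,
        Hammock.errLe_of_eq_add_three _ _ _, .inl (by omega)⟩
    · have := Hammock.errLe_coeff_width_two ε h6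
      exact ⟨_, _, _, half _, this.1, this.2, .inl (by omega)⟩
  by_cases h33 : l = 3 ∧ w = 3
  · obtain ⟨rfl, rfl⟩ := h33
    exact ⟨0, _, _, ⟨Hammock.errorBound_three_three.ge, fun h => absurd ⟨rfl, rfl⟩ h⟩,
      Hammock.errLe_of_eq_add_three _ _ _, Hammock.errLe_of_eq_add_three _ _ _, .inl (by omega)⟩
  · have := Hammock.errLe_coeff ε hl3 hw3 h33
    refine ⟨_, _, _, half _, this.1, this.2, ?_⟩
    simp only [max_lt_iff]
    omega
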